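/- Let $M^k$ be a compact smooth manifold of dimension $k$ with (possibly empty) boundary $\partial M$, let $f:M\to\mathbb{R}^n$ be a smooth immersion, and give $M$ the induced metric. Fix $\xi\in\mathbb{R}^n$, let $r(x)=|f(x)-\xi|$, and assume that $f(\partial M)\subset\partial B_R=\{y:|y-\xi|=R\}$ for some $R>0$. Let $2<\gamma<k$ and let $0\le\psi\in C^1(M)$ be a function whose Laplacian $\Delta\psi$, taken in the weak sense, is a locally integrable function in the interior of $M$ (that is, $\int_M\varphi\,\Delta\psi=-\int_M\langle\nabla\varphi,\nabla\psi\rangle$ for all smooth $\varphi$ with compact support in the interior of $M$; this holds with the classical $\Delta\psi$ when $\psi\in C^2(M)$). Write $\bar\nabla r=(f-\xi)/r$, let $\top$ and $\perp$ denote the orthogonal projections onto the tangent and normal spaces of $M$, let $H$ be the mean curvature vector (the trace of the second fundamental form), let $\nu$ be the exterior unit conormal to $\partial M$, and let $$\Phi=\gamma\,|\bar\nabla r^{\perp}|^2+r\langle\bar\nabla r,H\rangle,\qquad W=\nabla\psi+(\gamma-2)\,\frac{\psi\,\bar\nabla r^{\top}}{r},$$ with $\Phi^{\pm}\ge 0$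 the positive and negative parts of $\Phi$. Then the integrals below, except possibly that of $|\Delta\psi|/r^{\gamma-2}$, converge, and equality holds in the Rellich inequality with $p=1$, that is, $\int_M|\Delta\psi|/r^{\gamma-2}<\infty$ and $$(\gamma-2)(k-\gamma)\int_M\frac{\psi}{r^\gamma}+(\gamma-2)\int_M\frac{\psi}{r^\gamma}\Phi^+=\int_M\frac{|\Delta\psi|}{r^{\gamma-2}}+(\gamma-2)\int_M\frac{\psi}{r^\gamma}\Phi^-+\int_{\partial M}\frac{1}{r^{\gamma-2}}\langle W,\nu\rangle,$$ if and only if $\Delta\psi\le 0$ almost everywhere on $M$. -/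

import Mathlib

open Set MeasureTheory
open scoped Manifold ContDiff

noncomputable section

namespace ImmersedManifold

/-! Throughout, `M` is a `k`-dimensional manifold with (possibly empty) boundary, modelled on the
half-space `{y ∈ ℝᵏ | 0 ≤ y 0}`, and `f : M → ℝⁿ` is an immersion.  `M` carries the metric induced
by `f`.  Tangent vectors of `M` at `x` are identified with their images under `df`, i.e. with
vectors of `ℝⁿ`; so `∇ψ`, the conormal and the mean curvature vector are all vectors of `ℝⁿ`. -/

variable {k n : ℕ} [NeZero k] {M : Type*} [TopologicalSpace M]
  [ChartedSpace (EuclideanHalfSpace k) M]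

/-- `∂ᵢ g` in the coordinates of the chart centred at `c`, at the coordinate point `y`. -/
def chartPartial {V : Type*} [NormedAddCommGroup V] [NormedSpace ℝ V] (g : M → V) (c : M)
    (y : EuclideanSpace ℝ (Fin k)) (i : Fin k) : V :=
  fderivWithin ℝ (g ∘ (extChartAt (𝓡∂ k) c).symm) (range (𝓡∂ k)) y (EuclideanSpace.single i 1)

/-- `∂ᵢ ∂ⱼ g` in the coordinates of the chart centred at `c`, at the coordinate point `y`. -/
def chartPartial₂ {V : Type*} [NormedAddCommGroup V] [NormedSpace ℝ V] (g : M → V) (c : M)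
    (y : EuclideanSpace ℝ (Fin k)) (i j : Fin k) : V :=
  fderivWithin ℝ (fun z => chartPartial g c z j) (range (𝓡∂ k)) y (EuclideanSpace.single i 1)

/-- The matrix `gᵢⱼ = ⟨∂ᵢ f, ∂ⱼ f⟩` of the induced metric in the chart centred at `c`. -/
def gram (f : M → EuclideanSpace ℝ (Fin n)) (c : M) (y : EuclideanSpace ℝ (Fin k)) :
    Matrix (Fin k) (Fin k) ℝ :=
  Matrix.of fun i j => inner ℝ (chartPartial f c y i) (chartPartial f c y j)

/-! ### Volume measures -/

section Measures

variable [MeasurableSpace M]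

/-- The Riemannian volume `√(det g) dy` of the domain of the chart centred at `c`, seen as a
measure on `M` (concentrated on that domain). -/
def chartVolume (f : M → EuclideanSpace ℝ (Fin n)) (c : M) : Measure M :=
  ((volume.restrict (extChartAt (𝓡∂ k) c).target).withDensity
    (fun y => ENNReal.ofReal (Real.sqrt (gram f c y).det))).map (extChartAt (𝓡∂ k) c).symm

variable (k) in
/-- The Riemannian volume measure of the induced metric.  The chart volumes agree on the overlaps
of chart domains, so their least upper bound is the measure that restricts to each of them. -/
def riemannianVolume (f : M → EuclideanSpace ℝ (Fin n)) : Measure M :=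
  ⨆ c : M, chartVolume (k := k) f c

/-- The inclusion `z ↦ (0, z)` of the boundary hyperplane `{y 0 = 0}` of the half-space. -/
def boundaryInclusion (z : EuclideanSpace ℝ {i : Fin k // i ≠ 0}) : EuclideanSpace ℝ (Fin k) :=
  WithLp.toLp 2 fun i => if h : i = 0 then 0 else z ⟨i, h⟩

/-- The matrix of the metric induced on `∂M`, in the coordinates `y i`, `i ≠ 0`. -/
def boundaryGram (f : M → EuclideanSpace ℝ (Fin n)) (c : M)
    (z : EuclideanSpace ℝ {i : Fin k // i ≠ 0}) :
    Matrix {i : Fin k // i ≠ 0} {i : Fin k // i ≠ 0} ℝ :=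
  (gram f c (boundaryInclusion z)).submatrix Subtype.val Subtype.val

/-- The `(k - 1)`-dimensional Riemannian volume of the part of `∂M` in the domain of the chart
centred at `c`, seen as a measure on `M`. -/
def chartBoundaryVolume (f : M → EuclideanSpace ℝ (Fin n)) (c : M) : Measure M :=
  ((volume.restrict (boundaryInclusion ⁻¹' (extChartAt (𝓡∂ k) c).target)).withDensity
    (fun z => ENNReal.ofReal (Real.sqrt (boundaryGram f c z).det))).map
      (fun z => (extChartAt (𝓡∂ k) c).symm (boundaryInclusion z))

variable (k) in
/-- The `(k - 1)`-dimensional Riemannian volume measure of `∂M`, seen as a measure on `M`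
concentrated on `∂M`. -/
def boundaryVolume (f : M → EuclideanSpace ℝ (Fin n)) : Measure M :=
  ⨆ c : M, chartBoundaryVolume (k := k) f c

end Measures

/-! ### Pointwise geometry; at `x` the chart centred at `x` is used -/

variable (k)

/-- `∂ᵢ g` at `x`. -/
def partialAt {V : Type*} [NormedAddCommGroup V] [NormedSpace ℝ V] (g : M → V) (x : M)
    (i : Fin k) : V :=
  chartPartial g x (extChartAt (𝓡∂ k) x x) i

/-- The inverse metric `gⁱʲ` at `x`. -/
def invGramAt (f : M → EuclideanSpace ℝ (Fin n)) (x : M) : Matrix (Fin k) (Fin k) ℝ :=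
  (gram f x (extChartAt (𝓡∂ k) x x))⁻¹

/-- The tangent space `df(TₓM)` as a subspace of `ℝⁿ`. -/
def tangentPlane (f : M → EuclideanSpace ℝ (Fin n)) (x : M) :
    Submodule ℝ (EuclideanSpace ℝ (Fin n)) :=
  Submodule.span ℝ (range (partialAt k f x))

/-- The tangential part `v^⊤` at `x` of a vector `v` of `ℝⁿ`. -/
def tangentialPart (f : M → EuclideanSpace ℝ (Fin n)) (x : M) (v : EuclideanSpace ℝ (Fin n)) :
    EuclideanSpace ℝ (Fin n) :=
  (tangentPlane k f x).starProjection v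

/-- The normal part `v^⊥` at `x` of a vector `v` of `ℝⁿ`. -/
def normalPart (f : M → EuclideanSpace ℝ (Fin n)) (x : M) (v : EuclideanSpace ℝ (Fin n)) :
    EuclideanSpace ℝ (Fin n) :=
  v - tangentialPart k f x v

/-- The gradient `∇ψ = gⁱʲ ∂ⱼψ ∂ᵢf` on `M`. -/
def gradient (f : M → EuclideanSpace ℝ (Fin n)) (ψ : M → ℝ) (x : M) :
    EuclideanSpace ℝ (Fin n) :=
  ∑ i, ∑ j, (invGramAt k f x i j * partialAt k ψ x j) • partialAt k f x i

/-- The mean curvature vector `H = tr II = gⁱʲ (∂ᵢ∂ⱼf)^⊥` (not divided by `k`). -/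
def meanCurvature (f : M → EuclideanSpace ℝ (Fin n)) (x : M) : EuclideanSpace ℝ (Fin n) :=
  ∑ i, ∑ j, invGramAt k f x i j •
    normalPart k f x (chartPartial₂ f x (extChartAt (𝓡∂ k) x x) i j)

/-- The component of the inward coordinate vector `∂₀f` orthogonal to `df(Tₓ∂M)`, for a boundary
point `x`. -/
def inwardNormal (f : M → EuclideanSpace ℝ (Fin n)) (x : M) : EuclideanSpace ℝ (Fin n) :=
  partialAt k f x 0 -
    (Submodule.span ℝ (partialAt k f x '' {i | i ≠ 0})).starProjection (partialAt k f x 0)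

/-- The outward unit conormal `ν` at a boundary point `x`: the unit vector of `df(TₓM)` that is
orthogonal to `df(Tₓ∂M)` and points out of `M`. -/
def outwardConormal (f : M → EuclideanSpace ℝ (Fin n)) (x : M) : EuclideanSpace ℝ (Fin n) :=
  -(‖inwardNormal k f x‖⁻¹ • inwardNormal k f x)

/-- `u` is the Laplacian `Δψ` (of the induced metric) of `ψ` in the weak sense: a function that is
locally integrable in the interior of `M` and satisfies `∫ φ u = -∫ ⟨∇φ, ∇ψ⟩` for all smooth `φ`
with (compact) support in the interior of `M`.  It is unique up to null sets. -/
def IsLaplacian [MeasurableSpace M] (f : M → EuclideanSpace ℝ (Fin n)) (ψ u : M → ℝ) : Prop :=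
  LocallyIntegrableOn u ((𝓡∂ k).interior M) (riemannianVolume k f) ∧
  ∀ φ : M → ℝ, ContMDiff (𝓡∂ k) 𝓘(ℝ, ℝ) ∞ φ → HasCompactSupport φ →
    tsupport φ ⊆ (𝓡∂ k).interior M →
    ∫ x, φ x * u x ∂(riemannianVolume k f) =
      -∫ x, inner ℝ (gradient k f φ x) (gradient k f ψ x) ∂(riemannianVolume k f)

/-! ### The radial distance from `ξ` -/

/-- The distance `r` from `ξ` in `ℝⁿ`, as a function on `M`. -/
def r (f : M → EuclideanSpace ℝ (Fin n)) (ξ : EuclideanSpace ℝ (Fin n)) (x : M) : ℝ :=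
  dist (f x) ξ

/-- The gradient `∇̄r` in `ℝⁿ` of the distance `r` from `ξ`, at the point `f x`. -/
def radialField (f : M → EuclideanSpace ℝ (Fin n)) (ξ : EuclideanSpace ℝ (Fin n)) (x : M) :
    EuclideanSpace ℝ (Fin n) :=
  (r f ξ x)⁻¹ • (f x - ξ)

/-- `Φ = γ |∇̄r^⊥|² + r ⟨∇̄r, H⟩`. -/
def Φ (f : M → EuclideanSpace ℝ (Fin n)) (ξ : EuclideanSpace ℝ (Fin n)) (γ : ℝ)
    (x : M) : ℝ :=
  γ * ‖normalPart k f x (radialField f ξ x)‖ ^ 2 +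
    r f ξ x * inner ℝ (radialField f ξ x) (meanCurvature k f x)

/-- The field `W = ∇ψ + (γ - 2) ψ ∇̄r^⊤ / r` of the boundary term. -/
def W (f : M → EuclideanSpace ℝ (Fin n)) (ξ : EuclideanSpace ℝ (Fin n)) (γ : ℝ)
    (ψ : M → ℝ) (x : M) : EuclideanSpace ℝ (Fin n) :=
  gradient k f ψ x + ((γ - 2) * ψ x / r f ξ x) • tangentialPart k f x (radialField f ξ x)

end ImmersedManifold

end

/-! Everything follows from one identity. The tangential field `X = r^(2-γ) W = r^(2-γ) ∇ψ + (γ-2) ψ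
r^(-γ) (f-ξ)^⊤` is built so that the terms in `⟨∇ψ, (f-ξ)^⊤⟩` cancel in its divergence. Since `div
(f-ξ)^⊤ = k + ⟨f-ξ, H⟩` and `|∇̄r^⊤|² = 1 - |∇̄r^⊥|²`, what remains is `div X = r^(2-γ) Δψ + (γ-2) ψ
r^(-γ) (k - γ + Φ)`. Integrating (`integral_laplacian_identity`) gives the Rellich relation with
`-Δψ` in place of `|Δψ|`. Equality with `|Δψ|` therefore means `∫ (|Δψ| + Δψ) / r^(γ-2) = 0`; the
integrand is nonnegative, so this says `Δψ ≤ 0` almost everywhere.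

Three analytic obstacles account for the length.

The singularity at `r = 0`: `r²` is replaced by `r² + ε` with `ε = 1/(j+1)`, and the limit is taken
by dominated convergence. The majorant `r^(-γ)` is integrable because an immersion separates nearby
points linearly and `γ < k` (`exists_norm_sub_le`, `integrable_inv_rpow_r`). On `∂M` the distance is
the constant `R`, so the boundary terms are harmless (`integral_boundary_eq`).

The low regularity: `ψ` is only `C¹` and `Δψ` is a weak Laplacian tested in the interior. The
divergence theorem is thus proved for continuous tangential fields with a weak divergence
(`integral_eq_flux`). It is tested on cutoffs which vanish near `∂M`; the derivative of the cutoff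
concentrates on a thin layer and produces the boundary flux
(`tendsto_integral_inner_gradient_cutoff`). The weak divergence of `(f-ξ)^⊤` is the first variation
formula, which in coordinates is `∂ⱼ(√g gⁱʲ ∂ᵢf) = √g H` (`sum_fderiv_volumeField`).

The integrability of `Δψ`: when `Δψ ≤ 0` it is not given and is extracted from the sign by Fatou's
lemma, once up to `∂M` (`integrable_of_hasWeakDivergence`) and once up to `r = 0`
(`integrable_laplacian_div_of_nonpos`). -/

set_option linter.unusedSectionVars false

noncomputable section

/-! ### Linear algebra of an injective linear map into an inner product space -/

namespace ImmersedManifold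

section LinearAlgebra

variable {ι : Type*} [Fintype ι] [DecidableEq ι]
  {F : Type*} [NormedAddCommGroup F] [InnerProductSpace ℝ F]

/-- The Gram matrix of the images of the standard basis vectors. -/
def gramL (J : EuclideanSpace ℝ ι →L[ℝ] F) : Matrix ι ι ℝ :=
  Matrix.of fun i j =>
    inner ℝ (J (EuclideanSpace.single i 1)) (J (EuclideanSpace.single j 1))

/-- The vector representing the covector `l` in the metric pulled back by `J`. -/
def dualVec (J : EuclideanSpace ℝ ι →L[ℝ] F) (l : EuclideanSpace ℝ ι →L[ℝ] ℝ) :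
    EuclideanSpace ℝ ι :=
  WithLp.toLp 2 fun i => ∑ j, (gramL J)⁻¹ i j * l (EuclideanSpace.single j 1)

/-- The covector `w ↦ ⟨v, J w⟩`. -/
def pairing (J : EuclideanSpace ℝ ι →L[ℝ] F) (v : F) : EuclideanSpace ℝ ι →L[ℝ] ℝ :=
  (innerSL ℝ v).comp J

@[simp] lemma pairing_apply (J : EuclideanSpace ℝ ι →L[ℝ] F) (v : F) (w : EuclideanSpace ℝ ι) :
    pairing J v w = inner ℝ v (J w) := rfl

lemma euclidean_eq_sum (w : EuclideanSpace ℝ ι) :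
    w = ∑ i, w i • EuclideanSpace.single i (1 : ℝ) := by
  ext j
  simp [Finset.sum_apply, Pi.single_apply]

lemma map_eq_sum {V : Type*} [AddCommGroup V] [Module ℝ V] [TopologicalSpace V]
    (T : EuclideanSpace ℝ ι →L[ℝ] V)
    (w : EuclideanSpace ℝ ι) : T w = ∑ i, w i • T (EuclideanSpace.single i 1) := by
  conv_lhs => rw [euclidean_eq_sum w]
  simp

lemma gramL_posDef {J : EuclideanSpace ℝ ι →L[ℝ] F} (hJ : Function.Injective J) :
    (gramL J).PosDef := by
  refine Matrix.posDef_gram_of_linearIndependent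
    (v := fun i => J (EuclideanSpace.single i 1)) ?_
  have := (EuclideanSpace.basisFun ι ℝ).toBasis.linearIndependent.map' (J : _ →ₗ[ℝ] F)
    (LinearMap.ker_eq_bot.2 hJ)
  convert! this using 1
  ext i
  simp

lemma gramL_isUnit_det {J : EuclideanSpace ℝ ι →L[ℝ] F} (hJ : Function.Injective J) :
    IsUnit (gramL J).det := (gramL_posDef hJ).det_pos.ne'.isUnit

lemma gramL_symm (J : EuclideanSpace ℝ ι →L[ℝ] F) (i j : ι) : gramL J i j = gramL J j i :=
  real_inner_comm _ _

/-- The inverse Gram matrix cancels the Gram matrix. Together with uniqueness in `eq_dualVec`, this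
replaces matrix computations in all later changes of coordinates. -/
lemma inner_dualVec {J : EuclideanSpace ℝ ι →L[ℝ] F} (hJ : Function.Injective J)
    (l : EuclideanSpace ℝ ι →L[ℝ] ℝ) (w : EuclideanSpace ℝ ι) :
    inner ℝ (J (dualVec J l)) (J w) = l w := by
  have hbase : ∀ m, inner ℝ (J (dualVec J l)) (J (EuclideanSpace.single m 1)) =
      l (EuclideanSpace.single m 1) := by
    intro m
    rw [map_eq_sum J (dualVec J l), sum_inner]
    have h1 : ∀ i, inner ℝ (dualVec J l i • J (EuclideanSpace.single i 1))
        (J (EuclideanSpace.single m 1)) = ∑ j, gramL J m i * (gramL J)⁻¹ i j *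
          l (EuclideanSpace.single j 1) := by
      intro i
      rw [real_inner_smul_left, gramL_symm J m i, dualVec, gramL]
      simp only [Matrix.of_apply, Finset.sum_mul]
      exact Finset.sum_congr rfl fun j _ => by ring
    simp_rw [h1]
    rw [Finset.sum_comm]
    simp_rw [← Finset.sum_mul]
    have h2 : ∀ j, ∑ i, gramL J m i * (gramL J)⁻¹ i j = (1 : Matrix ι ι ℝ) m j := by
      intro j
      rw [← Matrix.mul_nonsing_inv _ (gramL_isUnit_det hJ), Matrix.mul_apply]
    simp [h2, Matrix.one_apply]
  rw [map_eq_sum J w, map_eq_sum l w, inner_sum]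
  simp [real_inner_smul_right, hbase]

/-- Nondegeneracy: the image of the difference of two representing vectors is orthogonal to itself.
-/
lemma eq_dualVec {J : EuclideanSpace ℝ ι →L[ℝ] F} (hJ : Function.Injective J)
    {l : EuclideanSpace ℝ ι →L[ℝ] ℝ} {b : EuclideanSpace ℝ ι}
    (h : ∀ w, inner ℝ (J b) (J w) = l w) : b = dualVec J l := by
  apply hJ
  rw [← sub_eq_zero, ← map_sub, ← inner_self_eq_zero (𝕜 := ℝ)]
  nth_rewrite 1 [map_sub]
  rw [inner_sub_left, h, inner_dualVec hJ, sub_self]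

lemma map_dualVec_pairing {J : EuclideanSpace ℝ ι →L[ℝ] F} (hJ : Function.Injective J)
    {v : F} (hv : v ∈ range J) : J (dualVec J (pairing J v)) = v := by
  obtain ⟨b, rfl⟩ := hv
  rw [← eq_dualVec hJ (b := b) fun w => rfl]

lemma dualVec_comp {J : EuclideanSpace ℝ ι →L[ℝ] F} (hJ : Function.Injective J)
    (l : EuclideanSpace ℝ ι →L[ℝ] ℝ) {A : EuclideanSpace ℝ ι →L[ℝ] EuclideanSpace ℝ ι}
    (hA : Function.Bijective A) : A (dualVec (J.comp A) (l.comp A)) = dualVec J l := by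
  refine eq_dualVec hJ fun w => ?_
  obtain ⟨w, rfl⟩ := hA.2 w
  exact inner_dualVec (J := J.comp A) (hJ.comp hA.1) (l.comp A) w

/-- The gradient of a covector, as a vector of the target space. -/
def gradL (J : EuclideanSpace ℝ ι →L[ℝ] F) (l : EuclideanSpace ℝ ι →L[ℝ] ℝ) : F :=
  J (dualVec J l)

lemma gradL_comp {J : EuclideanSpace ℝ ι →L[ℝ] F} (hJ : Function.Injective J)
    (l : EuclideanSpace ℝ ι →L[ℝ] ℝ) {A : EuclideanSpace ℝ ι →L[ℝ] EuclideanSpace ℝ ι}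
    (hA : Function.Bijective A) : gradL (J.comp A) (l.comp A) = gradL J l := by
  rw [gradL, gradL, ← dualVec_comp hJ l hA]; rfl

lemma inner_gradL {J : EuclideanSpace ℝ ι →L[ℝ] F} (hJ : Function.Injective J)
    (l : EuclideanSpace ℝ ι →L[ℝ] ℝ) (w : EuclideanSpace ℝ ι) :
    inner ℝ (gradL J l) (J w) = l w := inner_dualVec hJ l w

lemma inner_gradL_of_mem {J : EuclideanSpace ℝ ι →L[ℝ] F} (hJ : Function.Injective J)
    (l : EuclideanSpace ℝ ι →L[ℝ] ℝ) {v : F} (hv : v ∈ range J) :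
    inner ℝ (gradL J l) v = l (dualVec J (pairing J v)) := by
  nth_rewrite 1 [← map_dualVec_pairing hJ hv]
  exact inner_gradL hJ _ _

lemma dualVec_add (J : EuclideanSpace ℝ ι →L[ℝ] F) (l l' : EuclideanSpace ℝ ι →L[ℝ] ℝ) :
    dualVec J (l + l') = dualVec J l + dualVec J l' := by
  ext i
  simp [dualVec, mul_add, Finset.sum_add_distrib]

lemma dualVec_smul (J : EuclideanSpace ℝ ι →L[ℝ] F) (a : ℝ) (l : EuclideanSpace ℝ ι →L[ℝ] ℝ) :
    dualVec J (a • l) = a • dualVec J l := by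
  ext i
  simp [dualVec, Finset.mul_sum, mul_left_comm]

lemma gradL_add (J : EuclideanSpace ℝ ι →L[ℝ] F) (l l' : EuclideanSpace ℝ ι →L[ℝ] ℝ) :
    gradL J (l + l') = gradL J l + gradL J l' := by
  simp [gradL, dualVec_add]

lemma gradL_smul (J : EuclideanSpace ℝ ι →L[ℝ] F) (a : ℝ) (l : EuclideanSpace ℝ ι →L[ℝ] ℝ) :
    gradL J (a • l) = a • gradL J l := by
  simp [gradL, dualVec_smul]

lemma gradL_eq_sum (J : EuclideanSpace ℝ ι →L[ℝ] F) (l : EuclideanSpace ℝ ι →L[ℝ] ℝ) :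
    gradL J l = ∑ i, ∑ j, ((gramL J)⁻¹ i j * l (EuclideanSpace.single j 1)) •
      J (EuclideanSpace.single i 1) := by
  rw [gradL, map_eq_sum J]
  simp [dualVec, Finset.sum_smul]

lemma span_range_basis (J : EuclideanSpace ℝ ι →L[ℝ] F) :
    Submodule.span ℝ (range fun i => J (EuclideanSpace.single i 1)) =
      LinearMap.range (J : EuclideanSpace ℝ ι →ₗ[ℝ] F) := by
  apply le_antisymm
  · rw [Submodule.span_le]
    rintro _ ⟨i, rfl⟩
    exact ⟨_, rfl⟩
  · rintro _ ⟨w, rfl⟩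
    rw [ContinuousLinearMap.coe_coe, map_eq_sum J w]
    exact Submodule.sum_mem _ fun i _ =>
      Submodule.smul_mem _ _ (Submodule.subset_span ⟨i, rfl⟩)

/-- The matrix of an endomorphism in the standard basis. -/
def stdMatrix (A : EuclideanSpace ℝ ι →L[ℝ] EuclideanSpace ℝ ι) : Matrix ι ι ℝ :=
  Matrix.of fun l i => A (EuclideanSpace.single i 1) l

lemma stdMatrix_det (A : EuclideanSpace ℝ ι →L[ℝ] EuclideanSpace ℝ ι) :
    (stdMatrix A).det = A.det := by
  rw [ContinuousLinearMap.det,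
    ← LinearMap.det_toMatrix (EuclideanSpace.basisFun ι ℝ).toBasis]
  exact congrArg Matrix.det (Matrix.ext fun i j => by
    simp [LinearMap.toMatrix_apply, stdMatrix])

lemma apply_single_eq (A : EuclideanSpace ℝ ι →L[ℝ] EuclideanSpace ℝ ι) (i : ι) :
    A (EuclideanSpace.single i 1) = ∑ l, stdMatrix A l i • EuclideanSpace.single l (1 : ℝ) :=
  euclidean_eq_sum _

lemma gramL_comp (J : EuclideanSpace ℝ ι →L[ℝ] F)
    (A : EuclideanSpace ℝ ι →L[ℝ] EuclideanSpace ℝ ι) :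
    gramL (J.comp A) = (stdMatrix A).transpose * gramL J * stdMatrix A := by
  ext i j
  simp only [gramL, Matrix.of_apply, ContinuousLinearMap.comp_apply, apply_single_eq A, map_sum,
    map_smul, sum_inner, inner_sum, real_inner_smul_left, real_inner_smul_right, Matrix.mul_apply,
    Matrix.transpose_apply, Finset.sum_mul]
  exact Finset.sum_congr rfl fun a _ => Finset.sum_congr rfl fun b _ => by ring

lemma gramL_comp_det (J : EuclideanSpace ℝ ι →L[ℝ] F)
    (A : EuclideanSpace ℝ ι →L[ℝ] EuclideanSpace ℝ ι) :
    (gramL (J.comp A)).det = A.det ^ 2 * (gramL J).det := by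
  rw [gramL_comp, Matrix.det_mul, Matrix.det_mul, Matrix.det_transpose, stdMatrix_det]
  ring

lemma isUnit_stdMatrix_det {A : EuclideanSpace ℝ ι →L[ℝ] EuclideanSpace ℝ ι}
    (hA : Function.Bijective A) : IsUnit (stdMatrix A).det := by
  rw [stdMatrix_det]
  exact LinearEquiv.isUnit_det' (LinearEquiv.ofBijective
    (A : EuclideanSpace ℝ ι →ₗ[ℝ] EuclideanSpace ℝ ι) hA)

/-- The metric trace of a bilinear map does not depend on the coordinates. -/
lemma trace_comp {V : Type*} [NormedAddCommGroup V] [NormedSpace ℝ V]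
    (J : EuclideanSpace ℝ ι →L[ℝ] F)
    {A : EuclideanSpace ℝ ι →L[ℝ] EuclideanSpace ℝ ι} (hA : Function.Bijective A)
    (B : EuclideanSpace ℝ ι →L[ℝ] EuclideanSpace ℝ ι →L[ℝ] V) :
    ∑ i, ∑ j, (gramL (J.comp A))⁻¹ i j •
        B (A (EuclideanSpace.single i 1)) (A (EuclideanSpace.single j 1)) =
      ∑ i, ∑ j, (gramL J)⁻¹ i j • B (EuclideanSpace.single i 1) (EuclideanSpace.single j 1) := by
  have hu := isUnit_stdMatrix_det hA
  have hut : IsUnit (stdMatrix A).transpose.det := by rwa [Matrix.det_transpose]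
  -- The inverse of the congruence `G' = Aᵀ G A`. The rest only reorders finite sums.
  have key : stdMatrix A * (gramL (J.comp A))⁻¹ * (stdMatrix A).transpose = (gramL J)⁻¹ := by
    rw [gramL_comp, Matrix.mul_inv_rev, Matrix.mul_inv_rev, ← Matrix.mul_assoc,
      ← Matrix.mul_assoc, Matrix.mul_nonsing_inv _ hu, Matrix.one_mul, Matrix.mul_assoc,
      Matrix.nonsing_inv_mul _ hut, Matrix.mul_one]
  have hR : ∀ l m, (gramL J)⁻¹ l m =
      ∑ j, ∑ i, stdMatrix A l i * (gramL (J.comp A))⁻¹ i j * stdMatrix A m j := by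
    intro l m
    rw [← key, Matrix.mul_apply]
    simp [Matrix.mul_apply, Finset.sum_mul]
  simp only [apply_single_eq A, map_sum, map_smul, _root_.sum_apply,
    _root_.smul_apply, hR, Finset.smul_sum, Finset.sum_smul, smul_smul]
  calc _ = ∑ i, ∑ j, ∑ l, ∑ m, ((gramL (J.comp A))⁻¹ i j * (stdMatrix A m j * stdMatrix A l i)) •
        (B (EuclideanSpace.single l 1)) (EuclideanSpace.single m 1) := by
        refine Finset.sum_congr rfl fun i _ => Finset.sum_congr rfl fun j _ => ?_
        rw [Finset.sum_comm]
    _ = ∑ l, ∑ m, ∑ i, ∑ j, ((gramL (J.comp A))⁻¹ i j * (stdMatrix A m j * stdMatrix A l i)) •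
        (B (EuclideanSpace.single l 1)) (EuclideanSpace.single m 1) := by
        calc _ = ∑ i, ∑ l, ∑ j, ∑ m, ((gramL (J.comp A))⁻¹ i j *
                (stdMatrix A m j * stdMatrix A l i)) •
              (B (EuclideanSpace.single l 1)) (EuclideanSpace.single m 1) :=
              Finset.sum_congr rfl fun i _ => Finset.sum_comm
          _ = ∑ l, ∑ i, ∑ m, ∑ j, ((gramL (J.comp A))⁻¹ i j *
                (stdMatrix A m j * stdMatrix A l i)) •
              (B (EuclideanSpace.single l 1)) (EuclideanSpace.single m 1) := by
              rw [Finset.sum_comm]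
              exact Finset.sum_congr rfl fun l _ => Finset.sum_congr rfl fun i _ =>
                Finset.sum_comm
          _ = _ := Finset.sum_congr rfl fun l _ => Finset.sum_comm
    _ = _ := by
        refine Finset.sum_congr rfl fun l _ => Finset.sum_congr rfl fun m _ => ?_
        rw [Finset.sum_comm]
        exact Finset.sum_congr rfl fun j _ => Finset.sum_congr rfl fun i _ => by
          congr 1; ring

/-- The metric trace of the metric is the dimension. -/
lemma trace_gramL {J : EuclideanSpace ℝ ι →L[ℝ] F} (hJ : Function.Injective J) :
    ∑ i, ∑ j, (gramL J)⁻¹ i j * gramL J i j = Fintype.card ι := by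
  have h : ∀ i, ∑ j, (gramL J)⁻¹ i j * gramL J i j = 1 := by
    intro i
    have := congrFun (congrFun (Matrix.nonsing_inv_mul _ (gramL_isUnit_det hJ)) i) i
    rw [Matrix.mul_apply, Matrix.one_apply_eq] at this
    rw [← this]
    exact Finset.sum_congr rfl fun j _ => by rw [gramL_symm]
  simp [h]

/-! ### The conormal to a coordinate hyperplane. -/

section Conormal

variable [FiniteDimensional ℝ F] (i₀ : ι)

/-- The component of `J e_{i₀}` orthogonal to the other `J eᵢ`. -/
def normalL (J : EuclideanSpace ℝ ι →L[ℝ] F) : F :=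
  J (EuclideanSpace.single i₀ 1) -
    (Submodule.span ℝ ((fun i => J (EuclideanSpace.single i 1)) '' {i | i ≠ i₀})).starProjection
      (J (EuclideanSpace.single i₀ 1))

lemma inner_normalL_of_mem (J : EuclideanSpace ℝ ι →L[ℝ] F) {v : F}
    (hv : v ∈ Submodule.span ℝ ((fun i => J (EuclideanSpace.single i 1)) '' {i | i ≠ i₀})) :
    inner ℝ v (normalL i₀ J) = 0 := by
  rw [real_inner_comm]
  exact Submodule.starProjection_inner_eq_zero _ _ hv

lemma inner_normalL_single (J : EuclideanSpace ℝ ι →L[ℝ] F) :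
    inner ℝ (J (EuclideanSpace.single i₀ 1)) (normalL i₀ J) = ‖normalL i₀ J‖ ^ 2 := by
  rw [← real_inner_self_eq_norm_sq]
  nth_rewrite 2 [normalL]
  rw [inner_sub_left, inner_normalL_of_mem i₀ J (Submodule.starProjection_apply_mem _ _),
    sub_zero]

/-- All `J eᵢ` with `i ≠ i₀` are orthogonal to the normal, so only the `i₀` coefficient survives.
This is how a flux becomes a coordinate component. -/
lemma inner_map_normalL (J : EuclideanSpace ℝ ι →L[ℝ] F) (b : EuclideanSpace ℝ ι) :
    inner ℝ (J b) (normalL i₀ J) = b i₀ * ‖normalL i₀ J‖ ^ 2 := by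
  rw [map_eq_sum J b, sum_inner, Finset.sum_eq_single i₀]
  · rw [real_inner_smul_left, inner_normalL_single]
  · intro i _ hi
    rw [real_inner_smul_left, inner_normalL_of_mem, mul_zero]
    exact Submodule.subset_span ⟨i, hi, rfl⟩
  · simp

lemma normalL_mem_range (J : EuclideanSpace ℝ ι →L[ℝ] F) :
    ∃ a : EuclideanSpace ℝ ι, a i₀ = 1 ∧ J a = normalL i₀ J := by
  have h : ∀ v ∈ Submodule.span ℝ ((fun i => J (EuclideanSpace.single i 1)) '' {i | i ≠ i₀}),
      ∃ a : EuclideanSpace ℝ ι, a i₀ = 0 ∧ J a = v := by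
    intro v hv
    induction hv using Submodule.span_induction with
    | mem v hv =>
      obtain ⟨i, hi, rfl⟩ := hv
      exact ⟨EuclideanSpace.single i 1, by simp [Ne.symm hi], rfl⟩
    | zero => exact ⟨0, rfl, map_zero _⟩
    | add v w _ _ hv hw =>
      obtain ⟨a, ha, rfl⟩ := hv
      obtain ⟨b, hb, rfl⟩ := hw
      exact ⟨a + b, by simp [ha, hb], map_add _ _ _⟩
    | smul t v _ hv =>
      obtain ⟨a, ha, rfl⟩ := hv
      exact ⟨t • a, by simp [ha], map_smul _ _ _⟩
  obtain ⟨a, ha, ha'⟩ := h _ (Submodule.starProjection_apply_mem _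
    (J (EuclideanSpace.single i₀ 1)))
  exact ⟨EuclideanSpace.single i₀ 1 - a, by simp [ha], by rw [map_sub, ha', normalL]⟩

lemma normalL_ne_zero {J : EuclideanSpace ℝ ι →L[ℝ] F} (hJ : Function.Injective J) :
    normalL i₀ J ≠ 0 := by
  obtain ⟨a, ha, haN⟩ := normalL_mem_range i₀ J
  intro h
  rw [← haN, ← map_zero J] at h
  rw [hJ h] at ha
  simp at ha

/-- The adjugate entry is the determinant with row `i₀` replaced by a basis vector, which is block
triangular with a `1 × 1` block. The minor is indexed by a subtype to match `boundaryGram`. -/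
lemma adjugate_apply_self (G : Matrix ι ι ℝ) :
    G.adjugate i₀ i₀ =
      (G.submatrix (Subtype.val : {i // i ≠ i₀} → ι) Subtype.val).det := by
  rw [Matrix.adjugate_apply, ← Matrix.det_transpose,
    Matrix.twoBlockTriangular_det _ (fun i => i = i₀)]
  · have h1 : ∀ (inst : Fintype {i // i = i₀}) (N : Matrix {i // i = i₀} {i // i = i₀} ℝ),
        N.det = N ⟨i₀, rfl⟩ ⟨i₀, rfl⟩ := fun _ N => Matrix.det_eq_elem_of_subsingleton N _
    rw [h1, ← Matrix.det_transpose (G.submatrix _ _)]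
    simp only [Matrix.toSquareBlockProp, Matrix.toBlock_apply, Matrix.transpose_apply,
      Matrix.updateRow_self, Pi.single_eq_same, one_mul]
    exact congrArg Matrix.det (Matrix.ext fun i j => by
      simp [Matrix.updateRow_apply, j.2])
  · rintro i hi j rfl
    simp [hi]

/-- Height times base: the squared volume of the parallelepiped spanned by the `J eᵢ` is the squared
height over a face times the squared volume of that face. -/
lemma norm_normalL_sq_mul_det {J : EuclideanSpace ℝ ι →L[ℝ] F} (hJ : Function.Injective J) :
    ‖normalL i₀ J‖ ^ 2 *
      ((gramL J).submatrix (Subtype.val : {i // i ≠ i₀} → ι) Subtype.val).det =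
      (gramL J).det := by
  obtain ⟨a, ha, haN⟩ := normalL_mem_range i₀ J
  have h0 : a = dualVec J (pairing J (normalL i₀ J)) :=
    eq_dualVec hJ fun w => by rw [haN]; rfl
  -- The covector of the normal has the single nonzero entry `‖N‖²` at `i₀`. Raising its index gives
  -- `a`, and `a i₀ = 1`.
  have h1 : (1 : ℝ) = (gramL J)⁻¹ i₀ i₀ * ‖normalL i₀ J‖ ^ 2 := by
    rw [← ha, h0, dualVec]
    simp only [pairing_apply]
    rw [Finset.sum_eq_single i₀, real_inner_comm, inner_normalL_single]
    · intro i _ hi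
      rw [real_inner_comm, inner_normalL_of_mem, mul_zero]
      exact Submodule.subset_span ⟨i, hi, rfl⟩
    · simp
  rw [Matrix.inv_def, Matrix.smul_apply, adjugate_apply_self, Ring.inverse_eq_inv,
    smul_eq_mul] at h1
  have hd := (gramL_posDef hJ).det_pos.ne'
  field_simp at h1
  rw [mul_comm]
  exact h1.symm

/-- The density relation between the outward flux and the coordinate component of a field. -/
lemma inner_conormal_mul_sqrt_det {J : EuclideanSpace ℝ ι →L[ℝ] F} (hJ : Function.Injective J)
    (b : EuclideanSpace ℝ ι) :
    inner ℝ (J b) (-(‖normalL i₀ J‖⁻¹ • normalL i₀ J)) *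
      Real.sqrt ((gramL J).submatrix (Subtype.val : {i // i ≠ i₀} → ι) Subtype.val).det =
      -(b i₀ * Real.sqrt (gramL J).det) := by
  have hN : ‖normalL i₀ J‖ ≠ 0 := norm_ne_zero_iff.2 (normalL_ne_zero i₀ hJ)
  rw [← norm_normalL_sq_mul_det i₀ hJ, Real.sqrt_mul (by positivity),
    Real.sqrt_sq (norm_nonneg _), inner_neg_right, real_inner_smul_right, inner_map_normalL]
  field_simp

/-- The conormal does not depend on the coordinates, as long as the half-space is preserved. -/
lemma normalL_comp {J : EuclideanSpace ℝ ι →L[ℝ] F} (hJ : Function.Injective J)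
    {A : EuclideanSpace ℝ ι →L[ℝ] EuclideanSpace ℝ ι} (hA : Function.Bijective A)
    (h0 : ∀ i ≠ i₀, A (EuclideanSpace.single i 1) i₀ = 0)
    (hpos : 0 ≤ A (EuclideanSpace.single i₀ 1) i₀) :
    ‖normalL i₀ (J.comp A)‖⁻¹ • normalL i₀ (J.comp A) = ‖normalL i₀ J‖⁻¹ • normalL i₀ J := by
  have hA0 : ∀ w, A w i₀ = w i₀ * A (EuclideanSpace.single i₀ 1) i₀ := by
    intro w
    have : A w i₀ = ((EuclideanSpace.proj i₀ : _ →L[ℝ] ℝ).comp A) w := rfl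
    rw [this, map_eq_sum _ w, Finset.sum_eq_single i₀]
    · rfl
    · intro i _ hi
      simp [h0 i hi]
    · simp
  set α := A (EuclideanSpace.single i₀ 1) i₀ with hα
  -- `A` is onto, and `α = 0` would confine its image to the hyperplane `w i₀ = 0`.
  have hα0 : 0 < α := by
    refine lt_of_le_of_ne hpos fun h => ?_
    obtain ⟨w, hw⟩ := hA.2 (EuclideanSpace.single i₀ 1)
    have := hA0 w
    rw [hw, ← h] at this
    simp at this
  obtain ⟨a, ha, haN⟩ := normalL_mem_range i₀ J
  obtain ⟨b, hb, hbN⟩ := normalL_mem_range i₀ (J.comp A)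
  have key : normalL i₀ (J.comp A) = α • normalL i₀ J := by
    rw [← hbN, ← haN, ← map_smul, ContinuousLinearMap.comp_apply]
    congr 1
    have hAb : A b = dualVec J (pairing J (normalL i₀ (J.comp A))) :=
      eq_dualVec hJ fun w => by rw [← hbN]; rfl
    have haa : a = dualVec J (pairing J (normalL i₀ J)) :=
      eq_dualVec hJ fun w => by rw [haN]; rfl
    -- `c` lies in the hyperplane, as does its preimage under `A`, so `J c` is orthogonal to both
    -- normals. Being a combination of them, it is orthogonal to itself and vanishes.
    set c := A b - α • a with hc
    have hc0 : c i₀ = 0 := by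
      rw [hc]; simp [hA0 b, hb, ha]
    obtain ⟨d, hd⟩ := hA.2 c
    have hd0 : d i₀ = 0 := by
      have := hA0 d
      rw [hd, hc0] at this
      exact (mul_eq_zero.1 this.symm).resolve_right hα0.ne'
    have e1 : inner ℝ (J c) (J (A b)) = 0 := by
      have : J (A b) = normalL i₀ (J.comp A) := hbN
      rw [this, ← hd]
      have := inner_map_normalL i₀ (J.comp A) d
      rw [hd0, zero_mul] at this
      exact this
    have e2 : inner ℝ (J c) (J a) = 0 := by
      rw [haN, inner_map_normalL, hc0, zero_mul]
    have e3 : inner ℝ (J c) (J c) = 0 := by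
      have : J c = J (A b) - α • J a := by rw [hc, map_sub, map_smul]
      nth_rewrite 2 [this]
      rw [inner_sub_right, e1, real_inner_smul_right, e2]
      simp
    have : c = 0 := hJ (by rw [map_zero]; exact inner_self_eq_zero.1 e3)
    exact sub_eq_zero.1 this
  rw [key, norm_smul, Real.norm_of_nonneg hα0.le, smul_smul]
  congr 1
  field_simp

end Conormal

end LinearAlgebra

end ImmersedManifold

end

noncomputable section

/-! ### First derivatives in charts -/

namespace ImmersedManifold

open Filter Topology

variable {k n : ℕ} [NeZero k] {M : Type*} [TopologicalSpace M]
  [ChartedSpace (EuclideanHalfSpace k) M]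
  {V : Type*} [NormedAddCommGroup V] [NormedSpace ℝ V]

/-- The derivative of `g` in the chart centred at `c`. -/
def chartDeriv (g : M → V) (c : M) (y : EuclideanSpace ℝ (Fin k)) :
    EuclideanSpace ℝ (Fin k) →L[ℝ] V :=
  fderivWithin ℝ (g ∘ (extChartAt (𝓡∂ k) c).symm) (range (𝓡∂ k)) y

/-- The derivative of the coordinate change from the chart at `c` to the chart at `c'`. -/
def transDeriv (c c' : M) (y : EuclideanSpace ℝ (Fin k)) :
    EuclideanSpace ℝ (Fin k) →L[ℝ] EuclideanSpace ℝ (Fin k) :=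
  chartDeriv (extChartAt (𝓡∂ k) c') c y

lemma chartPartial_eq (g : M → V) (c : M) (y : EuclideanSpace ℝ (Fin k)) (i : Fin k) :
    chartPartial g c y i = chartDeriv g c y (EuclideanSpace.single i 1) := rfl

lemma halfSpace_uniqueDiffOn : UniqueDiffOn ℝ (range (𝓡∂ k)) := (𝓡∂ k).uniqueDiffOn

lemma mem_range_halfSpace {y : EuclideanSpace ℝ (Fin k)} : y ∈ range (𝓡∂ k) ↔ 0 ≤ y 0 := by
  rw [range_modelWithCornersEuclideanHalfSpace]; rfl

lemma target_subset_range (c : M) :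
    (extChartAt (𝓡∂ k) c).target ⊆ range (𝓡∂ k) := extChartAt_target_subset_range c

lemma nonneg_of_mem_target {c : M} {y : EuclideanSpace ℝ (Fin k)}
    (hy : y ∈ (extChartAt (𝓡∂ k) c).target) : 0 ≤ y 0 :=
  mem_range_halfSpace.1 (target_subset_range c hy)

lemma target_mem_nhdsWithin {c : M} {y : EuclideanSpace ℝ (Fin k)}
    (hy : y ∈ (extChartAt (𝓡∂ k) c).target) :
    (extChartAt (𝓡∂ k) c).target ∈ 𝓝[range (𝓡∂ k)] y :=
  extChartAt_target_mem_nhdsWithin_of_mem hy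

lemma contDiffWithinAt_chart {m : WithTop ℕ∞} (hm : m ≤ ∞)
    [IsManifold (𝓡∂ k) ∞ M] {g : M → V} (hg : ContMDiff (𝓡∂ k) 𝓘(ℝ, V) m g) {c : M}
    {y : EuclideanSpace ℝ (Fin k)} (hy : y ∈ (extChartAt (𝓡∂ k) c).target) :
    ContDiffWithinAt ℝ m (g ∘ (extChartAt (𝓡∂ k) c).symm) (range (𝓡∂ k)) y := by
  have : IsManifold (𝓡∂ k) m M := IsManifold.of_le hm
  have h1 : ContMDiffOn 𝓘(ℝ, EuclideanSpace ℝ (Fin k)) (𝓡∂ k) m (extChartAt (𝓡∂ k) c).symm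
      (extChartAt (𝓡∂ k) c).target := contMDiffOn_extChartAt_symm c
  have h2 : ContMDiffOn 𝓘(ℝ, EuclideanSpace ℝ (Fin k)) 𝓘(ℝ, V) m
      (g ∘ (extChartAt (𝓡∂ k) c).symm) (extChartAt (𝓡∂ k) c).target := hg.comp_contMDiffOn h1
  exact (h2.contDiffOn y hy).mono_of_mem_nhdsWithin (target_mem_nhdsWithin hy)

lemma differentiableWithinAt_chart [IsManifold (𝓡∂ k) ∞ M] {g : M → V}
    (hg : ContMDiff (𝓡∂ k) 𝓘(ℝ, V) 1 g) {c : M}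
    {y : EuclideanSpace ℝ (Fin k)} (hy : y ∈ (extChartAt (𝓡∂ k) c).target) :
    DifferentiableWithinAt ℝ (g ∘ (extChartAt (𝓡∂ k) c).symm) (range (𝓡∂ k)) y :=
  (contDiffWithinAt_chart (by simp) hg hy).differentiableWithinAt one_ne_zero

lemma contDiffWithinAt_chartDeriv {m : WithTop ℕ∞} {m' : WithTop ℕ∞} (hm : m ≤ ∞)
    (hm' : m' + 1 ≤ m) [IsManifold (𝓡∂ k) ∞ M] {g : M → V}
    (hg : ContMDiff (𝓡∂ k) 𝓘(ℝ, V) m g) {c : M}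
    {y : EuclideanSpace ℝ (Fin k)} (hy : y ∈ (extChartAt (𝓡∂ k) c).target) :
    ContDiffWithinAt ℝ m' (chartDeriv g c) (range (𝓡∂ k)) y :=
  (contDiffWithinAt_chart hm hg hy).fderivWithin_right halfSpace_uniqueDiffOn hm'
    (target_subset_range c hy)

lemma continuousOn_chartDeriv [IsManifold (𝓡∂ k) ∞ M] {g : M → V}
    (hg : ContMDiff (𝓡∂ k) 𝓘(ℝ, V) 1 g) (c : M) :
    ContinuousOn (chartDeriv g c) (extChartAt (𝓡∂ k) c).target := fun _ hy =>
  ((contDiffWithinAt_chartDeriv (m' := 0) (by simp) (by simp) hg hy).continuousWithinAt).mono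
    (target_subset_range c)

/-! ### Coordinate changes between charts, and recognition of boundary points. -/

section Transition

variable [IsManifold (𝓡∂ k) ∞ M] {c c' : M}

lemma contDiffWithinAt_trans {y : EuclideanSpace ℝ (Fin k)}
    (hy : y ∈ (extChartAt (𝓡∂ k) c).target)
    (hy' : (extChartAt (𝓡∂ k) c).symm y ∈ (extChartAt (𝓡∂ k) c').source) :
    ContDiffWithinAt ℝ ∞ (extChartAt (𝓡∂ k) c' ∘ (extChartAt (𝓡∂ k) c).symm)
      (range (𝓡∂ k)) y :=
  contDiffWithinAt_ext_coord_change c' c (by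
    rw [PartialEquiv.trans_source]
    exact ⟨hy, hy'⟩)

lemma hasFDerivWithinAt_trans {y : EuclideanSpace ℝ (Fin k)}
    (hy : y ∈ (extChartAt (𝓡∂ k) c).target)
    (hy' : (extChartAt (𝓡∂ k) c).symm y ∈ (extChartAt (𝓡∂ k) c').source) :
    HasFDerivWithinAt (extChartAt (𝓡∂ k) c' ∘ (extChartAt (𝓡∂ k) c).symm)
      (transDeriv c c' y) (range (𝓡∂ k)) y :=
  ((contDiffWithinAt_trans hy hy').differentiableWithinAt (by simp)).hasFDerivWithinAt

lemma overlap_mem_nhdsWithin {y : EuclideanSpace ℝ (Fin k)}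
    (hy : y ∈ (extChartAt (𝓡∂ k) c).target)
    (hy' : (extChartAt (𝓡∂ k) c).symm y ∈ (extChartAt (𝓡∂ k) c').source) :
    (extChartAt (𝓡∂ k) c).target ∩ (extChartAt (𝓡∂ k) c).symm ⁻¹' (extChartAt (𝓡∂ k) c').source ∈
      𝓝[range (𝓡∂ k)] y := by
  refine inter_mem (target_mem_nhdsWithin hy) ?_
  have h := (continuousOn_extChartAt_symm (I := 𝓡∂ k) c y hy).preimage_mem_nhdsWithin
    ((isOpen_extChartAt_source (I := 𝓡∂ k) c').mem_nhds hy')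
  rwa [nhdsWithin_extChartAt_target_eq_of_mem hy] at h

/-- The chain rule, applied on the overlap of the two chart domains. The overlap is a neighbourhood
within the half-space, so the derivative there is the derivative within the half-space. -/
lemma chartDeriv_trans {g : M → V} (hg : ContMDiff (𝓡∂ k) 𝓘(ℝ, V) 1 g)
    {y : EuclideanSpace ℝ (Fin k)} (hy : y ∈ (extChartAt (𝓡∂ k) c).target)
    (hy' : (extChartAt (𝓡∂ k) c).symm y ∈ (extChartAt (𝓡∂ k) c').source) :
    chartDeriv g c y =
      (chartDeriv g c' (extChartAt (𝓡∂ k) c' ((extChartAt (𝓡∂ k) c).symm y))).comp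
        (transDeriv c c' y) := by
  have hmem := overlap_mem_nhdsWithin hy hy'
  have h1 : HasFDerivWithinAt (g ∘ (extChartAt (𝓡∂ k) c').symm)
      (chartDeriv g c' (extChartAt (𝓡∂ k) c' ((extChartAt (𝓡∂ k) c).symm y))) (range (𝓡∂ k))
      ((extChartAt (𝓡∂ k) c' ∘ (extChartAt (𝓡∂ k) c).symm) y) :=
    (differentiableWithinAt_chart hg ((extChartAt (𝓡∂ k) c').map_source hy')).hasFDerivWithinAt
  have h2 := h1.comp y ((hasFDerivWithinAt_trans hy hy').mono (s := (extChartAt (𝓡∂ k) c).target ∩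
    (extChartAt (𝓡∂ k) c).symm ⁻¹' (extChartAt (𝓡∂ k) c').source)
    (inter_subset_left.trans (target_subset_range c)))
    (fun z hz => target_subset_range c' ((extChartAt (𝓡∂ k) c').map_source hz.2))
  have h3 := h2.congr_of_eventuallyEq (f₁ := g ∘ (extChartAt (𝓡∂ k) c).symm)
    (by filter_upwards [self_mem_nhdsWithin] with z hz
        simp only [Function.comp_apply]
        rw [(extChartAt (𝓡∂ k) c').left_inv hz.2])
    (by simp only [Function.comp_apply]; rw [(extChartAt (𝓡∂ k) c').left_inv hy'])
  exact (h3.mono_of_mem_nhdsWithin hmem).fderivWithin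
    (halfSpace_uniqueDiffOn y (target_subset_range c hy))

lemma transDeriv_bijective {y : EuclideanSpace ℝ (Fin k)}
    (hy : y ∈ (extChartAt (𝓡∂ k) c).target)
    (hy' : (extChartAt (𝓡∂ k) c).symm y ∈ (extChartAt (𝓡∂ k) c').source) :
    Function.Bijective (transDeriv c c' y) := by
  have h := (𝓡∂ k).isInvertible_fderivWithin_extendCoordChange (n := ∞) (by simp)
    (IsManifold.chart_mem_maximalAtlas (I := 𝓡∂ k) (n := ∞) c)
    (IsManifold.chart_mem_maximalAtlas (I := 𝓡∂ k) (n := ∞) c') (x := y) (by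
      rw [ModelWithCorners.extendCoordChange, PartialEquiv.trans_source]
      exact ⟨hy, hy'⟩)
  have h2 : transDeriv c c' y = fderivWithin ℝ
      ((𝓡∂ k).extendCoordChange (chartAt (EuclideanHalfSpace k) c)
        (chartAt (EuclideanHalfSpace k) c'))
      ((𝓡∂ k).extendCoordChange (chartAt (EuclideanHalfSpace k) c)
        (chartAt (EuclideanHalfSpace k) c')).source y := by
    symm
    have hs : ((𝓡∂ k).extendCoordChange (chartAt (EuclideanHalfSpace k) c)
        (chartAt (EuclideanHalfSpace k) c')).source ∈ 𝓝[range (𝓡∂ k)] y := by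
      rw [ModelWithCorners.extendCoordChange, PartialEquiv.trans_source]
      exact overlap_mem_nhdsWithin hy hy'
    refine ((hasFDerivWithinAt_trans hy hy').mono ?_).fderivWithin ?_
    · rw [ModelWithCorners.extendCoordChange, PartialEquiv.trans_source]
      exact inter_subset_left.trans (target_subset_range c)
    · refine (𝓡∂ k).uniqueDiffOn_extendCoordChange_source y ?_
      rw [ModelWithCorners.extendCoordChange, PartialEquiv.trans_source]
      exact ⟨hy, hy'⟩
  rw [h2]
  exact h.bijective

/-- At a boundary point the coordinate change preserves the boundary directions and the inward
direction. -/
lemma transDeriv_boundary {y : EuclideanSpace ℝ (Fin k)}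
    (hy : y ∈ (extChartAt (𝓡∂ k) c).target)
    (hy' : (extChartAt (𝓡∂ k) c).symm y ∈ (extChartAt (𝓡∂ k) c').source)
    (h0 : extChartAt (𝓡∂ k) c' ((extChartAt (𝓡∂ k) c).symm y) 0 = 0) (hy0 : y 0 = 0) :
    (∀ i ≠ 0, transDeriv c c' y (EuclideanSpace.single i 1) 0 = 0) ∧
      0 ≤ transDeriv c c' y (EuclideanSpace.single 0 1) 0 := by
  have hd : HasFDerivWithinAt
      (fun z => (extChartAt (𝓡∂ k) c' ((extChartAt (𝓡∂ k) c).symm z)) 0)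
      ((EuclideanSpace.proj (0 : Fin k) : _ →L[ℝ] ℝ).comp (transDeriv c c' y))
      (range (𝓡∂ k)) y :=
    (EuclideanSpace.proj (0 : Fin k) : EuclideanSpace ℝ (Fin k) →L[ℝ] ℝ).hasFDerivAt
      |>.comp_hasFDerivWithinAt y (hasFDerivWithinAt_trans hy hy')
  -- The new normal coordinate is nonnegative and vanishes at `y`. Its derivative is then
  -- nonnegative along every direction `v` with `0 ≤ v 0`; using this for both `eᵢ` and `-eᵢ`, `i ≠
  -- 0`, forces zero.
  have hmin : IsLocalMinOn (fun z => (extChartAt (𝓡∂ k) c' ((extChartAt (𝓡∂ k) c).symm z)) 0)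
      (range (𝓡∂ k)) y := by
    filter_upwards [overlap_mem_nhdsWithin hy hy'] with z hz
    rw [h0]
    exact nonneg_of_mem_target ((extChartAt (𝓡∂ k) c').map_source hz.2)
  have hcone : ∀ v : EuclideanSpace ℝ (Fin k), 0 ≤ v 0 → v ∈ posTangentConeAt (range (𝓡∂ k)) y := by
    intro v hv
    refine mem_posTangentConeAt_of_segment_subset ?_
    refine (𝓡∂ k).convex_range.segment_subset (mem_range_halfSpace.2 hy0.ge)
      (mem_range_halfSpace.2 ?_)
    simp [hy0, hv]
  have hnn : ∀ v : EuclideanSpace ℝ (Fin k), 0 ≤ v 0 → 0 ≤ transDeriv c c' y v 0 :=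
    fun v hv => hmin.hasFDerivWithinAt_nonneg hd (hcone v hv)
  refine ⟨fun i hi => le_antisymm ?_ (hnn _ ?_), hnn _ (by simp)⟩
  · have := hnn (-EuclideanSpace.single i 1) (by simp [Ne.symm hi])
    rw [map_neg] at this
    simpa using this
  · simp [Ne.symm hi]

/-- Interior points are defined through the preferred chart at each point; here they are read off in
any chart whose domain contains the point. -/
lemma mem_interior_iff {x : M} (hx : x ∈ (extChartAt (𝓡∂ k) c).source) :
    x ∈ (𝓡∂ k).interior M ↔ 0 < extChartAt (𝓡∂ k) c x 0 := by
  have h := (𝓡∂ k).isInteriorPoint_iff_of_mem_atlas (n := ∞) (by simp)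
    (chart_mem_atlas (EuclideanHalfSpace k) c) (x := x) (by rwa [extChartAt_source] at hx)
  have hxt := (extChartAt (𝓡∂ k) c).map_source hx
  rw [ModelWithCorners.interior, mem_ofPred_eq, h]
  constructor
  · intro h
    have := interior_mono (target_subset_range c) h
    rw [interior_range_modelWithCornersEuclideanHalfSpace] at this
    exact this
  · intro h0
    rw [mem_interior_iff_mem_nhds]
    have h1 : range (𝓡∂ k) ∈ 𝓝 (extChartAt (𝓡∂ k) c x) := by
      rw [← mem_interior_iff_mem_nhds, interior_range_modelWithCornersEuclideanHalfSpace]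
      exact h0
    have h2 := target_mem_nhdsWithin hxt
    rwa [nhdsWithin_eq_nhds.2 h1] at h2

lemma mem_boundary_iff {x : M} (hx : x ∈ (extChartAt (𝓡∂ k) c).source) :
    x ∈ (𝓡∂ k).boundary M ↔ extChartAt (𝓡∂ k) c x 0 = 0 := by
  rw [← (𝓡∂ k).compl_interior, mem_compl_iff, mem_interior_iff hx, not_lt]
  exact ⟨fun h => le_antisymm h (nonneg_of_mem_target ((extChartAt (𝓡∂ k) c).map_source hx)),
    fun h => h.le⟩

end Transition

/-! ### Pointwise geometry expressed in a fixed chart. -/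

section Immersion

variable [IsManifold (𝓡∂ k) ∞ M] {f : M → EuclideanSpace ℝ (Fin n)}

lemma chartDeriv_self_eq_mfderiv {g : M → V} (hg : ContMDiff (𝓡∂ k) 𝓘(ℝ, V) 1 g) (x : M) :
    chartDeriv g x (extChartAt (𝓡∂ k) x x) = mfderiv (𝓡∂ k) 𝓘(ℝ, V) g x := by
  exact (hg.mdifferentiableAt one_ne_zero).mfderiv.symm

lemma chartDeriv_injective (hf : ContMDiff (𝓡∂ k) 𝓘(ℝ, EuclideanSpace ℝ (Fin n)) 1 f)
    (himm : ∀ x, Function.Injective (mfderiv (𝓡∂ k) 𝓘(ℝ, EuclideanSpace ℝ (Fin n)) f x))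
    {c : M} {y : EuclideanSpace ℝ (Fin k)} (hy : y ∈ (extChartAt (𝓡∂ k) c).target) :
    Function.Injective (chartDeriv f c y) := by
  have hy' := mem_extChartAt_source (I := 𝓡∂ k) ((extChartAt (𝓡∂ k) c).symm y)
  rw [chartDeriv_trans hf hy hy', chartDeriv_self_eq_mfderiv hf]
  exact (himm _).comp (transDeriv_bijective hy hy').1

/-- The derivative of the coordinate change from the chart at `c` to the chart at `x`. -/
lemma chartDeriv_eq_comp {g : M → V} (hg : ContMDiff (𝓡∂ k) 𝓘(ℝ, V) 1 g) {c x : M}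
    (hx : x ∈ (extChartAt (𝓡∂ k) c).source) :
    chartDeriv g c (extChartAt (𝓡∂ k) c x) = (chartDeriv g x (extChartAt (𝓡∂ k) x x)).comp
      (transDeriv c x (extChartAt (𝓡∂ k) c x)) := by
  have hx' := (extChartAt (𝓡∂ k) c).left_inv hx
  have h := chartDeriv_trans (c' := x) hg ((extChartAt (𝓡∂ k) c).map_source hx)
    (by rw [hx']; exact mem_extChartAt_source x)
  rwa [hx'] at h

lemma transDeriv_self_bijective {c x : M} (hx : x ∈ (extChartAt (𝓡∂ k) c).source) :
    Function.Bijective (transDeriv c x (extChartAt (𝓡∂ k) c x)) :=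
  transDeriv_bijective ((extChartAt (𝓡∂ k) c).map_source hx)
    (by rw [(extChartAt (𝓡∂ k) c).left_inv hx]; exact mem_extChartAt_source x)

lemma gradient_eq_gradL_self (f : M → EuclideanSpace ℝ (Fin n)) (φ : M → ℝ) (x : M) :
    gradient k f φ x = gradL (chartDeriv f x (extChartAt (𝓡∂ k) x x))
      (chartDeriv φ x (extChartAt (𝓡∂ k) x x)) :=
  (gradL_eq_sum _ _).symm

variable (hf : ContMDiff (𝓡∂ k) 𝓘(ℝ, EuclideanSpace ℝ (Fin n)) 1 f)
  (himm : ∀ x, Function.Injective (mfderiv (𝓡∂ k) 𝓘(ℝ, EuclideanSpace ℝ (Fin n)) f x))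

include hf himm

/-- `gradient` uses the chart centred at `x`, which varies with `x` without any continuity. A
formula in one fixed chart is what continuity and integration require. -/
lemma gradient_eq_gradL {φ : M → ℝ} (hφ : ContMDiff (𝓡∂ k) 𝓘(ℝ, ℝ) 1 φ) {c x : M}
    (hx : x ∈ (extChartAt (𝓡∂ k) c).source) :
    gradient k f φ x = gradL (chartDeriv f c (extChartAt (𝓡∂ k) c x))
      (chartDeriv φ c (extChartAt (𝓡∂ k) c x)) := by
  rw [gradient_eq_gradL_self, chartDeriv_eq_comp hf hx, chartDeriv_eq_comp hφ hx,
    gradL_comp (chartDeriv_injective hf himm (mem_extChartAt_target x)) _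
      (transDeriv_self_bijective hx)]

lemma tangentPlane_eq_range {c x : M} (hx : x ∈ (extChartAt (𝓡∂ k) c).source) :
    tangentPlane k f x = LinearMap.range (chartDeriv f c (extChartAt (𝓡∂ k) c x) :
      EuclideanSpace ℝ (Fin k) →ₗ[ℝ] EuclideanSpace ℝ (Fin n)) := by
  have h1 : tangentPlane k f x = LinearMap.range (chartDeriv f x (extChartAt (𝓡∂ k) x x) :
      EuclideanSpace ℝ (Fin k) →ₗ[ℝ] EuclideanSpace ℝ (Fin n)) := span_range_basis _
  rw [h1, chartDeriv_eq_comp hf hx]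
  ext v
  constructor
  · rintro ⟨w, rfl⟩
    obtain ⟨w', rfl⟩ := (transDeriv_self_bijective hx).2 w
    exact ⟨w', rfl⟩
  · rintro ⟨w, rfl⟩
    exact ⟨_, rfl⟩

/-- Restricted to boundary points because only there does the coordinate change preserve the
hyperplane directions and the inward side. -/
lemma outwardConormal_eq {c x : M} (hx : x ∈ (extChartAt (𝓡∂ k) c).source)
    (hxb : x ∈ (𝓡∂ k).boundary M) :
    outwardConormal k f x = -(‖normalL 0 (chartDeriv f c (extChartAt (𝓡∂ k) c x))‖⁻¹ •
      normalL 0 (chartDeriv f c (extChartAt (𝓡∂ k) c x))) := by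
  have hx' := (extChartAt (𝓡∂ k) c).left_inv hx
  have hb := transDeriv_boundary (c' := x) ((extChartAt (𝓡∂ k) c).map_source hx)
    (by rw [hx']; exact mem_extChartAt_source x)
    (by rw [hx']; exact (mem_boundary_iff (mem_extChartAt_source x)).1 hxb)
    ((mem_boundary_iff hx).1 hxb)
  rw [chartDeriv_eq_comp hf hx, normalL_comp 0
    (chartDeriv_injective hf himm (mem_extChartAt_target x)) (transDeriv_self_bijective hx)
    hb.1 hb.2]
  rfl

end Immersion

end ImmersedManifold

end

noncomputable section

/-! ### The first variation formula in coordinates -/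

namespace ImmersedManifold

open Filter Topology

/-! ### Differentiation of determinants and inverse matrices. -/

section Det

variable {ι : Type*} [Fintype ι] [DecidableEq ι]
  {E : Type*} [NormedAddCommGroup E] [NormedSpace ℝ E]

/-- **Jacobi's formula** for the derivative of a determinant. -/
lemma hasFDerivAt_det {G : E → Matrix ι ι ℝ} {G' : ι → ι → E →L[ℝ] ℝ} {y : E}
    (h : ∀ i j, HasFDerivAt (fun z => G z i j) (G' i j) y) :
    HasFDerivAt (fun z => (G z).det) (∑ i, ∑ j, (G y).adjugate i j • G' j i) y := by
  have h1 : HasFDerivAt (fun z => (G z).det)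
      (∑ σ : Equiv.Perm ι, ((Equiv.Perm.sign σ : ℤ) : ℝ) •
        ∑ i, (∏ j ∈ Finset.univ.erase i, G y (σ j) j) • G' (σ i) i) y := by
    simp_rw [Matrix.det_apply']
    refine HasFDerivAt.fun_sum fun σ _ => ?_
    exact (HasFDerivAt.finsetProd fun i _ => h (σ i) i).const_mul _
  convert h1 using 1
  have h2 : ∀ i, ∀ w : E, ∑ j, (G y).adjugate i j * G' j i w =
      ∑ σ : Equiv.Perm ι, ((Equiv.Perm.sign σ : ℤ) : ℝ) *
        ((∏ j ∈ Finset.univ.erase i, G y (σ j) j) * G' (σ i) i w) := by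
    intro i w
    -- The Leibniz terms in which column `i` is the differentiated one reassemble to the determinant
    -- with that column replaced, that is, to Cramer's rule.
    have : ∑ j, (G y).adjugate i j * G' j i w =
        ((G y).updateCol i fun j => G' j i w).det := by
      rw [← Matrix.cramer_apply, Matrix.cramer_eq_adjugate_mulVec]
      rfl
    rw [this, Matrix.det_apply']
    refine Finset.sum_congr rfl fun σ _ => ?_
    rw [← Finset.mul_prod_erase _ _ (Finset.mem_univ i), Matrix.updateCol_self, mul_comm (G' _ _ _)]
    congr 2
    refine Finset.prod_congr rfl fun j hj => ?_
    rw [Matrix.updateCol_ne (Finset.ne_of_mem_erase hj)]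
  ext w
  simp only [_root_.sum_apply, _root_.smul_apply, smul_eq_mul, h2, Finset.mul_sum]
  exact Finset.sum_comm

lemma contDiffOn_det {m : WithTop ℕ∞} {G : E → Matrix ι ι ℝ} {s : Set E}
    (h : ∀ i j, ContDiffOn ℝ m (fun z => G z i j) s) :
    ContDiffOn ℝ m (fun z => (G z).det) s := by
  simp_rw [Matrix.det_apply']
  exact ContDiffOn.sum fun σ _ => contDiffOn_const.mul (contDiffOn_prod fun i _ => h _ _)

lemma contDiffOn_inv {m : WithTop ℕ∞} {G : E → Matrix ι ι ℝ} {s : Set E}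
    (h : ∀ i j, ContDiffOn ℝ m (fun z => G z i j) s) (hd : ∀ y ∈ s, (G y).det ≠ 0) (i j : ι) :
    ContDiffOn ℝ m (fun z => (G z)⁻¹ i j) s := by
  simp_rw [Matrix.inv_def, Ring.inverse_eq_inv, Matrix.smul_apply, smul_eq_mul,
    Matrix.adjugate_apply]
  refine ((contDiffOn_det h).inv hd).mul (contDiffOn_det fun a b => ?_)
  simp only [Matrix.updateRow_apply]
  split_ifs
  · exact contDiffOn_const
  · exact h a b

end Det

/-! ### Divergence of `√g gⁱʲ ∂ᵢf` and integration by parts. -/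

section FirstVariation

variable {ι : Type*} [Fintype ι] [DecidableEq ι]
  {F : Type*} [NormedAddCommGroup F] [InnerProductSpace ℝ F] [FiniteDimensional ℝ F]

lemma integral_fderiv_eq_zero {g : EuclideanSpace ℝ ι → ℝ} (hg : ContDiff ℝ 1 g)
    (hc : HasCompactSupport g) (v : EuclideanSpace ℝ ι) : ∫ y, fderiv ℝ g y v = 0 := by
  have hd : Continuous fun y => fderiv ℝ g y v :=
    (hg.continuous_fderiv one_ne_zero).clm_apply continuous_const
  have h := integral_mul_fderiv_eq_neg_fderiv_mul_of_integrable (μ := volume)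
    (f := fun _ : EuclideanSpace ℝ ι => (1 : ℝ)) (g := g) (v := v) (by simp)
    (by simpa using hd.integrable_of_hasCompactSupport (hc.fderiv_apply ℝ v))
    (by simpa using hg.continuous.integrable_of_hasCompactSupport hc)
    (fun x _ => differentiableAt_const _) (fun x _ => hg.differentiable one_ne_zero x)
  simpa using h

/-- The field `√g gⁱʲ ∂ᵢf`. -/
def volumeField (f : EuclideanSpace ℝ ι → F) (j : ι) (y : EuclideanSpace ℝ ι) : F :=
  ∑ i, (Real.sqrt (gramL (fderiv ℝ f y)).det * (gramL (fderiv ℝ f y))⁻¹ i j) •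
    fderiv ℝ f y (EuclideanSpace.single i 1)

/-- The metric trace of the normal part of the second derivative. -/
def normalTrace (J : EuclideanSpace ℝ ι →L[ℝ] F)
    (B : EuclideanSpace ℝ ι →L[ℝ] EuclideanSpace ℝ ι →L[ℝ] F) : F :=
  ∑ i, ∑ j, (gramL J)⁻¹ i j • (B (EuclideanSpace.single i 1) (EuclideanSpace.single j 1) -
    (LinearMap.range (J : EuclideanSpace ℝ ι →ₗ[ℝ] F)).starProjection
      (B (EuclideanSpace.single i 1) (EuclideanSpace.single j 1)))

variable {U : Set (EuclideanSpace ℝ ι)} {f : EuclideanSpace ℝ ι → F}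

lemma contDiffOn_gramL {J : EuclideanSpace ℝ ι → EuclideanSpace ℝ ι →L[ℝ] F} {m : WithTop ℕ∞}
    (hJ : ContDiffOn ℝ m J U) (i j : ι) : ContDiffOn ℝ m (fun y => gramL (J y) i j) U :=
  (hJ.clm_apply contDiffOn_const).inner ℝ (hJ.clm_apply contDiffOn_const)

lemma contDiffOn_volumeField (hU : IsOpen U) (hf : ContDiffOn ℝ 2 f U)
    (hJ : ∀ y ∈ U, Function.Injective (fderiv ℝ f y)) (j : ι) :
    ContDiffOn ℝ 1 (volumeField f j) U := by
  have h1 : ContDiffOn ℝ 1 (fderiv ℝ f) U := hf.fderiv_of_isOpen hU (by norm_num)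
  have hp := fun y (hy : y ∈ U) => (gramL_posDef (hJ y hy)).det_pos.ne'
  refine ContDiffOn.sum fun i _ => ContDiffOn.smul (ContDiffOn.mul ?_ ?_)
    (h1.clm_apply contDiffOn_const)
  · exact (contDiffOn_det (contDiffOn_gramL h1)).sqrt hp
  · exact contDiffOn_inv (contDiffOn_gramL h1) hp i j

/-- The fields are `√g` times the basis dual to `∂ₗf`. Differentiating this relation yields the
tangential part of their divergence. -/
lemma inner_volumeField {y : EuclideanSpace ℝ ι} (hJ : Function.Injective (fderiv ℝ f y))
    (j l : ι) :
    inner ℝ (volumeField f j y) (fderiv ℝ f y (EuclideanSpace.single l 1)) =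
      if j = l then Real.sqrt (gramL (fderiv ℝ f y)).det else 0 := by
  have h := congrFun (congrFun (Matrix.mul_nonsing_inv _ (gramL_isUnit_det hJ)) l) j
  rw [Matrix.mul_apply, Matrix.one_apply] at h
  rw [volumeField, sum_inner]
  simp_rw [real_inner_smul_left, mul_assoc]
  rw [← Finset.mul_sum]
  have h2 : ∑ i, (gramL (fderiv ℝ f y))⁻¹ i j *
      inner ℝ (fderiv ℝ f y (EuclideanSpace.single i 1))
        (fderiv ℝ f y (EuclideanSpace.single l 1)) = if l = j then 1 else 0 := by
    rw [← h]
    refine Finset.sum_congr rfl fun i _ => ?_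
    rw [gramL_symm, mul_comm]
    rfl
  rw [h2]
  by_cases hjl : j = l
  · simp [hjl]
  · simp [hjl, Ne.symm hjl]

lemma inv_gramL_symm (J : EuclideanSpace ℝ ι →L[ℝ] F) (i j : ι) :
    (gramL J)⁻¹ i j = (gramL J)⁻¹ j i := by
  have h : (gramL J).transpose = gramL J := Matrix.ext fun i j => gramL_symm J j i
  nth_rewrite 1 [← h]
  rw [← Matrix.transpose_nonsing_inv]
  rfl

/-- The divergence of `√g gⁱʲ ∂ᵢf` is `√g` times the mean curvature vector. -/
lemma sum_fderiv_volumeField (hU : IsOpen U) (hf : ContDiffOn ℝ 2 f U)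
    (hJ : ∀ y ∈ U, Function.Injective (fderiv ℝ f y)) {y : EuclideanSpace ℝ ι} (hy : y ∈ U) :
    ∑ j, fderiv ℝ (volumeField f j) y (EuclideanSpace.single j 1) =
      Real.sqrt (gramL (fderiv ℝ f y)).det •
        normalTrace (fderiv ℝ f y) (fderiv ℝ (fderiv ℝ f) y) := by
  have hyn := hU.mem_nhds hy
  have h1 : ContDiffOn ℝ 1 (fderiv ℝ f) U := hf.fderiv_of_isOpen hU (by norm_num)
  have hdJ : HasFDerivAt (fderiv ℝ f) (fderiv ℝ (fderiv ℝ f) y) y :=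
    ((h1.contDiffAt hyn).differentiableAt one_ne_zero).hasFDerivAt
  have hpos := (gramL_posDef (hJ y hy)).det_pos
  set B := fderiv ℝ (fderiv ℝ f) y with hB
  set J := fderiv ℝ f y with hJdef
  set a : EuclideanSpace ℝ ι → ℝ := fun z => Real.sqrt (gramL (fderiv ℝ f z)).det with ha
  have hsymm : ∀ v w, B v w = B w v := fun v w =>
    (hf.contDiffAt hyn).isSymmSndFDerivAt (by simp) v w
  have hei : ∀ i, HasFDerivAt (fun z => fderiv ℝ f z (EuclideanSpace.single i 1))
      (B.flip (EuclideanSpace.single i 1)) y := fun i => by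
    simpa using hdJ.clm_apply (hasFDerivAt_const (EuclideanSpace.single i (1 : ℝ)) y)
  have hG : ∀ i j, HasFDerivAt (fun z => gramL (fderiv ℝ f z) i j)
      ((innerSL ℝ (J (EuclideanSpace.single j 1))).comp (B.flip (EuclideanSpace.single i 1)) +
        (innerSL ℝ (J (EuclideanSpace.single i 1))).comp (B.flip (EuclideanSpace.single j 1)))
      y := fun i j => by
    refine ((hei i).inner ℝ (hei j)).congr_fderiv ?_
    ext w
    simp [fderivInnerCLM_apply, real_inner_comm, add_comm, hJdef]
  have hdet := hasFDerivAt_det hG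
  have hinvsm := contDiffOn_inv (contDiffOn_gramL h1)
    (fun z hz => (gramL_posDef (hJ z hz)).det_pos.ne')
  have hcoef : ∀ i j, DifferentiableAt ℝ (fun z => a z * (gramL (fderiv ℝ f z))⁻¹ i j) y :=
    fun i j => ((((contDiffOn_det (contDiffOn_gramL h1)).sqrt
      (fun z hz => (gramL_posDef (hJ z hz)).det_pos.ne')).mul
        (hinvsm i j)).contDiffAt hyn).differentiableAt one_ne_zero
  have hadiff : HasFDerivAt a ((1 / (2 * Real.sqrt (gramL J).det)) •
      ∑ i, ∑ j, (gramL J).adjugate i j •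
        ((innerSL ℝ (J (EuclideanSpace.single i 1))).comp (B.flip (EuclideanSpace.single j 1)) +
        (innerSL ℝ (J (EuclideanSpace.single j 1))).comp (B.flip (EuclideanSpace.single i 1))))
      y := hdet.sqrt hpos.ne'
  have hZ : ∀ j, HasFDerivAt (volumeField f j) (fderiv ℝ (volumeField f j) y) y := fun j =>
    (((contDiffOn_volumeField hU hf hJ j).contDiffAt hyn).differentiableAt
      one_ne_zero).hasFDerivAt
  set v := ∑ j, fderiv ℝ (volumeField f j) y (EuclideanSpace.single j 1) with hv
  -- the tangential components vanish
  have htan : ∀ l, inner ℝ v (J (EuclideanSpace.single l 1)) = 0 := by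
    intro l
    -- The product rule applied to `⟨Zⱼ, ∂ₗf⟩ = √g δⱼₗ`, differentiated in direction `j`.
    have hl : ∀ j, inner ℝ (fderiv ℝ (volumeField f j) y (EuclideanSpace.single j 1))
        (J (EuclideanSpace.single l 1)) + inner ℝ (volumeField f j y)
        (B (EuclideanSpace.single j 1) (EuclideanSpace.single l 1)) =
        if j = l then fderiv ℝ a y (EuclideanSpace.single l 1) else 0 := by
      intro j
      have e1 := (hZ j).inner ℝ (hei l)
      have e2 : (fun z => inner ℝ (volumeField f j z)
          (fderiv ℝ f z (EuclideanSpace.single l 1))) =ᶠ[𝓝 y]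
          fun z => if j = l then a z else 0 := by
        filter_upwards [hyn] with z hz
        exact inner_volumeField (hJ z hz) j l
      have e3 := e2.fderiv_eq (𝕜 := ℝ)
      rw [e1.fderiv] at e3
      have e4 := DFunLike.congr_fun e3 (EuclideanSpace.single j (1 : ℝ))
      simp only [ContinuousLinearMap.comp_apply, fderivInnerCLM_apply,
        ContinuousLinearMap.prod_apply, ContinuousLinearMap.flip_apply] at e4
      rw [add_comm, e4]
      by_cases hjl : j = l
      · subst hjl; simp
      · simp [hjl]
    have hsum := Finset.sum_congr (rfl : Finset.univ = Finset.univ) fun j _ => hl j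
    rw [Finset.sum_add_distrib, ← sum_inner, Finset.sum_ite_eq' Finset.univ l,
      if_pos (Finset.mem_univ l), hadiff.fderiv] at hsum
    -- Jacobi's formula gives `∂ₗ√g = √g gⁱʲ ⟨∂ᵢf, ∂ⱼ∂ₗf⟩`, exactly what cancels the tangential
    -- component `⟨v, ∂ₗf⟩`.
    have hjac : ∑ j, inner ℝ (volumeField f j y)
        (B (EuclideanSpace.single j 1) (EuclideanSpace.single l 1)) =
        ((1 / (2 * Real.sqrt (gramL J).det)) •
      ∑ i, ∑ j, (gramL J).adjugate i j •
        ((innerSL ℝ (J (EuclideanSpace.single i 1))).comp (B.flip (EuclideanSpace.single j 1)) +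
        (innerSL ℝ (J (EuclideanSpace.single j 1))).comp (B.flip (EuclideanSpace.single i 1))))
        (EuclideanSpace.single l 1) := by
      have hadj : ∀ i j, (gramL J).adjugate i j = (gramL J).det * (gramL J)⁻¹ i j := by
        intro i j
        rw [Matrix.inv_def, Matrix.smul_apply, Ring.inverse_eq_inv, smul_eq_mul,
          mul_inv_cancel_left₀ hpos.ne']
      set T : ι → ι → ℝ := fun i j => inner ℝ (J (EuclideanSpace.single i 1))
        (B (EuclideanSpace.single j 1) (EuclideanSpace.single l 1)) with hT
      have eL : ∑ j, inner ℝ (volumeField f j y)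
          (B (EuclideanSpace.single j 1) (EuclideanSpace.single l 1)) =
          Real.sqrt (gramL J).det * ∑ i, ∑ j, (gramL J)⁻¹ i j * T i j := by
        simp only [volumeField, sum_inner, real_inner_smul_left, Finset.mul_sum]
        rw [Finset.sum_comm]
        exact Finset.sum_congr rfl fun i _ => Finset.sum_congr rfl fun j _ => by
          rw [mul_assoc]
      have eR : ∑ i, ∑ j, (gramL J)⁻¹ i j * T j i = ∑ i, ∑ j, (gramL J)⁻¹ i j * T i j := by
        rw [Finset.sum_comm]
        exact Finset.sum_congr rfl fun i _ => Finset.sum_congr rfl fun j _ => by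
          rw [inv_gramL_symm]
      have eS : ∑ i, ∑ j, (gramL J).adjugate i j * (T i j + T j i) =
          (gramL J).det * (2 * ∑ i, ∑ j, (gramL J)⁻¹ i j * T i j) := by
        rw [two_mul]
        nth_rewrite 2 [← eR]
        simp only [hadj, mul_add, Finset.mul_sum, Finset.sum_add_distrib, mul_assoc]
      rw [eL]
      simp only [_root_.smul_apply, _root_.sum_apply, _root_.add_apply,
        ContinuousLinearMap.comp_apply, ContinuousLinearMap.flip_apply, innerSL_apply_apply,
        smul_eq_mul]
      have eT : ∀ i j, inner ℝ (J (EuclideanSpace.single i 1))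
          (B (EuclideanSpace.single l 1) (EuclideanSpace.single j 1)) = T i j := fun i j => by
        rw [hsymm]
      simp only [eT, eS]
      have hs : Real.sqrt (gramL J).det ≠ 0 := (Real.sqrt_pos.2 hpos).ne'
      have hss := Real.mul_self_sqrt hpos.le
      field_simp
      rw [sq, hss, mul_comm]
    rw [hjac] at hsum
    linarith
  have hvperp : ∀ w ∈ LinearMap.range (J : EuclideanSpace ℝ ι →ₗ[ℝ] F), inner ℝ v w = 0 := by
    rintro _ ⟨w, rfl⟩
    rw [ContinuousLinearMap.coe_coe, map_eq_sum J w, inner_sum]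
    simp [real_inner_smul_right, htan]
  set P := (LinearMap.range (J : EuclideanSpace ℝ ι →ₗ[ℝ] F)).starProjection with hP
  -- the normal components
  have hform : v = ∑ j, ∑ i, ((a y * (gramL J)⁻¹ i j) •
      B (EuclideanSpace.single j 1) (EuclideanSpace.single i 1) +
      (fderiv ℝ (fun z => a z * (gramL (fderiv ℝ f z))⁻¹ i j) y (EuclideanSpace.single j 1)) •
        J (EuclideanSpace.single i 1)) := by
    rw [hv]
    refine Finset.sum_congr rfl fun j _ => ?_
    have : HasFDerivAt (volumeField f j) _ y :=
      HasFDerivAt.fun_sum fun i _ => (hcoef i j).hasFDerivAt.smul (hei i)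
    rw [this.fderiv]
    simp [hJdef, ha]
  have hPv : P v = 0 := by
    rw [hP, Submodule.starProjection_apply_eq_zero_iff, Submodule.mem_orthogonal]
    intro w hw
    rw [real_inner_comm]
    exact hvperp w hw
  have hPJ : ∀ w, P (J w) = J w := fun w =>
    Submodule.starProjection_eq_self_iff.2 ⟨w, rfl⟩
  -- As `v` is normal, its projection may be subtracted for free. The terms in which the
  -- coefficients are differentiated are tangential and drop out, leaving the trace of the normal
  -- second derivatives.
  have : v = v - P v := by rw [hPv, sub_zero]
  rw [this, hform]
  simp only [map_sum, map_add, map_smul, hPJ, ← Finset.sum_sub_distrib, add_sub_add_right_eq_sub,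
    normalTrace, Finset.smul_sum, smul_smul, ← smul_sub]
  rw [Finset.sum_comm]
  refine Finset.sum_congr rfl fun i _ => Finset.sum_congr rfl fun j _ => ?_
  rw [hsymm]

/-- The **first variation formula** in coordinates. -/
theorem integral_firstVariation (hU : IsOpen U) (hf : ContDiffOn ℝ 2 f U)
    (hJ : ∀ y ∈ U, Function.Injective (fderiv ℝ f y)) {K : Set (EuclideanSpace ℝ ι)}
    (hK : IsCompact K) (hKU : K ⊆ U) {Y : EuclideanSpace ℝ ι → F} (hY : ContDiffOn ℝ 1 Y U)
    (hY0 : ∀ y ∈ U \ K, Y y = 0) :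
    ∫ y in U, Real.sqrt (gramL (fderiv ℝ f y)).det *
      (∑ i, ∑ j, (gramL (fderiv ℝ f y))⁻¹ i j *
          inner ℝ (fderiv ℝ Y y (EuclideanSpace.single j 1))
            (fderiv ℝ f y (EuclideanSpace.single i 1)) +
        inner ℝ (Y y) (normalTrace (fderiv ℝ f y) (fderiv ℝ (fderiv ℝ f) y))) = 0 := by
  classical
  -- Extended by zero, the components of `Y` against the fields `Zⱼ` are `C¹` with compact support
  -- on the whole space, so the integral of their divergence vanishes.
  set V : ι → EuclideanSpace ℝ ι → ℝ := fun j => U.indicator fun y =>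
    inner ℝ (Y y) (volumeField f j y) with hV
  have hVU : ∀ j, ∀ y ∈ U, V j =ᶠ[𝓝 y] fun y => inner ℝ (Y y) (volumeField f j y) :=
    fun j y hy => by
      filter_upwards [hU.mem_nhds hy] with z hz
      exact indicator_of_mem hz _
  have hV0 : ∀ j, ∀ y ∉ K, V j y = 0 := by
    intro j y hy
    by_cases hyU : y ∈ U
    · rw [hV]
      simp only [indicator_of_mem hyU, hY0 y ⟨hyU, hy⟩, inner_zero_left]
    · exact indicator_of_notMem hyU _
  have hVsm : ∀ j, ContDiff ℝ 1 (V j) := by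
    intro j
    rw [contDiff_iff_contDiffAt]
    intro y
    by_cases hy : y ∈ U
    · exact (((hY.inner ℝ (contDiffOn_volumeField hU hf hJ j)).contDiffAt
        (hU.mem_nhds hy))).congr_of_eventuallyEq (hVU j y hy)
    · have : V j =ᶠ[𝓝 y] fun _ => 0 := by
        filter_upwards [hK.isClosed.isOpen_compl.mem_nhds fun h => hy (hKU h)] with z hz
        exact hV0 j z hz
      exact contDiffAt_const.congr_of_eventuallyEq this
  have hVc : ∀ j, HasCompactSupport (V j) := fun j =>
    HasCompactSupport.intro hK (hV0 j)
  have hint : ∀ j, Integrable fun y => fderiv ℝ (V j) y (EuclideanSpace.single j 1) := fun j =>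
    (((hVsm j).continuous_fderiv one_ne_zero).clm_apply
      continuous_const).integrable_of_hasCompactSupport ((hVc j).fderiv_apply ℝ _)
  have hsum : ∫ y, ∑ j, fderiv ℝ (V j) y (EuclideanSpace.single j 1) = 0 := by
    rw [integral_finsetSum _ fun j _ => hint j]
    exact Finset.sum_eq_zero fun j _ => integral_fderiv_eq_zero (hVsm j) (hVc j) _
  rw [← hsum, ← integral_indicator hU.measurableSet]
  congr 1
  ext y
  by_cases hy : y ∈ U
  · rw [indicator_of_mem hy]
    have hdY : DifferentiableAt ℝ Y y :=
      (hY.contDiffAt (hU.mem_nhds hy)).differentiableAt one_ne_zero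
    have hdZ : ∀ j, DifferentiableAt ℝ (volumeField f j) y := fun j =>
      ((contDiffOn_volumeField hU hf hJ j).contDiffAt (hU.mem_nhds hy)).differentiableAt
        one_ne_zero
    have hdV : ∀ j, fderiv ℝ (V j) y (EuclideanSpace.single j 1) =
        inner ℝ (Y y) (fderiv ℝ (volumeField f j) y (EuclideanSpace.single j 1)) +
        inner ℝ (fderiv ℝ Y y (EuclideanSpace.single j 1)) (volumeField f j y) := by
      intro j
      rw [(hVU j y hy).fderiv_eq, fderiv_inner_apply ℝ hdY (hdZ j)]
    simp only [hdV, Finset.sum_add_distrib, ← inner_sum, sum_fderiv_volumeField hU hf hJ hy]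
    rw [real_inner_smul_right, mul_add, add_comm]
    congr 1
    rw [Finset.sum_comm, Finset.mul_sum]
    refine Finset.sum_congr rfl fun j _ => ?_
    rw [volumeField, inner_sum, Finset.mul_sum]
    refine Finset.sum_congr rfl fun i _ => ?_
    rw [real_inner_smul_right]
    ring
  · rw [indicator_of_notMem hy]
    symm
    refine Finset.sum_eq_zero fun j _ => ?_
    have : V j =ᶠ[𝓝 y] fun _ => 0 := by
      filter_upwards [hK.isClosed.isOpen_compl.mem_nhds fun h => hy (hKU h)] with z hz
      exact hV0 j z hz
    rw [this.fderiv_eq]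
    simp

end FirstVariation

end ImmersedManifold

end

noncomputable section

/-! ### Cutoff functions at the boundary of the half-space -/

namespace ImmersedManifold

open Filter Topology

/-- The derivative vanishes on the open half-line, and at the endpoint by continuity. -/
lemma deriv_smoothTransition_of_neg {x : ℝ} (hx : x ≤ 0) : deriv Real.smoothTransition x = 0 := by
  have hc : Continuous (deriv Real.smoothTransition) :=
    (Real.smoothTransition.contDiff (n := 1)).continuous_deriv le_rfl
  have hcl : IsClosed {x | deriv Real.smoothTransition x = 0} := isClosed_eq hc continuous_const
  have hsub : Iio (0 : ℝ) ⊆ {x | deriv Real.smoothTransition x = 0} := by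
    intro x hx
    have : Real.smoothTransition =ᶠ[𝓝 x] fun _ => 0 := by
      filter_upwards [Iio_mem_nhds hx] with z hz
      exact Real.smoothTransition.zero_of_nonpos hz.le
    simp [this.deriv_eq]
  have := hcl.closure_subset_iff.2 hsub
  rw [closure_Iio] at this
  exact this hx

lemma deriv_smoothTransition_of_one_le {x : ℝ} (hx : 1 ≤ x) :
    deriv Real.smoothTransition x = 0 := by
  have hc : Continuous (deriv Real.smoothTransition) :=
    (Real.smoothTransition.contDiff (n := 1)).continuous_deriv le_rfl
  have hcl : IsClosed {x | deriv Real.smoothTransition x = 0} := isClosed_eq hc continuous_const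
  have hsub : Ioi (1 : ℝ) ⊆ {x | deriv Real.smoothTransition x = 0} := by
    intro x hx
    have : Real.smoothTransition =ᶠ[𝓝 x] fun _ => 1 := by
      filter_upwards [Ioi_mem_nhds hx] with z hz
      exact Real.smoothTransition.one_of_one_le hz.le
    simp [this.deriv_eq]
  have := hcl.closure_subset_iff.2 hsub
  rw [closure_Ioi] at this
  exact this hx

lemma continuous_deriv_smoothTransition : Continuous (deriv Real.smoothTransition) :=
  (Real.smoothTransition.contDiff (n := 1)).continuous_deriv le_rfl

lemma integrable_deriv_smoothTransition : Integrable (deriv Real.smoothTransition) :=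
  continuous_deriv_smoothTransition.integrable_of_hasCompactSupport
    (HasCompactSupport.intro (isCompact_Icc (a := (0 : ℝ)) (b := 1)) fun x hx => by
      rw [mem_Icc, not_and_or, not_le, not_le] at hx
      rcases hx with h | h
      · exact deriv_smoothTransition_of_neg h.le
      · exact deriv_smoothTransition_of_one_le h.le)

lemma integral_deriv_smoothTransition : ∫ x, deriv Real.smoothTransition x = 1 := by
  have := integral_of_hasDerivAt_of_tendsto (f := Real.smoothTransition)
    (f' := deriv Real.smoothTransition) (m := 0) (n := 1)
    (fun x => ((Real.smoothTransition.contDiff (n := 1)).differentiable one_ne_zero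
      x).hasDerivAt) integrable_deriv_smoothTransition
    (tendsto_const_nhds.congr' (by
      filter_upwards [Iic_mem_atBot (0 : ℝ)] with x hx
      rw [Real.smoothTransition.zero_of_nonpos hx]))
    (tendsto_const_nhds.congr' (by
      filter_upwards [Ici_mem_atTop (1 : ℝ)] with x hx
      rw [Real.smoothTransition.one_of_one_le hx]))
  rw [this, sub_zero]

variable {k : ℕ} [NeZero k]

/-- The point of `ℝᵏ` with normal coordinate `t` and boundary coordinates `z`. -/
def slab (p : ℝ × EuclideanSpace ℝ {i : Fin k // i ≠ 0}) : EuclideanSpace ℝ (Fin k) :=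
  WithLp.toLp 2 fun i => if h : i = 0 then p.1 else p.2 ⟨i, h⟩

@[simp] lemma slab_zero (p : ℝ × EuclideanSpace ℝ {i : Fin k // i ≠ 0}) : slab p 0 = p.1 := by
  simp [slab]

lemma slab_apply_ne (p : ℝ × EuclideanSpace ℝ {i : Fin k // i ≠ 0}) (i : {i : Fin k // i ≠ 0}) :
    slab p i = p.2 i := by
  simp [slab, i.2]

lemma slab_boundary (z : EuclideanSpace ℝ {i : Fin k // i ≠ 0}) :
    slab (0, z) = boundaryInclusion z := rfl

lemma continuous_slab : Continuous (slab (k := k)) := by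
  refine (PiLp.continuous_toLp 2 _).comp (continuous_pi fun i => ?_)
  by_cases h : i = 0
  · simp only [h, dite_true]; exact continuous_fst
  · simp only [h, dite_false]
    exact (PiLp.continuous_apply 2 _ _).comp continuous_snd

lemma continuous_boundaryInclusion : Continuous (boundaryInclusion (k := k)) :=
  continuous_slab.comp (Continuous.prodMk_right 0)

lemma norm_snd_le_norm_slab (p : ℝ × EuclideanSpace ℝ {i : Fin k // i ≠ 0}) :
    ‖p.2‖ ≤ ‖slab p‖ := by
  rw [EuclideanSpace.norm_eq, EuclideanSpace.norm_eq]
  apply Real.sqrt_le_sqrt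
  calc ∑ i, ‖p.2 i‖ ^ 2 = ∑ i : {i : Fin k // i ≠ 0}, ‖slab p i‖ ^ 2 :=
        Finset.sum_congr rfl fun i _ => by rw [slab_apply_ne]
    _ = ∑ i ∈ Finset.univ.filter (fun i : Fin k => i ≠ 0), ‖slab p i‖ ^ 2 := by
        rw [← Finset.sum_subtype_eq_sum_filter]
        simp
    _ ≤ ∑ i, ‖slab p i‖ ^ 2 :=
        Finset.sum_le_sum_of_subset_of_nonneg (Finset.filter_subset _ _)
          fun _ _ _ => by positivity

lemma abs_fst_le_norm_slab (p : ℝ × EuclideanSpace ℝ {i : Fin k // i ≠ 0}) :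
    |p.1| ≤ ‖slab p‖ := by
  have := PiLp.norm_apply_le (slab p) 0
  rwa [slab_zero] at this

/-- `slab` as a measurable equivalence. -/
def slabEquiv : (ℝ × EuclideanSpace ℝ {i : Fin k // i ≠ 0}) ≃ᵐ EuclideanSpace ℝ (Fin k) :=
  ((((MeasurableEquiv.funUnique {i : Fin k // i = 0} ℝ).symm).prodCongr
    (MeasurableEquiv.toLp 2 ({i : Fin k // i ≠ 0} → ℝ)).symm).trans
    (MeasurableEquiv.piEquivPiSubtypeProd (fun _ : Fin k => ℝ) (fun i => i = 0)).symm).trans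
    (MeasurableEquiv.toLp 2 (Fin k → ℝ))

lemma slabEquiv_apply (p : ℝ × EuclideanSpace ℝ {i : Fin k // i ≠ 0}) :
    slabEquiv p = slab p := rfl

/-- Splits Lebesgue measure into the normal coordinate and the boundary coordinates, so that Fubini
applies to thin layers. -/
lemma measurePreserving_slab :
    MeasurePreserving (slabEquiv (k := k)) (volume.prod volume) volume := by
  refine (PiLp.volume_preserving_toLp (Fin k)).comp ?_
  refine ((volume_preserving_piEquivPiSubtypeProd (fun _ : Fin k => ℝ)
    (fun i => i = 0)).symm _).comp ?_
  convert! ((volume_preserving_funUnique {i : Fin k // i = 0} ℝ).symm _).prod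
    (PiLp.volume_preserving_ofLp {i : Fin k // i ≠ 0})
  rw [Measure.volume_eq_prod]
  congr!

lemma integral_slab (g : EuclideanSpace ℝ (Fin k) → ℝ) :
    ∫ y, g y = ∫ p, g (slab p) ∂(volume.prod volume) :=
  ((measurePreserving_slab (k := k)).integral_comp' (f := slabEquiv) g).symm

lemma volume_boundary_eq_zero : volume {y : EuclideanSpace ℝ (Fin k) | y 0 = 0} = 0 := by
  rw [← (measurePreserving_slab (k := k)).measure_preimage_equiv]
  have : slabEquiv (k := k) ⁻¹' {y | y 0 = 0} = {(0 : ℝ)} ×ˢ univ := by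
    ext p
    simp [slabEquiv_apply]
  rw [this, Measure.prod_prod]
  simp

lemma isClosed_halfSpace : IsClosed {y : EuclideanSpace ℝ (Fin k) | 0 ≤ y 0} :=
  isClosed_le continuous_const (PiLp.continuous_apply 2 _ _)

lemma exists_bound_of_compact_support {Q : EuclideanSpace ℝ (Fin k) → ℝ}
    (hQ : ContinuousOn Q {y | 0 ≤ y 0}) {R : ℝ} (hR : ∀ y, R < ‖y‖ → Q y = 0) :
    ∃ C, 0 ≤ C ∧ ∀ y : EuclideanSpace ℝ (Fin k), 0 ≤ y 0 → |Q y| ≤ C := by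
  have hK : IsCompact ({y : EuclideanSpace ℝ (Fin k) | 0 ≤ y 0} ∩ Metric.closedBall 0 R) :=
    (isCompact_closedBall _ _).inter_left isClosed_halfSpace
  obtain ⟨C, hC⟩ := hK.exists_bound_of_continuousOn (hQ.mono inter_subset_left)
  refine ⟨max C 0, le_max_right _ _, fun y hy => ?_⟩
  by_cases h : ‖y‖ ≤ R
  · exact (hC y ⟨hy, by simpa using h⟩).trans (le_max_left _ _)
  · rw [hR y (not_le.1 h), abs_zero]; exact le_max_right _ _

lemma integrableOn_halfSpace {Q : EuclideanSpace ℝ (Fin k) → ℝ}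
    (hQ : ContinuousOn Q {y | 0 ≤ y 0}) {R : ℝ} (hR : ∀ y, R < ‖y‖ → Q y = 0) :
    IntegrableOn Q {y | 0 ≤ y 0} := by
  have hK : IsCompact ({y : EuclideanSpace ℝ (Fin k) | 0 ≤ y 0} ∩ Metric.closedBall 0 R) :=
    (isCompact_closedBall _ _).inter_left isClosed_halfSpace
  have h1 : IntegrableOn Q ({y | 0 ≤ y 0} ∩ Metric.closedBall 0 R) :=
    (hQ.mono inter_subset_left).integrableOn_compact hK
  exact h1.of_forall_sdiff_eq_zero isClosed_halfSpace.measurableSet fun y hy => hR y (by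
    by_contra h
    exact hy.2 ⟨hy.1, by simpa using not_lt.1 h⟩)

/-- The boundary integral as a limit of integrals over thin layers. -/
lemma tendsto_integral_layer {Q : EuclideanSpace ℝ (Fin k) → ℝ}
    (hQ : ContinuousOn Q {y | 0 ≤ y 0}) {R : ℝ} (hR : ∀ y, R < ‖y‖ → Q y = 0) :
    Tendsto (fun j : ℕ => ∫ y in {y : EuclideanSpace ℝ (Fin k) | 0 ≤ y 0},
        (j * deriv Real.smoothTransition (j * y 0 - 1)) * Q y) atTop
      (𝓝 (∫ z, Q (boundaryInclusion z))) := by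
  obtain ⟨C, hC0, hC⟩ := exists_bound_of_compact_support hQ hR
  -- Clamping the normal coordinate at `0` makes the integrand continuous on the whole space.
  -- Nothing changes in the layer, since `χ` vanishes at nonpositive arguments.
  set q : ℝ × EuclideanSpace ℝ {i : Fin k // i ≠ 0} → ℝ := fun p => Q (slab (max p.1 0, p.2))
    with hq
  have hqc : Continuous q := by
    refine hQ.comp_continuous (continuous_slab.comp
      ((continuous_fst.max continuous_const).prodMk continuous_snd)) fun p => ?_
    simp
  have hqb : ∀ p, |q p| ≤ C := fun p => hC _ (by simp)
  have hq0 : ∀ p, R < ‖p.2‖ → q p = 0 := fun p hp =>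
    hR _ (hp.trans_le (norm_snd_le_norm_slab (max p.1 0, p.2)))
  have hq1 : ∀ p, R < p.1 → q p = 0 := fun p hp => hR _ (by
    have := abs_fst_le_norm_slab (max p.1 0, p.2)
    rw [abs_of_nonneg (le_max_right _ _)] at this
    exact (hp.trans_le (le_max_left _ _)).trans_le this)
  set χ := deriv Real.smoothTransition with hχ
  have hχc : Continuous χ := continuous_deriv_smoothTransition
  have hχs : Integrable fun x => χ (x - 1) := integrable_deriv_smoothTransition.comp_sub_right 1
  set bound : ℝ × EuclideanSpace ℝ {i : Fin k // i ≠ 0} → ℝ := fun p =>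
    |χ (p.1 - 1)| * (Metric.closedBall 0 R).indicator (fun _ => C) p.2 with hbound
  have hbi : Integrable bound (volume.prod volume) := by
    refine Integrable.mul_prod hχs.abs ?_
    exact (integrable_indicator_iff Metric.isClosed_closedBall.measurableSet).2
      (integrableOn_const (isCompact_closedBall _ _).measure_lt_top.ne)
  have hle : ∀ t p, |χ (p.1 - 1) * q (t, p.2)| ≤ bound p := by
    intro t p
    rw [abs_mul]
    refine mul_le_mul_of_nonneg_left ?_ (abs_nonneg _)
    by_cases hp : p.2 ∈ Metric.closedBall 0 R
    · rw [indicator_of_mem hp]; exact hqb _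
    · rw [indicator_of_notMem hp, hq0 (t, p.2) (by simpa using hp), abs_zero]
  have hmeas : ∀ j : ℕ, Continuous fun p : ℝ × EuclideanSpace ℝ {i : Fin k // i ≠ 0} =>
      χ (p.1 - 1) * q (p.1 / j, p.2) := fun j => by fun_prop
  -- In the rescaled variable `x = j t` the layer has fixed thickness and `χ` has mass `1`. The
  -- limit is then plain dominated convergence, with `x / j → 0`.
  have hlim : Tendsto (fun j : ℕ => ∫ p, χ (p.1 - 1) * q (p.1 / j, p.2)
      ∂((volume : Measure ℝ).prod
        (volume : Measure (EuclideanSpace ℝ {i : Fin k // i ≠ 0})))) atTop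
      (𝓝 (∫ z, Q (boundaryInclusion z))) := by
    have hfin : ∫ p, χ (p.1 - 1) * q (0, p.2) ∂((volume : Measure ℝ).prod
        (volume : Measure (EuclideanSpace ℝ {i : Fin k // i ≠ 0}))) =
        ∫ z, Q (boundaryInclusion z) := by
      rw [integral_prod_mul (fun x => χ (x - 1)) (fun z => q (0, z)),
        integral_sub_right_eq_self χ, integral_deriv_smoothTransition, one_mul]
      simp [hq, slab_boundary]
    rw [← hfin]
    refine tendsto_integral_of_dominated_convergence bound
      (fun j => (hmeas j).aestronglyMeasurable) hbi
      (fun j => Eventually.of_forall fun p => hle _ p) (Eventually.of_forall fun p => ?_)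
    refine (Tendsto.const_mul _ ?_)
    have : Tendsto (fun j : ℕ => (p.1 / j, p.2)) atTop (𝓝 (0, p.2)) :=
      (tendsto_const_div_atTop_nhds_zero_nat p.1).prodMk_nhds tendsto_const_nhds
    exact (hqc.tendsto _).comp this
  refine hlim.congr' ?_
  filter_upwards [eventually_gt_atTop 0] with j hj
  have hj' : (0 : ℝ) < j := by exact_mod_cast hj
  rw [integral_prod_symm _ (hbi.mono' (hmeas j).aestronglyMeasurable
    (Eventually.of_forall fun p => hle _ p)), ← integral_indicator
    isClosed_halfSpace.measurableSet, integral_slab]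
  have hpt : ∀ p : ℝ × EuclideanSpace ℝ {i : Fin k // i ≠ 0},
      {y : EuclideanSpace ℝ (Fin k) | 0 ≤ y 0}.indicator
        (fun y => (j * χ (j * y 0 - 1)) * Q y) (slab p) = (j * χ (j * p.1 - 1)) * q p := by
    intro p
    by_cases hp : 0 ≤ p.1
    · rw [indicator_of_mem (by simpa using hp), slab_zero, hq]
      simp only [max_eq_left hp]
    · rw [indicator_of_notMem (by simpa using hp), hχ, deriv_smoothTransition_of_neg]
      · simp
      · nlinarith
  simp_rw [hpt]
  have hint : Integrable (fun p : ℝ × EuclideanSpace ℝ {i : Fin k // i ≠ 0} =>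
      (j * χ (j * p.1 - 1)) * q p) (volume.prod volume) := by
    refine Continuous.integrable_of_hasCompactSupport (by fun_prop) ?_
    refine HasCompactSupport.intro (isCompact_Icc (a := (0 : ℝ)) (b := R) |>.prod
      (isCompact_closedBall (0 : EuclideanSpace ℝ {i : Fin k // i ≠ 0}) R)) fun p hp => ?_
    rw [mem_prod, not_and_or, mem_Icc, not_and_or, not_le, not_le] at hp
    rcases hp with (h | h) | h
    · rw [hχ, deriv_smoothTransition_of_neg (by nlinarith)]; simp
    · rw [hq1 p h, mul_zero]
    · rw [hq0 p (by simpa using h), mul_zero]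
  rw [integral_prod_symm _ hint]
  congr 1
  ext z
  -- The substitution `x = j t`; the factor `j` in the layer density is its Jacobian.
  have h := Measure.integral_comp_mul_left (fun x => χ (x - 1) * q (x / j, z)) (j : ℝ)
  rw [abs_of_pos (inv_pos.2 hj'), smul_eq_mul, eq_comm, inv_mul_eq_iff_eq_mul₀ hj'.ne'] at h
  rw [h, ← integral_const_mul]
  congr 1
  ext x
  simp only [mul_div_cancel_left₀ x hj'.ne']
  ring

/-- The cutoffs are eventually `1` at each point with `y 0 > 0`, and the hyperplane `y 0 = 0` is
null. -/
lemma tendsto_integral_cutoff {P : EuclideanSpace ℝ (Fin k) → ℝ}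
    (hP : IntegrableOn P {y | 0 ≤ y 0}) :
    Tendsto (fun j : ℕ => ∫ y in {y : EuclideanSpace ℝ (Fin k) | 0 ≤ y 0},
        Real.smoothTransition (j * y 0 - 1) * P y) atTop
      (𝓝 (∫ y in {y : EuclideanSpace ℝ (Fin k) | 0 ≤ y 0}, P y)) := by
  refine tendsto_integral_of_dominated_convergence (fun y => ‖P y‖) (fun j => ?_) hP.norm
    (fun j => Eventually.of_forall fun y => ?_) ?_
  · refine Continuous.aestronglyMeasurable ?_ |>.mul hP.aestronglyMeasurable
    have := PiLp.continuous_apply 2 (fun _ : Fin k => ℝ) 0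
    exact Real.smoothTransition.continuous.comp ((continuous_const.mul this).sub continuous_const)
  · rw [norm_mul, Real.norm_of_nonneg (Real.smoothTransition.nonneg _)]
    exact mul_le_of_le_one_left (norm_nonneg _) (Real.smoothTransition.le_one _)
  · have h0 : ∀ᵐ y : EuclideanSpace ℝ (Fin k), y 0 ≠ 0 := by
      rw [ae_iff]
      simpa using volume_boundary_eq_zero (k := k)
    filter_upwards [ae_restrict_mem isClosed_halfSpace.measurableSet, ae_restrict_of_ae h0]
      with y hy hy0
    have hpos : 0 < y 0 := lt_of_le_of_ne hy (Ne.symm hy0)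
    refine tendsto_const_nhds.congr' ?_
    have : Tendsto (fun j : ℕ => (j : ℝ) * y 0 - 1) atTop atTop :=
      tendsto_atTop_add_const_right _ _ (tendsto_natCast_atTop_atTop.atTop_mul_const hpos)
    filter_upwards [this.eventually_ge_atTop 1] with j hj
    rw [Real.smoothTransition.one_of_one_le hj, one_mul]

end ImmersedManifold

end

noncomputable section

/-! ### The Riemannian measures in charts -/

namespace ImmersedManifold

open Filter Topology

/-- Gluing: measures that agree on overlaps have a supremum which adds no mass on any single patch.
With `U c` the chart domains, this justifies the definitions of the volume and boundary volume. -/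
lemma iSup_measure_restrict {α ι : Type*} [MeasurableSpace α] (ν : ι → Measure α) (U : ι → Set α)
    (hU : ∀ c, MeasurableSet (U c)) (hν : ∀ c, ν c (U c)ᶜ = 0)
    (hag : ∀ c c' B, MeasurableSet B → B ⊆ U c → B ⊆ U c' → ν c B = ν c' B) (c : ι) :
    (⨆ i, ν i).restrict (U c) = ν c := by
  have hrc : ∀ c, (ν c).restrict (U c) = ν c := fun c =>
    Measure.restrict_eq_self_of_ae_mem (by rw [ae_iff]; exact hν c)
  apply le_antisymm
  · have hle : (⨆ i, ν i) ≤ ν c + (⊤ : Measure α).restrict (U c)ᶜ := by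
      refine iSup_le fun c' => Measure.le_iff.2 fun B hB => ?_
      rw [Measure.add_apply, ← measure_inter_add_sdiff B (hU c)]
      refine add_le_add ?_ ?_
      · have h1 : ν c' (B ∩ U c) ≤ ν c' (B ∩ U c ∩ U c') + ν c' (U c')ᶜ := by
          refine (measure_mono ?_).trans (measure_union_le _ _)
          intro x hx
          by_cases h : x ∈ U c'
          · exact Or.inl ⟨hx, h⟩
          · exact Or.inr h
        rw [hν, add_zero] at h1
        refine h1.trans ?_
        rw [hag c' c _ ((hB.inter (hU c)).inter (hU c')) inter_subset_right
          (inter_subset_left.trans inter_subset_right)]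
        exact measure_mono (inter_subset_left.trans inter_subset_left)
      · rw [Measure.restrict_apply hB, sdiff_eq]
        exact (le_top : ν c' ≤ ⊤) _
    refine (Measure.restrict_mono subset_rfl hle).trans ?_
    rw [Measure.restrict_add, Measure.restrict_restrict (hU c), inter_compl_self,
      Measure.restrict_empty, add_zero]
    exact Measure.restrict_le_self
  · rw [← hrc c]
    exact Measure.restrict_mono subset_rfl (le_iSup ν c)

/-! ### Measures transported by a parametrization. -/

section Param

variable {α : Type*} [TopologicalSpace α] [MeasurableSpace α] [BorelSpace α]
  {E : Type*} [NormedAddCommGroup E] [NormedSpace ℝ E] [FiniteDimensional ℝ E]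
  [MeasurableSpace E] [BorelSpace E] (μ : Measure E) [μ.IsAddHaarMeasure]

lemma measurableSet_inter_preimage {S : Set E} (hS : MeasurableSet S) {p : E → α}
    (hp : ContinuousOn p S) {B : Set α} (hB : MeasurableSet B) : MeasurableSet (S ∩ p ⁻¹' B) := by
  have h : MeasurableSet (S.domRestrict p ⁻¹' B) :=
    (continuousOn_iff_continuous_domRestrict.1 hp).measurable hB
  have := hS.subtype_image h
  convert this using 1
  ext x
  exact ⟨fun hx => ⟨⟨x, hx.1⟩, hx.2, rfl⟩, by rintro ⟨y, hy, rfl⟩; exact ⟨y.2, hy⟩⟩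

/-- The measure with density `w` on the image of `S` under the parametrization `p`. -/
def paramMeasure (S : Set E) (w : E → ℝ) (p : E → α) : Measure α :=
  ((μ.restrict S).withDensity fun y => ENNReal.ofReal (w y)).map p

variable {S : Set E} {w : E → ℝ} {p : E → α}

lemma aemeasurable_param (hS : MeasurableSet S) (hp : ContinuousOn p S)
    (ρ : E → ENNReal) : AEMeasurable p ((μ.restrict S).withDensity ρ) := by
  have h : AEMeasurable p (μ.restrict S) := by
    by_cases hSe : S = ∅
    · subst hSe; simp
    obtain ⟨y₀, hy₀⟩ := Set.nonempty_iff_ne_empty.2 hSe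
    classical
    have hm : Measurable (S.piecewise p fun _ => p y₀) :=
      ContinuousOn.measurable_piecewise hp continuousOn_const hS
    refine ⟨_, hm, ?_⟩
    filter_upwards [ae_restrict_mem hS] with y hy
    rw [piecewise_eq_of_mem _ _ _ hy]
  exact h.mono_ac (withDensity_absolutelyContinuous _ _)

lemma paramMeasure_apply (hS : MeasurableSet S) (hp : ContinuousOn p S) {B : Set α}
    (hB : MeasurableSet B) :
    paramMeasure μ S w p B = ∫⁻ y in S ∩ p ⁻¹' B, ENNReal.ofReal (w y) ∂μ := by
  rw [paramMeasure, Measure.map_apply_of_aemeasurable (aemeasurable_param μ hS hp _) hB,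
    withDensity_apply', Measure.restrict_restrict' hS, inter_comm]

/-- The change of variables formula for the transition map `τ` between two parametrizations of the
same set. -/
lemma paramMeasure_congr (hS : MeasurableSet S) (hp : ContinuousOn p S)
    {S' : Set E} {w' : E → ℝ} {p' : E → α} (hS' : MeasurableSet S') (hp' : ContinuousOn p' S')
    {B : Set α} (hB : MeasurableSet B) {τ : E → E} {A : E → E →L[ℝ] E}
    (hτ : ∀ y ∈ S ∩ p ⁻¹' B, HasFDerivWithinAt τ (A y) (S ∩ p ⁻¹' B) y)
    (hinj : InjOn τ (S ∩ p ⁻¹' B)) (himg : τ '' (S ∩ p ⁻¹' B) = S' ∩ p' ⁻¹' B)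
    (hw : ∀ y ∈ S ∩ p ⁻¹' B, w y = |(A y).det| * w' (τ y)) :
    paramMeasure μ S w p B = paramMeasure μ S' w' p' B := by
  have hT := measurableSet_inter_preimage hS hp hB
  rw [paramMeasure_apply μ hS hp hB, paramMeasure_apply μ hS' hp' hB, ← himg,
    lintegral_image_eq_lintegral_abs_det_fderiv_mul μ hT hτ hinj]
  refine setLIntegral_congr_fun hT fun y hy => ?_
  rw [hw y hy, ENNReal.ofReal_mul (abs_nonneg _)]

lemma paramMeasure_compl (hS : MeasurableSet S) (hp : ContinuousOn p S) {U : Set α}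
    (hU : MeasurableSet U) (hSU : MapsTo p S U) : paramMeasure μ S w p Uᶜ = 0 := by
  rw [paramMeasure_apply μ hS hp hU.compl]
  have : S ∩ p ⁻¹' Uᶜ = ∅ := by
    ext y
    simp only [mem_inter_iff, mem_preimage, mem_compl_iff, mem_empty_iff_false, iff_false, not_and,
      not_not]
    exact fun hy => hSU hy
  rw [this, Measure.restrict_empty, lintegral_zero_measure]

lemma paramMeasure_lt_top (hS : MeasurableSet S) (hp : ContinuousOn p S) {B : Set α}
    (hB : MeasurableSet B) {L : Set E} (hL : IsCompact L) (hBL : S ∩ p ⁻¹' B ⊆ L) (hw : ContinuousOn w L) :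
    paramMeasure μ S w p B < ⊤ := by
  obtain ⟨C, hC⟩ := hL.exists_bound_of_continuousOn hw
  rw [paramMeasure_apply μ hS hp hB]
  calc ∫⁻ y in S ∩ p ⁻¹' B, ENNReal.ofReal (w y) ∂μ ≤ ∫⁻ y in L, ENNReal.ofReal (w y) ∂μ :=
        lintegral_mono_set hBL
    _ ≤ ∫⁻ y in L, ENNReal.ofReal C ∂μ :=
        setLIntegral_mono' hL.measurableSet fun y hy =>
          ENNReal.ofReal_le_ofReal ((le_abs_self _).trans (hC y hy))
    _ < ⊤ := by
        rw [setLIntegral_const]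
        exact ENNReal.mul_lt_top ENNReal.ofReal_lt_top hL.measure_lt_top

lemma integral_paramMeasure (hS : MeasurableSet S) (hp : ContinuousOn p S)
    (hw : ContinuousOn w S) (hw0 : ∀ y ∈ S, 0 ≤ w y) {h : α → ℝ}
    (hh : AEStronglyMeasurable h (paramMeasure μ S w p)) :
    ∫ x, h x ∂(paramMeasure μ S w p) = ∫ y in S, w y * h (p y) ∂μ := by
  rw [paramMeasure, integral_map (aemeasurable_param μ hS hp _) hh,
    integral_withDensity_eq_integral_toReal_smul₀]
  · refine setIntegral_congr_fun hS fun y hy => ?_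
    simp only [smul_eq_mul]
    rw [ENNReal.toReal_ofReal (hw0 y hy)]
  · exact (hw.aemeasurable hS).ennreal_ofReal
  · exact Eventually.of_forall fun y => ENNReal.ofReal_lt_top

end Param

variable {k n : ℕ} [NeZero k] {M : Type*} [TopologicalSpace M]
  [ChartedSpace (EuclideanHalfSpace k) M] [MeasurableSpace M] [BorelSpace M]

/-- The density of the volume in the chart centred at `c`. -/
def density (f : M → EuclideanSpace ℝ (Fin n)) (c : M) (y : EuclideanSpace ℝ (Fin k)) : ℝ :=
  Real.sqrt (gramL (chartDeriv f c y)).det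

/-- The inclusion of the boundary hyperplane as a linear map. -/
def boundaryInclusionL :
    EuclideanSpace ℝ {i : Fin k // i ≠ 0} →L[ℝ] EuclideanSpace ℝ (Fin k) :=
  LinearMap.toContinuousLinearMap
    { toFun := boundaryInclusion
      map_add' := fun z w => by
        ext i
        by_cases h : i = 0 <;> simp [boundaryInclusion, h]
      map_smul' := fun t z => by
        ext i
        by_cases h : i = 0 <;> simp [boundaryInclusion, h] }

/-- The projection to the boundary coordinates as a linear map. -/
def boundaryProjectionL :
    EuclideanSpace ℝ (Fin k) →L[ℝ] EuclideanSpace ℝ {i : Fin k // i ≠ 0} :=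
  LinearMap.toContinuousLinearMap
    { toFun := fun y => WithLp.toLp 2 fun i => y i
      map_add' := fun _ _ => rfl
      map_smul' := fun _ _ => rfl }

lemma boundaryInclusionL_apply (z : EuclideanSpace ℝ {i : Fin k // i ≠ 0}) :
    boundaryInclusionL z = boundaryInclusion z := rfl

lemma boundaryProjectionL_apply (y : EuclideanSpace ℝ (Fin k)) (i : {i : Fin k // i ≠ 0}) :
    boundaryProjectionL y i = y i := rfl

lemma boundaryInclusion_zero (z : EuclideanSpace ℝ {i : Fin k // i ≠ 0}) :
    boundaryInclusion z 0 = 0 := by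
  simp [boundaryInclusion]

lemma boundaryProjectionL_inclusion (z : EuclideanSpace ℝ {i : Fin k // i ≠ 0}) :
    boundaryProjectionL (boundaryInclusion z) = z := by
  ext i
  rw [boundaryProjectionL_apply]
  simp [boundaryInclusion, i.2]

lemma boundaryInclusion_projection {y : EuclideanSpace ℝ (Fin k)} (hy : y 0 = 0) :
    boundaryInclusion (boundaryProjectionL y) = y := by
  ext i
  by_cases h : i = 0
  · subst h; simp [boundaryInclusion, hy]
  · simp [boundaryProjectionL_apply, boundaryInclusion, h]

lemma boundaryInclusionL_single (i : {i : Fin k // i ≠ 0}) :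
    boundaryInclusionL (EuclideanSpace.single i (1 : ℝ)) = EuclideanSpace.single i.1 1 := by
  ext j
  by_cases h : j = 0
  · subst h; simp [boundaryInclusionL_apply, boundaryInclusion, Ne.symm i.2]
  · simp [boundaryInclusionL_apply, boundaryInclusion, h, Subtype.ext_iff]

/-- The density of the boundary volume in the chart centred at `c`. -/
def boundaryDensity (f : M → EuclideanSpace ℝ (Fin n)) (c : M)
    (z : EuclideanSpace ℝ {i : Fin k // i ≠ 0}) : ℝ :=
  Real.sqrt (gramL ((chartDeriv f c (boundaryInclusion z)).comp boundaryInclusionL)).det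

lemma boundaryGram_eq (f : M → EuclideanSpace ℝ (Fin n)) (c : M)
    (z : EuclideanSpace ℝ {i : Fin k // i ≠ 0}) :
    boundaryGram f c z =
      gramL ((chartDeriv f c (boundaryInclusion z)).comp boundaryInclusionL) := by
  ext i j
  simp only [gramL, Matrix.of_apply, ContinuousLinearMap.comp_apply, boundaryInclusionL_single]
  rfl

lemma measurableSet_target (c : M) : MeasurableSet (extChartAt (𝓡∂ k) c).target := by
  rw [extChartAt_target]
  refine MeasurableSet.inter ?_ ?_
  · exact ((chartAt (EuclideanHalfSpace k) c).open_target.preimage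
      (𝓡∂ k).continuous_symm).measurableSet
  · exact (𝓡∂ k).isClosed_range.measurableSet

lemma measurableSet_source (c : M) : MeasurableSet (extChartAt (𝓡∂ k) c).source :=
  (isOpen_extChartAt_source c).measurableSet

lemma chartVolume_eq (f : M → EuclideanSpace ℝ (Fin n)) (c : M) :
    chartVolume (k := k) f c = paramMeasure volume (extChartAt (𝓡∂ k) c).target (density f c)
      (extChartAt (𝓡∂ k) c).symm := rfl

/-- The boundary part of the target of the chart centred at `c`. -/
def boundaryTarget (c : M) : Set (EuclideanSpace ℝ {i : Fin k // i ≠ 0}) :=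
  boundaryInclusion ⁻¹' (extChartAt (𝓡∂ k) c).target

lemma chartBoundaryVolume_eq (f : M → EuclideanSpace ℝ (Fin n)) (c : M) :
    chartBoundaryVolume (k := k) f c = paramMeasure volume (boundaryTarget c)
      (boundaryDensity f c)
      (fun z => (extChartAt (𝓡∂ k) c).symm (boundaryInclusion z)) := by
  rw [chartBoundaryVolume]
  simp_rw [boundaryGram_eq]
  rfl

lemma measurableSet_boundaryTarget (c : M) : MeasurableSet (boundaryTarget (k := k) c) :=
  continuous_boundaryInclusion.measurable (measurableSet_target c)

lemma continuousOn_boundaryParam (c : M) :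
    ContinuousOn (fun z => (extChartAt (𝓡∂ k) c).symm (boundaryInclusion z))
      (boundaryTarget (k := k) c) :=
  (continuousOn_extChartAt_symm c).comp continuous_boundaryInclusion.continuousOn
    (mapsTo_preimage _ _)

lemma mapsTo_boundaryParam (c : M) :
    MapsTo (fun z => (extChartAt (𝓡∂ k) c).symm (boundaryInclusion z))
      (boundaryTarget (k := k) c) (extChartAt (𝓡∂ k) c).source :=
  fun _ hz => (extChartAt (𝓡∂ k) c).map_target hz

/-! ### Consistency and finiteness of the Riemannian and boundary volumes. -/

section Immersion

variable [IsManifold (𝓡∂ k) ∞ M] {f : M → EuclideanSpace ℝ (Fin n)}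
  (hf : ContMDiff (𝓡∂ k) 𝓘(ℝ, EuclideanSpace ℝ (Fin n)) 1 f)

include hf

lemma continuousOn_gramL_det (c : M) :
    ContinuousOn (fun y => (gramL (chartDeriv f c y)).det) (extChartAt (𝓡∂ k) c).target := by
  refine (Continuous.matrix_det continuous_id).comp_continuousOn ?_
  refine continuousOn_pi.2 fun i => continuousOn_pi.2 fun j => ?_
  exact ((continuousOn_chartDeriv hf c).clm_apply continuousOn_const).inner
    ((continuousOn_chartDeriv hf c).clm_apply continuousOn_const)

lemma continuousOn_density (c : M) :
    ContinuousOn (density f c) (extChartAt (𝓡∂ k) c).target :=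
  (continuousOn_gramL_det hf c).sqrt

lemma continuousOn_boundaryDensity (c : M) :
    ContinuousOn (boundaryDensity f c) (boundaryTarget (k := k) c) := by
  have hJ : ContinuousOn (fun z => (chartDeriv f c (boundaryInclusion z)).comp
      (boundaryInclusionL (k := k))) (boundaryTarget (k := k) c) :=
    ((continuousOn_chartDeriv hf c).comp continuous_boundaryInclusion.continuousOn
      (mapsTo_preimage _ _)).clm_comp continuousOn_const
  refine ContinuousOn.sqrt ((Continuous.matrix_det continuous_id).comp_continuousOn ?_)
  refine continuousOn_pi.2 fun i => continuousOn_pi.2 fun j => ?_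
  exact (hJ.clm_apply continuousOn_const).inner (hJ.clm_apply continuousOn_const)

/-- `√(det g)` picks up the factor `|det|` of the derivative of the coordinate change, which is the
Jacobian of the change of variables. -/
lemma chartVolume_agree (c c' : M) (B : Set M) (hB : MeasurableSet B)
    (hBc : B ⊆ (extChartAt (𝓡∂ k) c).source) (hBc' : B ⊆ (extChartAt (𝓡∂ k) c').source) :
    chartVolume (k := k) f c B = chartVolume (k := k) f c' B := by
  rw [chartVolume_eq, chartVolume_eq]
  refine paramMeasure_congr volume (measurableSet_target c) (continuousOn_extChartAt_symm c)
    (measurableSet_target c') (continuousOn_extChartAt_symm c') hB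
    (τ := extChartAt (𝓡∂ k) c' ∘ (extChartAt (𝓡∂ k) c).symm) (A := transDeriv c c')
    (fun y hy => (hasFDerivWithinAt_trans hy.1 (hBc' hy.2)).mono
      (inter_subset_left.trans (target_subset_range c))) ?_ ?_ ?_
  · intro y hy y' hy' h
    have := (extChartAt (𝓡∂ k) c').injOn (hBc' hy.2) (hBc' hy'.2) h
    exact (extChartAt (𝓡∂ k) c).symm.injOn hy.1 hy'.1 this
  · apply Subset.antisymm
    · rintro _ ⟨y, hy, rfl⟩
      refine ⟨(extChartAt (𝓡∂ k) c').map_source (hBc' hy.2), ?_⟩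
      simp only [Function.comp_apply, mem_preimage]
      rw [(extChartAt (𝓡∂ k) c').left_inv (hBc' hy.2)]
      exact hy.2
    · intro y hy
      have h1 : (extChartAt (𝓡∂ k) c').symm y ∈ (extChartAt (𝓡∂ k) c).source := hBc hy.2
      refine ⟨extChartAt (𝓡∂ k) c ((extChartAt (𝓡∂ k) c').symm y),
        ⟨(extChartAt (𝓡∂ k) c).map_source h1, ?_⟩, ?_⟩
      · rw [mem_preimage, (extChartAt (𝓡∂ k) c).left_inv h1]
        exact hy.2
      · simp only [Function.comp_apply]
        rw [(extChartAt (𝓡∂ k) c).left_inv h1, (extChartAt (𝓡∂ k) c').right_inv hy.1]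
  · intro y hy
    rw [density, chartDeriv_trans hf hy.1 (hBc' hy.2), gramL_comp_det,
      Real.sqrt_mul (sq_nonneg _), Real.sqrt_sq_eq_abs]
    rfl

lemma riemannianVolume_restrict (c : M) :
    (riemannianVolume k f).restrict (extChartAt (𝓡∂ k) c).source = chartVolume (k := k) f c :=
  iSup_measure_restrict _ (fun c : M => (extChartAt (𝓡∂ k) c).source) measurableSet_source
    (fun c => paramMeasure_compl volume (measurableSet_target c) (continuousOn_extChartAt_symm c)
      (measurableSet_source c) (extChartAt (𝓡∂ k) c).symm.mapsTo) (chartVolume_agree hf) c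

/-- Coordinate changes map boundary points to boundary points, so they induce a map of hyperplanes,
with derivative projection ∘ derivative ∘ inclusion. The argument for the volume then repeats one
dimension lower. -/
lemma chartBoundaryVolume_agree (c c' : M) (B : Set M) (hB : MeasurableSet B)
    (hBc : B ⊆ (extChartAt (𝓡∂ k) c).source) (hBc' : B ⊆ (extChartAt (𝓡∂ k) c').source) :
    chartBoundaryVolume (k := k) f c B = chartBoundaryVolume (k := k) f c' B := by
  rw [chartBoundaryVolume_eq, chartBoundaryVolume_eq]
  have hzero : ∀ (a a' : M) (z : EuclideanSpace ℝ {i : Fin k // i ≠ 0}),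
      boundaryInclusion z ∈ (extChartAt (𝓡∂ k) a).target →
      (extChartAt (𝓡∂ k) a).symm (boundaryInclusion z) ∈ (extChartAt (𝓡∂ k) a').source →
      extChartAt (𝓡∂ k) a' ((extChartAt (𝓡∂ k) a).symm (boundaryInclusion z)) 0 = 0 := by
    intro a a' z hz hz'
    rw [← mem_boundary_iff hz', mem_boundary_iff ((extChartAt (𝓡∂ k) a).map_target hz),
      (extChartAt (𝓡∂ k) a).right_inv hz, boundaryInclusion_zero]
  have hτ : ∀ z ∈ boundaryTarget (k := k) c ∩
      (fun z => (extChartAt (𝓡∂ k) c).symm (boundaryInclusion z)) ⁻¹' B,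
      boundaryInclusion (boundaryProjectionL
        (extChartAt (𝓡∂ k) c' ((extChartAt (𝓡∂ k) c).symm (boundaryInclusion z)))) =
        extChartAt (𝓡∂ k) c' ((extChartAt (𝓡∂ k) c).symm (boundaryInclusion z)) :=
    fun z hz => boundaryInclusion_projection (hzero c c' z hz.1 (hBc' hz.2))
  refine paramMeasure_congr volume (measurableSet_boundaryTarget c) (continuousOn_boundaryParam c)
    (measurableSet_boundaryTarget c') (continuousOn_boundaryParam c') hB
    (τ := fun z => boundaryProjectionL
      (extChartAt (𝓡∂ k) c' ((extChartAt (𝓡∂ k) c).symm (boundaryInclusion z))))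
    (A := fun z => (boundaryProjectionL.comp
      ((transDeriv c c' (boundaryInclusion z)).comp boundaryInclusionL)))
    (fun z hz => ?_) ?_ ?_ ?_
  · have h1 := hasFDerivWithinAt_trans (c' := c') hz.1 (hBc' hz.2)
    have h2 : HasFDerivWithinAt (boundaryInclusion (k := k)) boundaryInclusionL
        (boundaryTarget (k := k) c ∩
        (fun z => (extChartAt (𝓡∂ k) c).symm (boundaryInclusion z)) ⁻¹' B) z :=
      (boundaryInclusionL (k := k)).hasFDerivWithinAt
    exact (boundaryProjectionL (k := k)).hasFDerivAt.comp_hasFDerivWithinAt z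
      (h1.comp z h2 fun z hz => target_subset_range c hz.1)
  · intro z hz z' hz' h
    have h1 := congrArg boundaryInclusion h
    simp only [hτ z hz, hτ z' hz'] at h1
    have h2 := (extChartAt (𝓡∂ k) c').injOn (hBc' hz.2) (hBc' hz'.2) h1
    have h3 := (extChartAt (𝓡∂ k) c).symm.injOn hz.1 hz'.1 h2
    rw [← boundaryProjectionL_inclusion z, h3, boundaryProjectionL_inclusion]
  · apply Subset.antisymm
    · rintro _ ⟨z, hz, rfl⟩
      refine ⟨?_, ?_⟩
      · rw [boundaryTarget, mem_preimage, hτ z hz]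
        exact (extChartAt (𝓡∂ k) c').map_source (hBc' hz.2)
      · simp only [mem_preimage]
        rw [hτ z hz, (extChartAt (𝓡∂ k) c').left_inv (hBc' hz.2)]
        exact hz.2
    · intro z hz
      have h1 : (extChartAt (𝓡∂ k) c').symm (boundaryInclusion z) ∈
        (extChartAt (𝓡∂ k) c).source := hBc hz.2
      have h2 := boundaryInclusion_projection (hzero c' c z hz.1 h1)
      have h3 : boundaryProjectionL
          (extChartAt (𝓡∂ k) c ((extChartAt (𝓡∂ k) c').symm (boundaryInclusion z))) ∈
          boundaryTarget (k := k) c ∩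
            (fun z => (extChartAt (𝓡∂ k) c).symm (boundaryInclusion z)) ⁻¹' B := by
        refine ⟨?_, ?_⟩
        · rw [boundaryTarget, mem_preimage, h2]
          exact (extChartAt (𝓡∂ k) c).map_source h1
        · rw [mem_preimage, h2, (extChartAt (𝓡∂ k) c).left_inv h1]
          exact hz.2
      refine ⟨_, h3, ?_⟩
      simp only
      rw [h2, (extChartAt (𝓡∂ k) c).left_inv h1, (extChartAt (𝓡∂ k) c').right_inv hz.1,
        boundaryProjectionL_inclusion]
  · intro z hz
    rw [boundaryDensity, boundaryDensity, hτ z hz, chartDeriv_trans hf hz.1 (hBc' hz.2)]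
    set A := transDeriv c c' (boundaryInclusion z) with hA
    set J := chartDeriv f c' (extChartAt (𝓡∂ k) c'
      ((extChartAt (𝓡∂ k) c).symm (boundaryInclusion z))) with hJ
    have hb := transDeriv_boundary (c' := c') hz.1 (hBc' hz.2)
      (hzero c c' z hz.1 (hBc' hz.2)) (boundaryInclusion_zero z)
    -- By `transDeriv_boundary` the derivative maps the hyperplane into itself, so projecting and
    -- including again loses nothing.
    have hcomp : A.comp boundaryInclusionL = boundaryInclusionL.comp
        (boundaryProjectionL.comp (A.comp boundaryInclusionL)) := by
      ext1 v
      have h0 : A (boundaryInclusionL v) 0 = 0 := by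
        have : A (boundaryInclusionL v) 0 = ((EuclideanSpace.proj (0 : Fin k) : _ →L[ℝ] ℝ).comp
          (A.comp boundaryInclusionL)) v := rfl
        rw [this, map_eq_sum _ v]
        refine Finset.sum_eq_zero fun i _ => ?_
        rw [ContinuousLinearMap.comp_apply, ContinuousLinearMap.comp_apply,
          boundaryInclusionL_single]
        have := hb.1 i.1 i.2
        simp [hA, this]
      exact (boundaryInclusion_projection h0).symm
    have : (J.comp A).comp boundaryInclusionL = (J.comp boundaryInclusionL).comp
        (boundaryProjectionL.comp (A.comp boundaryInclusionL)) := by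
      rw [ContinuousLinearMap.comp_assoc, ContinuousLinearMap.comp_assoc, ← hcomp]
    rw [this, gramL_comp_det, Real.sqrt_mul (sq_nonneg _), Real.sqrt_sq_eq_abs]

lemma boundaryVolume_restrict (c : M) :
    (boundaryVolume k f).restrict (extChartAt (𝓡∂ k) c).source =
      chartBoundaryVolume (k := k) f c :=
  iSup_measure_restrict _ (fun c : M => (extChartAt (𝓡∂ k) c).source) measurableSet_source
    (fun c => by
      rw [chartBoundaryVolume_eq]
      exact paramMeasure_compl volume (measurableSet_boundaryTarget c)
        (continuousOn_boundaryParam c) (measurableSet_source c) (mapsTo_boundaryParam c))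
    (chartBoundaryVolume_agree hf) c

lemma integral_riemannianVolume_chart (c : M) {h : M → ℝ}
    (hh : AEStronglyMeasurable h (riemannianVolume k f))
    (hs : ∀ x ∉ (extChartAt (𝓡∂ k) c).source, h x = 0) :
    ∫ x, h x ∂(riemannianVolume k f) =
      ∫ y in (extChartAt (𝓡∂ k) c).target, density f c y * h ((extChartAt (𝓡∂ k) c).symm y) := by
  rw [← setIntegral_eq_integral_of_forall_compl_eq_zero hs, riemannianVolume_restrict hf,
    chartVolume_eq]
  refine integral_paramMeasure volume (measurableSet_target c) (continuousOn_extChartAt_symm c)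
    (continuousOn_density hf c) (fun y _ => Real.sqrt_nonneg _) ?_
  rw [← chartVolume_eq, ← riemannianVolume_restrict hf]
  exact hh.restrict

lemma integral_boundaryVolume_chart (c : M) {h : M → ℝ}
    (hh : AEStronglyMeasurable h (boundaryVolume k f))
    (hs : ∀ x ∉ (extChartAt (𝓡∂ k) c).source, h x = 0) :
    ∫ x, h x ∂(boundaryVolume k f) =
      ∫ z in boundaryTarget (k := k) c, boundaryDensity f c z *
        h ((extChartAt (𝓡∂ k) c).symm (boundaryInclusion z)) := by
  rw [← setIntegral_eq_integral_of_forall_compl_eq_zero hs, boundaryVolume_restrict hf,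
    chartBoundaryVolume_eq]
  refine integral_paramMeasure volume (measurableSet_boundaryTarget c)
    (continuousOn_boundaryParam c) (continuousOn_boundaryDensity hf c)
    (fun y _ => Real.sqrt_nonneg _) ?_
  rw [← chartBoundaryVolume_eq, ← boundaryVolume_restrict hf]
  exact hh.restrict

variable [CompactSpace M]

omit hf in
-- Compactness reduces to finitely many chart domains.
lemma measure_null_of_charts (μ : Measure M) {B : Set M}
    (h : ∀ c, μ.restrict (extChartAt (𝓡∂ k) c).source B = 0) : μ B = 0 := by
  obtain ⟨t, ht⟩ := isCompact_univ.elim_finite_subcover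
    (fun c : M => (extChartAt (𝓡∂ k) c).source) (fun c => isOpen_extChartAt_source c)
    (fun x _ => mem_iUnion.2 ⟨x, mem_extChartAt_source x⟩)
  have : B ⊆ ⋃ c ∈ t, B ∩ (extChartAt (𝓡∂ k) c).source := by
    intro x hx
    obtain ⟨c, hc, hxc⟩ := mem_iUnion₂.1 (ht (mem_univ x))
    exact mem_iUnion₂.2 ⟨c, hc, hx, hxc⟩
  refine measure_mono_null this ((measure_biUnion_null_iff t.countable_toSet).2 fun c _ => ?_)
  rw [← Measure.restrict_apply' (measurableSet_source c)]
  exact h c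

omit hf in
lemma aestronglyMeasurable_of_charts {μ : Measure M} {V : Type*} [NormedAddCommGroup V]
    {h : M → V}
    (hh : ∀ c, AEStronglyMeasurable h (μ.restrict (extChartAt (𝓡∂ k) c).source)) :
    AEStronglyMeasurable h μ := by
  obtain ⟨t, ht⟩ := isCompact_univ.elim_finite_subcover
    (fun c : M => (extChartAt (𝓡∂ k) c).source) (fun c => isOpen_extChartAt_source c)
    (fun x _ => mem_iUnion.2 ⟨x, mem_extChartAt_source x⟩)
  have h1 : AEStronglyMeasurable h (μ.restrict (⋃ c : t, (extChartAt (𝓡∂ k) c.1).source)) :=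
    aestronglyMeasurable_iUnion_iff.2 fun c => hh c
  have h2 : (⋃ c : t, (extChartAt (𝓡∂ k) c.1).source) = univ := by
    rw [eq_univ_iff_forall]
    intro x
    obtain ⟨c, hc, hxc⟩ := mem_iUnion₂.1 (ht (mem_univ x))
    exact mem_iUnion.2 ⟨⟨c, hc⟩, hxc⟩
  rwa [h2, Measure.restrict_univ] at h1

/-- Weak divergences are tested only in the interior; this is why such information holds almost
everywhere on `M`. -/
lemma riemannianVolume_boundary : riemannianVolume k f ((𝓡∂ k).boundary M) = 0 := by
  have hbm : MeasurableSet ((𝓡∂ k).boundary M) :=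
    ((𝓡∂ k).isClosed_boundary (n := ∞) (by simp)).measurableSet
  refine measure_null_of_charts (k := k) _ fun c => ?_
  rw [riemannianVolume_restrict hf, chartVolume_eq, paramMeasure_apply volume
    (measurableSet_target c) (continuousOn_extChartAt_symm c) hbm]
  refine setLIntegral_measure_zero _ _ (measure_mono_null ?_ volume_boundary_eq_zero)
  intro y hy
  have := (mem_boundary_iff ((extChartAt (𝓡∂ k) c).map_target hy.1)).1 hy.2
  rwa [(extChartAt (𝓡∂ k) c).right_inv hy.1] at this

lemma boundaryVolume_interior : boundaryVolume k f ((𝓡∂ k).interior M) = 0 := by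
  have hbm : MeasurableSet ((𝓡∂ k).interior M) :=
    ((𝓡∂ k).isOpen_interior (n := ∞) (by simp)).measurableSet
  refine measure_null_of_charts (k := k) _ fun c => ?_
  rw [boundaryVolume_restrict hf, chartBoundaryVolume_eq, paramMeasure_apply volume
    (measurableSet_boundaryTarget c) (continuousOn_boundaryParam c) hbm]
  refine setLIntegral_measure_zero _ _ ?_
  convert measure_empty (μ := volume)
  ext z
  simp only [mem_inter_iff, mem_preimage, mem_empty_iff_false, iff_false, not_and]
  intro hz h
  have := (mem_interior_iff ((extChartAt (𝓡∂ k) c).map_target hz)).1 h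
  rw [(extChartAt (𝓡∂ k) c).right_inv hz, boundaryInclusion_zero] at this
  exact lt_irrefl _ this

lemma ae_boundaryVolume_mem_boundary : ∀ᵐ x ∂(boundaryVolume k f), x ∈ (𝓡∂ k).boundary M := by
  rw [ae_iff]
  have : {x | x ∉ (𝓡∂ k).boundary M} = (𝓡∂ k).interior M := by
    rw [← (𝓡∂ k).compl_boundary]; rfl
  rw [this]
  exact boundaryVolume_interior hf

variable [T2Space M]

omit [MeasurableSpace M] [BorelSpace M] [IsManifold (𝓡∂ k) ∞ M] hf [CompactSpace M] in
lemma isCompact_chart_image {c : M} {K : Set M} (hK : IsCompact K)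
    (hKc : K ⊆ (extChartAt (𝓡∂ k) c).source) : IsCompact (extChartAt (𝓡∂ k) c '' K) :=
  hK.image_of_continuousOn ((continuousOn_extChartAt c).mono hKc)

omit hf in
lemma isFiniteMeasure_of_charts (μ : Measure M)
    (h : ∀ (c : M) (K : Set M), IsCompact K → K ⊆ (extChartAt (𝓡∂ k) c).source →
      μ.restrict (extChartAt (𝓡∂ k) c).source K < ⊤) : IsFiniteMeasure μ := by
  refine ⟨isCompact_univ.measure_lt_top_of_nhdsWithin fun x _ => ?_⟩
  obtain ⟨K, hK, hKc, hKs⟩ := exists_mem_nhds_isCompact_mapsTo (f := id) continuous_id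
    ((isOpen_extChartAt_source (I := 𝓡∂ k) x).mem_nhds (mem_extChartAt_source x))
  refine ⟨K, mem_nhdsWithin_of_mem_nhds hK, ?_⟩
  have := h x K hKc hKs
  rwa [Measure.restrict_apply' (measurableSet_source x), inter_eq_left.2 hKs] at this

lemma isFiniteMeasure_riemannianVolume : IsFiniteMeasure (riemannianVolume k f) := by
  refine isFiniteMeasure_of_charts (k := k) _ fun c K hK hKc => ?_
  rw [riemannianVolume_restrict hf, chartVolume_eq]
  refine paramMeasure_lt_top volume (measurableSet_target c) (continuousOn_extChartAt_symm c)
    hK.measurableSet (isCompact_chart_image hK hKc) ?_ ((continuousOn_density hf c).mono ?_)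
  · intro y hy
    exact ⟨_, hy.2, (extChartAt (𝓡∂ k) c).right_inv hy.1⟩
  · rintro _ ⟨x, hx, rfl⟩
    exact (extChartAt (𝓡∂ k) c).map_source (hKc hx)

lemma isFiniteMeasure_boundaryVolume : IsFiniteMeasure (boundaryVolume k f) := by
  refine isFiniteMeasure_of_charts (k := k) _ fun c K hK hKc => ?_
  rw [boundaryVolume_restrict hf, chartBoundaryVolume_eq]
  have hL := isCompact_chart_image hK hKc
  have hL' : IsCompact ((boundaryInclusion (k := k)) ⁻¹' (extChartAt (𝓡∂ k) c '' K)) := by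
    refine Metric.isCompact_of_isClosed_isBounded
      (hL.isClosed.preimage continuous_boundaryInclusion) ?_
    obtain ⟨C, hC⟩ := hL.isBounded.exists_norm_le
    refine isBounded_iff_forall_norm_le.2 ⟨C, fun z hz => ?_⟩
    exact (norm_snd_le_norm_slab (0, z)).trans (hC _ hz)
  refine paramMeasure_lt_top volume (measurableSet_boundaryTarget c)
    (continuousOn_boundaryParam c) hK.measurableSet hL' ?_
    ((continuousOn_boundaryDensity hf c).mono ?_)
  · intro z hz
    exact ⟨_, hz.2, (extChartAt (𝓡∂ k) c).right_inv hz.1⟩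
  · rintro z ⟨x, hx, hxz⟩
    rw [boundaryTarget, mem_preimage, ← hxz]
    exact (extChartAt (𝓡∂ k) c).map_source (hKc hx)

end Immersion

end ImmersedManifold

end

noncomputable section

/-! ### Continuity of the geometric quantities and the first variation formula -/

namespace ImmersedManifold

open Filter Topology

/-! ### Continuous dependence of projections and normal traces on the derivative. -/

section Continuity

variable {ι : Type*} [Fintype ι] [DecidableEq ι]
  {F : Type*} [NormedAddCommGroup F] [InnerProductSpace ℝ F]
  {T : Type*} [TopologicalSpace T] {s : Set T}
  {J : T → EuclideanSpace ℝ ι →L[ℝ] F}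

lemma continuousOn_gramL (hJ : ContinuousOn J s) : ContinuousOn (fun y => gramL (J y)) s :=
  continuousOn_pi.2 fun _ => continuousOn_pi.2 fun _ =>
    (hJ.clm_apply continuousOn_const).inner (hJ.clm_apply continuousOn_const)

lemma continuousOn_inv_gramL (hJ : ContinuousOn J s) (hi : ∀ y ∈ s, Function.Injective (J y))
    (i j : ι) : ContinuousOn (fun y => (gramL (J y))⁻¹ i j) s := by
  simp_rw [Matrix.inv_def, Ring.inverse_eq_inv, Matrix.smul_apply, smul_eq_mul]
  refine ContinuousOn.mul (ContinuousOn.inv₀ ?_ fun y hy => (gramL_posDef (hi y hy)).det_pos.ne') ?_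
  · exact (Continuous.matrix_det continuous_id).comp_continuousOn (continuousOn_gramL hJ)
  · have : Continuous fun A : Matrix ι ι ℝ => A.adjugate i j :=
      (Continuous.matrix_adjugate continuous_id).matrix_elem i j
    exact this.comp_continuousOn (continuousOn_gramL hJ)

lemma continuousOn_dualVec (hJ : ContinuousOn J s) (hi : ∀ y ∈ s, Function.Injective (J y))
    {l : T → EuclideanSpace ℝ ι →L[ℝ] ℝ} (hl : ContinuousOn l s) :
    ContinuousOn (fun y => dualVec (J y) (l y)) s := by
  refine (PiLp.continuous_toLp 2 _).comp_continuousOn (continuousOn_pi.2 fun i => ?_)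
  exact continuousOn_finsetSum _ fun j _ =>
    (continuousOn_inv_gramL hJ hi i j).mul (hl.clm_apply continuousOn_const)

lemma continuousOn_pairing (hJ : ContinuousOn J s) {v : T → F} (hv : ContinuousOn v s) :
    ContinuousOn (fun y => pairing (J y) (v y)) s :=
  ((innerSL ℝ).continuous.comp_continuousOn hv).clm_comp hJ

lemma continuousOn_gradL (hJ : ContinuousOn J s) (hi : ∀ y ∈ s, Function.Injective (J y))
    {l : T → EuclideanSpace ℝ ι →L[ℝ] ℝ} (hl : ContinuousOn l s) :
    ContinuousOn (fun y => gradL (J y) (l y)) s :=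
  hJ.clm_apply (continuousOn_dualVec hJ hi hl)

variable [FiniteDimensional ℝ F]

/-- Writes the projection through the inverse Gram matrix, from which its continuity in `J` is
visible. -/
lemma starProjection_range {J : EuclideanSpace ℝ ι →L[ℝ] F} (hJ : Function.Injective J) (v : F) :
    (LinearMap.range (J : EuclideanSpace ℝ ι →ₗ[ℝ] F)).starProjection v =
      gradL J (pairing J v) := by
  refine Submodule.eq_starProjection_of_mem_of_inner_eq_zero ⟨_, rfl⟩ ?_
  rintro _ ⟨w, rfl⟩
  rw [ContinuousLinearMap.coe_coe, inner_sub_left, inner_gradL hJ, pairing_apply, sub_self]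

lemma continuousOn_normalTrace (hJ : ContinuousOn J s) (hi : ∀ y ∈ s, Function.Injective (J y))
    {B : T → EuclideanSpace ℝ ι →L[ℝ] EuclideanSpace ℝ ι →L[ℝ] F} (hB : ContinuousOn B s) :
    ContinuousOn (fun y => normalTrace (J y) (B y)) s := by
  refine continuousOn_finsetSum _ fun i _ => continuousOn_finsetSum _ fun j _ => ?_
  have hv : ContinuousOn (fun y => B y (EuclideanSpace.single i 1) (EuclideanSpace.single j 1)) s :=
    (hB.clm_apply continuousOn_const).clm_apply continuousOn_const
  refine (continuousOn_inv_gramL hJ hi i j).smul (hv.sub ?_)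
  refine (continuousOn_gradL hJ hi (continuousOn_pairing hJ hv)).congr fun y hy => ?_
  exact starProjection_range (hi y hy) _

/-- Second derivatives are not tensorial, but their defect under a coordinate change is tangential.
The normal projection removes it, and the trace is invariant by `trace_comp`. -/
lemma normalTrace_comp {J : EuclideanSpace ℝ ι →L[ℝ] F}
    {A : EuclideanSpace ℝ ι →L[ℝ] EuclideanSpace ℝ ι} (hA : Function.Bijective A)
    {B B' : EuclideanSpace ℝ ι →L[ℝ] EuclideanSpace ℝ ι →L[ℝ] F}
    (hB : ∀ v w, B' v w - B (A v) (A w) ∈ LinearMap.range (J : EuclideanSpace ℝ ι →ₗ[ℝ] F)) :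
    normalTrace (J.comp A) B' = normalTrace J B := by
  set P := (LinearMap.range (J : EuclideanSpace ℝ ι →ₗ[ℝ] F)).starProjection with hP
  have hrange : LinearMap.range ((J.comp A : EuclideanSpace ℝ ι →L[ℝ] F) :
      EuclideanSpace ℝ ι →ₗ[ℝ] F) = LinearMap.range (J : EuclideanSpace ℝ ι →ₗ[ℝ] F) := by
    ext v
    constructor
    · rintro ⟨w, rfl⟩
      exact ⟨_, rfl⟩
    · rintro ⟨w, rfl⟩
      obtain ⟨w', rfl⟩ := hA.2 w
      exact ⟨w', rfl⟩
  have hproj : (LinearMap.range ((J.comp A : EuclideanSpace ℝ ι →L[ℝ] F) :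
      EuclideanSpace ℝ ι →ₗ[ℝ] F)).starProjection = P := by
    rw [hP]; congr 1
  have hN : ∀ v w, B' v w - P (B' v w) = B (A v) (A w) - P (B (A v) (A w)) := by
    intro v w
    have := Submodule.starProjection_eq_self_iff.2 (hB v w)
    rw [← hP, map_sub] at this
    rw [sub_eq_sub_iff_add_eq_add, ← sub_eq_sub_iff_add_eq_add, eq_comm] at this
    rw [sub_eq_sub_iff_sub_eq_sub]
    exact this.symm ▸ rfl
  have h := trace_comp J hA
    ((ContinuousLinearMap.compL ℝ _ _ _ (ContinuousLinearMap.id ℝ F - P)).comp B)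
  rw [normalTrace, normalTrace, hproj]
  simp only [hN]
  exact h

end Continuity

variable {k n : ℕ} [NeZero k] {M : Type*} [TopologicalSpace M]
  [ChartedSpace (EuclideanHalfSpace k) M]
  {V : Type*} [NormedAddCommGroup V] [NormedSpace ℝ V]

/-- The second derivative of `g` in the chart centred at `c`. -/
def chartDeriv₂ (g : M → V) (c : M) (y : EuclideanSpace ℝ (Fin k)) :
    EuclideanSpace ℝ (Fin k) →L[ℝ] EuclideanSpace ℝ (Fin k) →L[ℝ] V :=
  fderivWithin ℝ (chartDeriv g c) (range (𝓡∂ k)) y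

variable [IsManifold (𝓡∂ k) ∞ M]

lemma hasFDerivWithinAt_chartDeriv {g : M → V} (hg : ContMDiff (𝓡∂ k) 𝓘(ℝ, V) ∞ g) {c : M}
    {y : EuclideanSpace ℝ (Fin k)} (hy : y ∈ (extChartAt (𝓡∂ k) c).target) :
    HasFDerivWithinAt (chartDeriv g c) (chartDeriv₂ g c y) (range (𝓡∂ k)) y :=
  ((contDiffWithinAt_chartDeriv (m' := 1) le_rfl (by norm_cast) hg hy).differentiableWithinAt
    one_ne_zero).hasFDerivWithinAt

lemma continuousOn_chartDeriv₂ {g : M → V} (hg : ContMDiff (𝓡∂ k) 𝓘(ℝ, V) ∞ g) (c : M) :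
    ContinuousOn (chartDeriv₂ g c) (extChartAt (𝓡∂ k) c).target := fun y hy =>
  (((contDiffWithinAt_chartDeriv (m' := 1) le_rfl (by norm_cast) hg hy).fderivWithin_right
    (m := 0) halfSpace_uniqueDiffOn (by simp) (target_subset_range c hy)).continuousWithinAt).mono
    (target_subset_range c)

lemma chartPartial₂_eq {g : M → V} (hg : ContMDiff (𝓡∂ k) 𝓘(ℝ, V) ∞ g) {c : M}
    {y : EuclideanSpace ℝ (Fin k)} (hy : y ∈ (extChartAt (𝓡∂ k) c).target) (i j : Fin k) :
    chartPartial₂ g c y i j =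
      chartDeriv₂ g c y (EuclideanSpace.single i 1) (EuclideanSpace.single j 1) := by
  have h := (hasFDerivWithinAt_chartDeriv hg hy).clm_apply
    (hasFDerivWithinAt_const (EuclideanSpace.single j (1 : ℝ)) y _)
  have h2 := h.fderivWithin (halfSpace_uniqueDiffOn y (target_subset_range c hy))
  rw [chartPartial₂]
  simp only [chartPartial_eq]
  rw [h2]
  simp

/-- The vector `u` is the second derivative of the coordinate change; its image under the first
derivative is the tangential defect allowed for in `normalTrace_comp`. -/
lemma chartDeriv₂_trans {g : M → V} (hg : ContMDiff (𝓡∂ k) 𝓘(ℝ, V) ∞ g) {c c' : M}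
    {y : EuclideanSpace ℝ (Fin k)} (hy : y ∈ (extChartAt (𝓡∂ k) c).target)
    (hy' : (extChartAt (𝓡∂ k) c).symm y ∈ (extChartAt (𝓡∂ k) c').source)
    (v w : EuclideanSpace ℝ (Fin k)) :
    ∃ u, chartDeriv₂ g c y v w =
      chartDeriv₂ g c' (extChartAt (𝓡∂ k) c' ((extChartAt (𝓡∂ k) c).symm y))
        (transDeriv c c' y v) (transDeriv c c' y w) +
      chartDeriv g c' (extChartAt (𝓡∂ k) c' ((extChartAt (𝓡∂ k) c).symm y)) u := by
  have hg1 : ContMDiff (𝓡∂ k) 𝓘(ℝ, V) 1 g := hg.of_le (by simp)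
  have hmem := overlap_mem_nhdsWithin hy hy'
  set O := (extChartAt (𝓡∂ k) c).target ∩
    (extChartAt (𝓡∂ k) c).symm ⁻¹' (extChartAt (𝓡∂ k) c').source with hO
  have hOr : O ⊆ range (𝓡∂ k) := inter_subset_left.trans (target_subset_range c)
  have hτ := (hasFDerivWithinAt_trans hy hy').mono hOr
  have h1 : HasFDerivWithinAt (fun z => chartDeriv g c'
      ((extChartAt (𝓡∂ k) c' ∘ (extChartAt (𝓡∂ k) c).symm) z)) _ O y :=
    HasFDerivWithinAt.comp y
    (hasFDerivWithinAt_chartDeriv hg ((extChartAt (𝓡∂ k) c').map_source hy')) hτ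
    (fun z hz => target_subset_range c' ((extChartAt (𝓡∂ k) c').map_source hz.2))
  have h2 : DifferentiableWithinAt ℝ (transDeriv c c') O y :=
    ((((contDiffWithinAt_trans hy hy').fderivWithin_right (m := 1) halfSpace_uniqueDiffOn
      (by norm_cast) (target_subset_range c hy)).differentiableWithinAt one_ne_zero)).mono hOr
  have h3 := h1.clm_comp h2.hasFDerivWithinAt
  have h4 : HasFDerivWithinAt (chartDeriv g c) _ O y :=
    h3.congr (fun z hz => chartDeriv_trans hg1 hz.1 hz.2) (chartDeriv_trans hg1 hy hy')
  have h5 := (h4.mono_of_mem_nhdsWithin hmem).fderivWithin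
    (halfSpace_uniqueDiffOn y (target_subset_range c hy))
  refine ⟨fderivWithin ℝ (transDeriv c c') O y v w, ?_⟩
  rw [chartDeriv₂, h5]
  simp [add_comm]

/-! ### Mean curvature, gradients and the local first variation formula. -/

section Immersion

variable {f : M → EuclideanSpace ℝ (Fin n)}
  (hf : ContMDiff (𝓡∂ k) 𝓘(ℝ, EuclideanSpace ℝ (Fin n)) ∞ f)
  (himm : ∀ x, Function.Injective (mfderiv (𝓡∂ k) 𝓘(ℝ, EuclideanSpace ℝ (Fin n)) f x))

include hf himm

lemma meanCurvature_eq_normalTrace {c x : M} (hx : x ∈ (extChartAt (𝓡∂ k) c).source) :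
    meanCurvature k f x = normalTrace (chartDeriv f c (extChartAt (𝓡∂ k) c x))
      (chartDeriv₂ f c (extChartAt (𝓡∂ k) c x)) := by
  have hf1 : ContMDiff (𝓡∂ k) 𝓘(ℝ, EuclideanSpace ℝ (Fin n)) 1 f := hf.of_le (by simp)
  have h1 : meanCurvature k f x = normalTrace (chartDeriv f x (extChartAt (𝓡∂ k) x x))
      (chartDeriv₂ f x (extChartAt (𝓡∂ k) x x)) := by
    rw [meanCurvature, normalTrace]
    refine Finset.sum_congr rfl fun i _ => Finset.sum_congr rfl fun j _ => ?_
    rw [chartPartial₂_eq hf (mem_extChartAt_target x), normalPart, tangentialPart]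
    have hP : (tangentPlane k f x).starProjection =
        (LinearMap.range (chartDeriv f x (extChartAt (𝓡∂ k) x x) :
          EuclideanSpace ℝ (Fin k) →ₗ[ℝ] EuclideanSpace ℝ (Fin n))).starProjection := by
      congr 1
      exact tangentPlane_eq_range hf1 himm (mem_extChartAt_source x)
    rw [hP]
    rfl
  have hx' := (extChartAt (𝓡∂ k) c).left_inv hx
  rw [h1, chartDeriv_eq_comp hf1 hx]
  symm
  refine normalTrace_comp (transDeriv_self_bijective hx) fun v w => ?_
  obtain ⟨u, hu⟩ := chartDeriv₂_trans (c' := x) hf ((extChartAt (𝓡∂ k) c).map_source hx)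
    (by rw [hx']; exact mem_extChartAt_source x) v w
  rw [hx'] at hu
  exact ⟨u, by rw [hu, add_sub_cancel_left]; rfl⟩

omit [IsManifold (𝓡∂ k) ∞ M] hf himm in
lemma continuous_of_charts {W : Type*} [TopologicalSpace W] {h : M → W}
    {h' : M → EuclideanSpace ℝ (Fin k) → W}
    (hc : ∀ c, ContinuousOn (h' c) (extChartAt (𝓡∂ k) c).target)
    (he : ∀ c, ∀ x ∈ (extChartAt (𝓡∂ k) c).source, h x = h' c (extChartAt (𝓡∂ k) c x)) :
    Continuous h := by
  rw [continuous_iff_continuousAt]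
  intro c
  have h1 : ContinuousOn h (extChartAt (𝓡∂ k) c).source :=
    ((hc c).comp (continuousOn_extChartAt c) (extChartAt (𝓡∂ k) c).mapsTo).congr (he c)
  exact h1.continuousAt ((isOpen_extChartAt_source c).mem_nhds (mem_extChartAt_source c))

lemma continuous_meanCurvature : Continuous (meanCurvature k f) := by
  have hf1 : ContMDiff (𝓡∂ k) 𝓘(ℝ, EuclideanSpace ℝ (Fin n)) 1 f := hf.of_le (by simp)
  exact continuous_of_charts
    (fun c => continuousOn_normalTrace (continuousOn_chartDeriv hf1 c)
      (fun y hy => chartDeriv_injective hf1 himm hy) (continuousOn_chartDeriv₂ hf c))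
    (fun c x hx => meanCurvature_eq_normalTrace hf himm hx)

lemma continuous_gradient {φ : M → ℝ} (hφ : ContMDiff (𝓡∂ k) 𝓘(ℝ, ℝ) 1 φ) :
    Continuous (gradient k f φ) := by
  have hf1 : ContMDiff (𝓡∂ k) 𝓘(ℝ, EuclideanSpace ℝ (Fin n)) 1 f := hf.of_le (by simp)
  exact continuous_of_charts
    (fun c => continuousOn_gradL (continuousOn_chartDeriv hf1 c)
      (fun y hy => chartDeriv_injective hf1 himm hy) (continuousOn_chartDeriv hφ c))
    (fun c x hx => gradient_eq_gradL hf1 himm hφ hx)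

omit hf himm in
lemma chartDeriv_eq_zero {g : M → V} {x : M} (hx : x ∉ tsupport g) :
    chartDeriv (k := k) g x (extChartAt (𝓡∂ k) x x) = 0 := by
  have h0 : g =ᶠ[𝓝 x] 0 := notMem_tsupport_iff_eventuallyEq.1 hx
  have ht : Tendsto (extChartAt (𝓡∂ k) x).symm (𝓝[range (𝓡∂ k)] (extChartAt (𝓡∂ k) x x))
      (𝓝 x) := by
    have := (map_extChartAt_symm_nhdsWithin_range (I := 𝓡∂ k) x).le
    exact this
  have h1 : g ∘ (extChartAt (𝓡∂ k) x).symm =ᶠ[𝓝[range (𝓡∂ k)] (extChartAt (𝓡∂ k) x x)]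
      fun _ => 0 := ht.eventually h0
  rw [chartDeriv, h1.fderivWithin_eq (by
    simp only [Function.comp_apply, extChartAt_to_inv]
    exact h0.self_of_nhds), fderivWithin_const_apply]

omit hf himm in
lemma gradient_eq_zero {φ : M → ℝ} {x : M} (hx : x ∉ tsupport φ) : gradient k f φ x = 0 := by
  rw [gradient_eq_gradL_self, chartDeriv_eq_zero hx]
  simp [gradL, dualVec]
  exact map_zero _

omit hf himm in
lemma chartDeriv_add {g g' : M → V} (hg : ContMDiff (𝓡∂ k) 𝓘(ℝ, V) 1 g)
    (hg' : ContMDiff (𝓡∂ k) 𝓘(ℝ, V) 1 g') {c : M} {y : EuclideanSpace ℝ (Fin k)}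
    (hy : y ∈ (extChartAt (𝓡∂ k) c).target) :
    chartDeriv (fun x => g x + g' x) c y = chartDeriv g c y + chartDeriv g' c y :=
  fderivWithin_fun_add (halfSpace_uniqueDiffOn y (target_subset_range c hy))
    (differentiableWithinAt_chart hg hy) (differentiableWithinAt_chart hg' hy)

omit hf himm in
lemma chartDeriv_smul {φ : M → ℝ} {g : M → V} (hφ : ContMDiff (𝓡∂ k) 𝓘(ℝ, ℝ) 1 φ)
    (hg : ContMDiff (𝓡∂ k) 𝓘(ℝ, V) 1 g) {c : M} {y : EuclideanSpace ℝ (Fin k)}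
    (hy : y ∈ (extChartAt (𝓡∂ k) c).target) (w : EuclideanSpace ℝ (Fin k)) :
    chartDeriv (fun x => φ x • g x) c y w =
      φ ((extChartAt (𝓡∂ k) c).symm y) • chartDeriv g c y w +
        chartDeriv φ c y w • g ((extChartAt (𝓡∂ k) c).symm y) := by
  have := fderivWithin_fun_smul (halfSpace_uniqueDiffOn y (target_subset_range c hy))
    (differentiableWithinAt_chart hφ hy) (differentiableWithinAt_chart hg hy)
  have h2 := DFunLike.congr_fun this w
  simp only [_root_.add_apply, _root_.smul_apply, ContinuousLinearMap.smulRight_apply,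
    Function.comp_apply] at h2
  exact h2

omit hf himm in
lemma gradient_add {φ φ' : M → ℝ} (hφ : ContMDiff (𝓡∂ k) 𝓘(ℝ, ℝ) 1 φ)
    (hφ' : ContMDiff (𝓡∂ k) 𝓘(ℝ, ℝ) 1 φ') (x : M) :
    gradient k f (fun x => φ x + φ' x) x = gradient k f φ x + gradient k f φ' x := by
  simp only [gradient_eq_gradL_self]
  rw [chartDeriv_add hφ hφ' (mem_extChartAt_target x), gradL_add]

omit hf himm in
lemma gradient_mul {φ φ' : M → ℝ} (hφ : ContMDiff (𝓡∂ k) 𝓘(ℝ, ℝ) 1 φ)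
    (hφ' : ContMDiff (𝓡∂ k) 𝓘(ℝ, ℝ) 1 φ') (x : M) :
    gradient k f (fun x => φ x * φ' x) x =
      φ x • gradient k f φ' x + φ' x • gradient k f φ x := by
  have : chartDeriv (fun x => φ x * φ' x) x (extChartAt (𝓡∂ k) x x) =
      φ x • chartDeriv φ' x (extChartAt (𝓡∂ k) x x) +
        φ' x • chartDeriv φ x (extChartAt (𝓡∂ k) x x) := by
    ext1 w
    have h := chartDeriv_smul hφ hφ' (mem_extChartAt_target x) w
    simp only [smul_eq_mul, extChartAt_to_inv] at h
    rw [h]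
    simp [mul_comm]
  simp only [gradient_eq_gradL_self]
  rw [this, gradL_add, gradL_smul, gradL_smul]

omit hf himm in
lemma gradient_const (a : ℝ) (x : M) : gradient k f (fun _ => a) x = 0 := by
  have : chartDeriv (fun _ : M => a) x (extChartAt (𝓡∂ k) x x) = 0 := by
    rw [chartDeriv]
    exact fderivWithin_const_apply ..
  rw [gradient_eq_gradL_self, this]
  simp [gradL, dualVec]
  exact map_zero _

/-- The interior part of the target of the chart centred at `c`. -/
def interiorTarget (c : M) : Set (EuclideanSpace ℝ (Fin k)) :=
  (extChartAt (𝓡∂ k) c).target ∩ {y | 0 < y 0}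

omit [IsManifold (𝓡∂ k) ∞ M] hf himm in
lemma range_mem_nhds {y : EuclideanSpace ℝ (Fin k)} (hy : 0 < y 0) : range (𝓡∂ k) ∈ 𝓝 y := by
  rw [← mem_interior_iff_mem_nhds, interior_range_modelWithCornersEuclideanHalfSpace]
  exact hy

omit [IsManifold (𝓡∂ k) ∞ M] hf himm in
lemma isOpen_interiorTarget (c : M) : IsOpen (interiorTarget (k := k) c) := by
  rw [isOpen_iff_mem_nhds]
  intro y hy
  refine inter_mem ?_ ?_
  · have := target_mem_nhdsWithin hy.1
    rwa [nhdsWithin_eq_nhds.2 (range_mem_nhds hy.2)] at this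
  · exact (isOpen_lt continuous_const (PiLp.continuous_apply 2 _ _)).mem_nhds hy.2

omit [IsManifold (𝓡∂ k) ∞ M] hf himm in
lemma chartDeriv_eq_fderiv (g : M → V) (c : M) {y : EuclideanSpace ℝ (Fin k)} (hy : 0 < y 0) :
    chartDeriv g c y = fderiv ℝ (g ∘ (extChartAt (𝓡∂ k) c).symm) y :=
  fderivWithin_of_mem_nhds (range_mem_nhds hy)

omit [IsManifold (𝓡∂ k) ∞ M] hf himm in
lemma chartDeriv₂_eq_fderiv (g : M → V) (c : M) {y : EuclideanSpace ℝ (Fin k)} (hy : 0 < y 0) :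
    chartDeriv₂ g c y = fderiv ℝ (fderiv ℝ (g ∘ (extChartAt (𝓡∂ k) c).symm)) y := by
  rw [chartDeriv₂, fderivWithin_of_mem_nhds (range_mem_nhds hy)]
  refine Filter.EventuallyEq.fderiv_eq ?_
  filter_upwards [(isOpen_lt continuous_const (PiLp.continuous_apply 2 _ 0)).mem_nhds hy]
    with z hz
  exact chartDeriv_eq_fderiv g c hz

omit hf himm in
lemma contDiffOn_interiorTarget {m : WithTop ℕ∞} (hm : m ≤ ∞) {g : M → V}
    (hg : ContMDiff (𝓡∂ k) 𝓘(ℝ, V) m g) (c : M) :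
    ContDiffOn ℝ m (g ∘ (extChartAt (𝓡∂ k) c).symm) (interiorTarget (k := k) c) :=
  fun _ hy => (contDiffWithinAt_chart hm hg hy.1).mono
    (inter_subset_left.trans (target_subset_range c))

omit [IsManifold (𝓡∂ k) ∞ M] hf himm in
-- Lets the integral over a chart be computed on an open set, where derivatives within the
-- half-space are ordinary derivatives.
lemma interiorTarget_ae_eq (c : M) :
    interiorTarget (k := k) c =ᵐ[volume] (extChartAt (𝓡∂ k) c).target := by
  have h0 : ∀ᵐ y : EuclideanSpace ℝ (Fin k), y 0 ≠ 0 := by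
    rw [ae_iff]
    simpa using volume_boundary_eq_zero (k := k)
  filter_upwards [h0] with y hy
  apply propext
  exact ⟨fun h => h.1, fun h => ⟨h, lt_of_le_of_ne (nonneg_of_mem_target h) (Ne.symm hy)⟩⟩

variable [MeasurableSpace M] [BorelSpace M] [CompactSpace M] [T2Space M]

omit himm in
lemma integrable_of_continuous {h : M → ℝ} (hc : Continuous h) :
    Integrable h (riemannianVolume k f) := by
  have hf1 : ContMDiff (𝓡∂ k) 𝓘(ℝ, EuclideanSpace ℝ (Fin n)) 1 f := hf.of_le (by simp)
  have := isFiniteMeasure_riemannianVolume (k := k) hf1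
  exact hc.integrable_of_hasCompactSupport (HasCompactSupport.of_compactSpace h)

/-- The coordinate first variation formula for the variation field `φ (f - ξ)`. -/
lemma integral_firstVariation_local (ξ : EuclideanSpace ℝ (Fin n)) {φ : M → ℝ}
    (hφ : ContMDiff (𝓡∂ k) 𝓘(ℝ, ℝ) 1 φ) {c : M}
    (hφi : tsupport φ ⊆ (𝓡∂ k).interior M) (hφc : tsupport φ ⊆ (extChartAt (𝓡∂ k) c).source) :
    ∫ x, (inner ℝ (gradient k f φ x) (f x - ξ) +
      φ x * (k + inner ℝ (f x - ξ) (meanCurvature k f x))) ∂(riemannianVolume k f) = 0 := by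
  have hf1 : ContMDiff (𝓡∂ k) 𝓘(ℝ, EuclideanSpace ℝ (Fin n)) 1 f := hf.of_le (by simp)
  have hcont : Continuous fun x => inner ℝ (gradient k f φ x) (f x - ξ) +
      φ x * (k + inner ℝ (f x - ξ) (meanCurvature k f x)) := by
    have h1 := continuous_gradient hf himm hφ
    have h2 := continuous_meanCurvature hf himm
    have h3 := hf.continuous
    have h4 := hφ.continuous
    fun_prop
  rw [integral_riemannianVolume_chart hf1 c hcont.aestronglyMeasurable]
  swap
  · intro x hx
    have hx' : x ∉ tsupport φ := fun h => hx (hφc h)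
    rw [gradient_eq_zero hx', image_eq_zero_of_notMem_tsupport hx']
    simp
  rw [← setIntegral_congr_set (interiorTarget_ae_eq c)]
  set K := extChartAt (𝓡∂ k) c '' tsupport φ with hK
  have hKc : IsCompact K := isCompact_chart_image (isClosed_tsupport φ).isCompact hφc
  have hKU : K ⊆ interiorTarget (k := k) c := by
    rintro _ ⟨x, hx, rfl⟩
    exact ⟨(extChartAt (𝓡∂ k) c).map_source (hφc hx), (mem_interior_iff (hφc hx)).1 (hφi hx)⟩
  have hff : ContMDiff (𝓡∂ k) 𝓘(ℝ, EuclideanSpace ℝ (Fin n)) 1 fun x => f x - ξ :=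
    hf1.sub contMDiff_const
  have hY : ContMDiff (𝓡∂ k) 𝓘(ℝ, EuclideanSpace ℝ (Fin n)) 1 fun x => φ x • (f x - ξ) :=
    hφ.smul hff
  have key := integral_firstVariation (f := f ∘ (extChartAt (𝓡∂ k) c).symm)
    (isOpen_interiorTarget c)
    ((contDiffOn_interiorTarget le_rfl hf c).of_le (by norm_cast))
    (fun y hy => by
      rw [← chartDeriv_eq_fderiv f c hy.2]
      exact chartDeriv_injective hf1 himm hy.1) hKc hKU
    (contDiffOn_interiorTarget (by simp) hY c) (by
      rintro y ⟨hy, hyK⟩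
      have : (extChartAt (𝓡∂ k) c).symm y ∉ tsupport φ := fun h =>
        hyK ⟨_, h, (extChartAt (𝓡∂ k) c).right_inv hy.1⟩
      simp only [Function.comp_apply]
      rw [image_eq_zero_of_notMem_tsupport this, zero_smul])
  rw [← key]
  refine setIntegral_congr_fun (isOpen_interiorTarget c).measurableSet fun y hy => ?_
  have hys := (extChartAt (𝓡∂ k) c).map_target hy.1
  simp only [← chartDeriv_eq_fderiv _ c hy.2, ← chartDeriv₂_eq_fderiv _ c hy.2]
  rw [density]
  congr 1
  rw [gradient_eq_gradL hf1 himm hφ hys, meanCurvature_eq_normalTrace hf himm hys,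
    (extChartAt (𝓡∂ k) c).right_inv hy.1]
  set J := chartDeriv f c y with hJ
  set N := normalTrace J (chartDeriv₂ f c y) with hN
  set x := (extChartAt (𝓡∂ k) c).symm y with hx
  have hJinj : Function.Injective J := chartDeriv_injective hf1 himm hy.1
  have hD : ∀ w, chartDeriv (fun x => φ x • (f x - ξ)) c y w =
      φ x • J w + chartDeriv φ c y w • (f x - ξ) := by
    intro w
    rw [chartDeriv_smul hφ hff hy.1]
    have : chartDeriv (fun x => f x - ξ) c y = J :=
      fderivWithin_sub_const ξ
    rw [this]
  simp only [Function.comp_apply]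
  -- The tangential divergence of the position vector is the metric trace of the metric, hence the
  -- dimension.
  have hk : (k : ℝ) = ∑ i, ∑ j, (gramL J)⁻¹ i j * gramL J i j := by
    have := trace_gramL hJinj
    rw [this, Fintype.card_fin]
  rw [real_inner_smul_left, mul_add, hk, gradL_eq_sum, sum_inner, ← add_assoc]
  congr 1
  rw [Finset.mul_sum, ← Finset.sum_add_distrib]
  refine Finset.sum_congr rfl fun i _ => ?_
  rw [Finset.mul_sum, sum_inner, ← Finset.sum_add_distrib]
  refine Finset.sum_congr rfl fun j _ => ?_
  rw [hD, inner_add_left, real_inner_smul_left, real_inner_smul_left, real_inner_smul_left,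
    gramL_symm]
  have : gramL J j i = inner ℝ (J (EuclideanSpace.single j 1)) (J (EuclideanSpace.single i 1)) :=
    rfl
  rw [this, real_inner_comm (f x - ξ)]
  ring

end Immersion

end ImmersedManifold

end

noncomputable section

/-! ### The flux of a continuous tangential field -/

namespace ImmersedManifold

open Filter Topology

/-- Fatou's lemma as an integrability criterion. -/
lemma integrable_of_tendsto_of_integral_le {α : Type*} [MeasurableSpace α] {μ : Measure α}
    {v : ℕ → α → ℝ} {w : α → ℝ} (hv : ∀ j, Integrable (v j) μ) (hv0 : ∀ j, ∀ᵐ x ∂μ, 0 ≤ v j x)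
    {C : ℝ} (hC : ∀ j, ∫ x, v j x ∂μ ≤ C)
    (hlim : ∀ᵐ x ∂μ, Tendsto (fun j => v j x) atTop (𝓝 (w x))) : Integrable w μ := by
  have hw : AEStronglyMeasurable w μ :=
    aestronglyMeasurable_of_tendsto_ae atTop (fun j => (hv j).aestronglyMeasurable) hlim
  have hw0 : ∀ᵐ x ∂μ, 0 ≤ w x := by
    filter_upwards [hlim, ae_all_iff.2 hv0] with x hx h0
    exact ge_of_tendsto' hx h0
  refine ⟨hw, ?_⟩
  rw [hasFiniteIntegral_iff_ofReal hw0]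
  have h1 : ∫⁻ x, ENNReal.ofReal (w x) ∂μ ≤
      liminf (fun j => ∫⁻ x, ENNReal.ofReal (v j x) ∂μ) atTop := by
    refine le_trans (lintegral_mono_ae ?_) (lintegral_liminf_le' fun j =>
      (hv j).aestronglyMeasurable.aemeasurable.ennreal_ofReal)
    filter_upwards [hlim] with x hx
    exact ((ENNReal.continuous_ofReal.tendsto _).comp hx).liminf_eq.ge
  refine h1.trans_lt (lt_of_le_of_lt (b := ENNReal.ofReal C) ?_ ENNReal.ofReal_lt_top)
  refine liminf_le_of_le (by isBoundedDefault) fun b hb => ?_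
  obtain ⟨j, hj⟩ := hb.exists
  refine hj.trans ?_
  rw [← ofReal_integral_eq_lintegral_ofReal (hv j) (hv0 j)]
  exact ENNReal.ofReal_le_ofReal (hC j)

variable {k n : ℕ} [NeZero k] {M : Type*} [TopologicalSpace M]
  [ChartedSpace (EuclideanHalfSpace k) M]
  {V : Type*} [NormedAddCommGroup V] [NormedSpace ℝ V]
  [IsManifold (𝓡∂ k) ∞ M]

variable (k M) in
lemma exists_partition [CompactSpace M] [T2Space M] :
    ∃ (t : Finset M) (ρ : t → M → ℝ), (∀ i, ContMDiff (𝓡∂ k) 𝓘(ℝ, ℝ) ∞ (ρ i)) ∧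
      (∀ i x, 0 ≤ ρ i x) ∧ (∀ i, tsupport (ρ i) ⊆ (extChartAt (𝓡∂ k) i.1).source) ∧
      ∀ x, ∑ i, ρ i x = 1 := by
  obtain ⟨t, ht⟩ := isCompact_univ.elim_finite_subcover
    (fun c : M => (extChartAt (𝓡∂ k) c).source) (fun c => isOpen_extChartAt_source c)
    (fun x _ => mem_iUnion.2 ⟨x, mem_extChartAt_source x⟩)
  obtain ⟨ρ, hρ⟩ := SmoothPartitionOfUnity.exists_isSubordinate (𝓡∂ k) (isClosed_univ (X := M))
    (fun i : t => (extChartAt (𝓡∂ k) i.1).source) (fun i => isOpen_extChartAt_source i.1)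
    (by
      intro x hx
      obtain ⟨c, hc, hxc⟩ := mem_iUnion₂.1 (ht hx)
      exact mem_iUnion.2 ⟨⟨c, hc⟩, hxc⟩)
  refine ⟨t, fun i => ρ i, fun i => (ρ i).contMDiff, fun i x => ρ.nonneg i x, hρ, fun x => ?_⟩
  have := ρ.sum_eq_one (mem_univ x)
  rwa [finsum_eq_sum_of_fintype] at this

lemma gradient_sum {ι : Type*} (s : Finset ι) (f : M → EuclideanSpace ℝ (Fin n)) {φ : ι → M → ℝ}
    (hφ : ∀ i, ContMDiff (𝓡∂ k) 𝓘(ℝ, ℝ) 1 (φ i)) (x : M) :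
    gradient k f (fun x => ∑ i ∈ s, φ i x) x = ∑ i ∈ s, gradient k f (φ i) x := by
  classical
  induction s using Finset.induction_on with
  | empty => simpa using gradient_const (k := k) (f := f) 0 x
  | insert a s ha ih =>
    simp only [Finset.sum_insert ha]
    rw [gradient_add (hφ a) (contMDiff_finsetSum fun i _ => hφ i), ih]

/-- A function cut off near the boundary in the chart centred at `c`. -/
def cutoff (c : M) (ρ : M → ℝ) (j : ℕ) (x : M) : ℝ :=
  ρ x * Real.smoothTransition (j * extChartAt (𝓡∂ k) c x 0 - 1)

/-! ### Smoothness, support and derivative of the boundary cutoffs. -/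

section Cutoff

variable {c : M} {ρ : M → ℝ} (hρc : tsupport ρ ⊆ (extChartAt (𝓡∂ k) c).source)

include hρc

omit [IsManifold (𝓡∂ k) ∞ M] hρc in
lemma tsupport_cutoff_subset (j : ℕ) : tsupport (cutoff (k := k) c ρ j) ⊆ tsupport ρ :=
  closure_mono (Function.support_mul_subset_left _ _)

/-- Smoothness is needed only on the support of `ρ`, which lies in the chart domain; outside that
domain the chart values are meaningless but `ρ` vanishes. -/
lemma contMDiff_cutoff (hρ : ContMDiff (𝓡∂ k) 𝓘(ℝ, ℝ) ∞ ρ) (j : ℕ) :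
    ContMDiff (𝓡∂ k) 𝓘(ℝ, ℝ) ∞ (cutoff (k := k) c ρ j) := by
  refine contMDiff_of_tsupport fun x hx => ?_
  have hxs := hρc (tsupport_cutoff_subset j hx)
  have h1 : ContMDiffAt (𝓡∂ k) 𝓘(ℝ, EuclideanSpace ℝ (Fin k)) ∞ (extChartAt (𝓡∂ k) c) x :=
    contMDiffAt_extChartAt' (by rwa [extChartAt_source] at hxs)
  have h2 : ContDiff ℝ ∞ fun y : EuclideanSpace ℝ (Fin k) =>
      Real.smoothTransition (j * y 0 - 1) := by
    have h0 : ContDiff ℝ ∞ fun y : EuclideanSpace ℝ (Fin k) => y 0 :=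
      (EuclideanSpace.proj (0 : Fin k) : EuclideanSpace ℝ (Fin k) →L[ℝ] ℝ).contDiff
    exact Real.smoothTransition.contDiff.comp ((contDiff_const.mul h0).sub contDiff_const)
  exact hρ.contMDiffAt.mul (h2.contMDiff.contMDiffAt.comp x h1)

/-- The shift by `-1` serves here: at a boundary point the argument of the transition function is
`-1`, hence negative nearby, and the cutoff vanishes on a neighbourhood. -/
lemma tsupport_cutoff_interior (j : ℕ) :
    tsupport (cutoff (k := k) c ρ j) ⊆ (𝓡∂ k).interior M := by
  intro x hx
  have hxs := hρc (tsupport_cutoff_subset j hx)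
  by_contra hxi
  rw [mem_interior_iff hxs, not_lt] at hxi
  have h1 : ContinuousAt (fun x => j * extChartAt (𝓡∂ k) c x 0 - 1) x := by
    have := (PiLp.continuous_apply 2 (fun _ : Fin k => ℝ) 0).continuousAt.comp
      (continuousAt_extChartAt' (I := 𝓡∂ k) hxs)
    exact (continuousAt_const.mul this).sub continuousAt_const
  have h2 : (j : ℝ) * extChartAt (𝓡∂ k) c x 0 - 1 < 0 := by
    have : (0 : ℝ) ≤ j := Nat.cast_nonneg j
    nlinarith
  have h3 : cutoff (k := k) c ρ j =ᶠ[𝓝 x] 0 := by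
    filter_upwards [h1.eventually_lt continuousAt_const h2] with z hz
    simp only [cutoff, Pi.zero_apply]
    rw [Real.smoothTransition.zero_of_nonpos hz.le, mul_zero]
  exact notMem_tsupport_iff_eventuallyEq.2 h3 hx

omit hρc in
-- The first term tends to the derivative of `ρ`. The second is the layer term, of size `j` on a
-- layer of thickness of order `1/j`, and yields the flux.
lemma chartDeriv_cutoff (hρ : ContMDiff (𝓡∂ k) 𝓘(ℝ, ℝ) ∞ ρ) (j : ℕ)
    {y : EuclideanSpace ℝ (Fin k)} (hy : y ∈ (extChartAt (𝓡∂ k) c).target)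
    (w : EuclideanSpace ℝ (Fin k)) :
    chartDeriv (cutoff (k := k) c ρ j) c y w =
      Real.smoothTransition (j * y 0 - 1) * chartDeriv ρ c y w +
        (j * deriv Real.smoothTransition (j * y 0 - 1)) *
          (ρ ((extChartAt (𝓡∂ k) c).symm y) * w 0) := by
  have h0 : HasFDerivAt (fun y : EuclideanSpace ℝ (Fin k) => (j : ℝ) * y 0 - 1)
      ((j : ℝ) • (EuclideanSpace.proj (0 : Fin k) : EuclideanSpace ℝ (Fin k) →L[ℝ] ℝ)) y :=
    ((EuclideanSpace.proj (0 : Fin k) :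
      EuclideanSpace ℝ (Fin k) →L[ℝ] ℝ).hasFDerivAt.const_mul _).sub_const _
  have h1 : HasFDerivAt (fun y : EuclideanSpace ℝ (Fin k) =>
      Real.smoothTransition (j * y 0 - 1)) (deriv Real.smoothTransition (j * y 0 - 1) •
        ((j : ℝ) • (EuclideanSpace.proj (0 : Fin k) : EuclideanSpace ℝ (Fin k) →L[ℝ] ℝ))) y := by
    have hd : DifferentiableAt ℝ Real.smoothTransition (j * y 0 - 1) :=
      (Real.smoothTransition.contDiffAt (n := 1)).differentiableAt one_ne_zero
    exact hd.hasDerivAt.comp_hasFDerivAt y h0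
  have h2 := (differentiableWithinAt_chart (hρ.of_le (by simp)) hy).hasFDerivWithinAt.mul
    (h1.hasFDerivWithinAt (s := range (𝓡∂ k)))
  have h3 : HasFDerivWithinAt (cutoff (k := k) c ρ j ∘ (extChartAt (𝓡∂ k) c).symm) _
      (range (𝓡∂ k)) y := h2.congr_of_eventuallyEq (by
    filter_upwards [target_mem_nhdsWithin hy] with z hz
    simp only [cutoff, Function.comp_apply, Pi.mul_apply]
    rw [(extChartAt (𝓡∂ k) c).right_inv hz]) (by
    simp only [cutoff, Function.comp_apply, Pi.mul_apply]
    rw [(extChartAt (𝓡∂ k) c).right_inv hy])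
  rw [chartDeriv, h3.fderivWithin (halfSpace_uniqueDiffOn y (target_subset_range c hy))]
  simp only [_root_.add_apply, _root_.smul_apply, smul_eq_mul, Function.comp_apply,
    chartDeriv]
  rw [show (EuclideanSpace.proj (0 : Fin k) : EuclideanSpace ℝ (Fin k) →L[ℝ] ℝ) w = w 0 from rfl]
  ring

omit hρc in
lemma chartDeriv_eq_zero_of_notMem {g : M → V} (hg : ContMDiff (𝓡∂ k) 𝓘(ℝ, V) 1 g) {c : M}
    {y : EuclideanSpace ℝ (Fin k)} (hy : y ∈ (extChartAt (𝓡∂ k) c).target)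
    (h : (extChartAt (𝓡∂ k) c).symm y ∉ tsupport g) : chartDeriv g c y = 0 := by
  rw [chartDeriv_trans hg hy (mem_extChartAt_source _), chartDeriv_eq_zero h,
    ContinuousLinearMap.zero_comp]

end Cutoff

/-! ### Flux through the boundary and its layer approximation. -/

section Immersion

variable {f : M → EuclideanSpace ℝ (Fin n)}
  (hf : ContMDiff (𝓡∂ k) 𝓘(ℝ, EuclideanSpace ℝ (Fin n)) ∞ f)
  (himm : ∀ x, Function.Injective (mfderiv (𝓡∂ k) 𝓘(ℝ, EuclideanSpace ℝ (Fin n)) f x))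

include hf himm

/-- The components of a tangential field in the chart centred at `c`. -/
def components (f X : M → EuclideanSpace ℝ (Fin n)) (c : M) (y : EuclideanSpace ℝ (Fin k)) :
    EuclideanSpace ℝ (Fin k) :=
  dualVec (chartDeriv f c y) (pairing (chartDeriv f c y) (X ((extChartAt (𝓡∂ k) c).symm y)))

lemma continuousOn_components {X : M → EuclideanSpace ℝ (Fin n)} (hX : Continuous X) (c : M) :
    ContinuousOn (components (k := k) f X c) (extChartAt (𝓡∂ k) c).target := by
  have hf1 : ContMDiff (𝓡∂ k) 𝓘(ℝ, EuclideanSpace ℝ (Fin n)) 1 f := hf.of_le (by simp)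
  exact continuousOn_dualVec (continuousOn_chartDeriv hf1 c)
    (fun y hy => chartDeriv_injective hf1 himm hy) (continuousOn_pairing
      (continuousOn_chartDeriv hf1 c) (hX.comp_continuousOn (continuousOn_extChartAt_symm c)))

lemma mem_range_chartDeriv {X : M → EuclideanSpace ℝ (Fin n)}
    (hXt : ∀ x, X x ∈ tangentPlane k f x) {c : M} {y : EuclideanSpace ℝ (Fin k)}
    (hy : y ∈ (extChartAt (𝓡∂ k) c).target) :
    X ((extChartAt (𝓡∂ k) c).symm y) ∈ range (chartDeriv f c y) := by
  have hf1 : ContMDiff (𝓡∂ k) 𝓘(ℝ, EuclideanSpace ℝ (Fin n)) 1 f := hf.of_le (by simp)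
  have := hXt ((extChartAt (𝓡∂ k) c).symm y)
  rw [tangentPlane_eq_range hf1 himm ((extChartAt (𝓡∂ k) c).map_target hy),
    (extChartAt (𝓡∂ k) c).right_inv hy] at this
  exact this

lemma inner_gradient_eq {X : M → EuclideanSpace ℝ (Fin n)}
    (hXt : ∀ x, X x ∈ tangentPlane k f x) {φ : M → ℝ} (hφ : ContMDiff (𝓡∂ k) 𝓘(ℝ, ℝ) 1 φ)
    {c : M} {y : EuclideanSpace ℝ (Fin k)} (hy : y ∈ (extChartAt (𝓡∂ k) c).target) :
    inner ℝ (gradient k f φ ((extChartAt (𝓡∂ k) c).symm y)) (X ((extChartAt (𝓡∂ k) c).symm y)) =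
      chartDeriv φ c y (components f X c y) := by
  have hf1 : ContMDiff (𝓡∂ k) 𝓘(ℝ, EuclideanSpace ℝ (Fin n)) 1 f := hf.of_le (by simp)
  rw [gradient_eq_gradL hf1 himm hφ ((extChartAt (𝓡∂ k) c).map_target hy),
    (extChartAt (𝓡∂ k) c).right_inv hy,
    inner_gradL_of_mem (chartDeriv_injective hf1 himm hy) _ (mem_range_chartDeriv hf himm hXt hy)]
  rfl

omit hf himm in
lemma norm_outwardConormal_le (x : M) : ‖outwardConormal k f x‖ ≤ 1 := by
  rw [outwardConormal, norm_neg, norm_smul, norm_inv, norm_norm]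
  exact inv_mul_le_one

/-- Turns the flux density on `∂M` into the normal component of the field times the interior
density, the quantity that the layer integral converges to. The sign is there because `∂₀f` points
inward. -/
lemma inner_outwardConormal_eq {X : M → EuclideanSpace ℝ (Fin n)}
    (hXt : ∀ x, X x ∈ tangentPlane k f x) {c : M} {z : EuclideanSpace ℝ {i : Fin k // i ≠ 0}}
    (hz : z ∈ boundaryTarget (k := k) c) :
    boundaryDensity f c z *
      inner ℝ (X ((extChartAt (𝓡∂ k) c).symm (boundaryInclusion z)))
        (outwardConormal k f ((extChartAt (𝓡∂ k) c).symm (boundaryInclusion z))) =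
      -(density f c (boundaryInclusion z) * components f X c (boundaryInclusion z) 0) := by
  have hf1 : ContMDiff (𝓡∂ k) 𝓘(ℝ, EuclideanSpace ℝ (Fin n)) 1 f := hf.of_le (by simp)
  have hxs := (extChartAt (𝓡∂ k) c).map_target hz
  have hr := (extChartAt (𝓡∂ k) c).right_inv hz
  have hxb : (extChartAt (𝓡∂ k) c).symm (boundaryInclusion z) ∈ (𝓡∂ k).boundary M := by
    rw [mem_boundary_iff hxs, hr, boundaryInclusion_zero]
  have hJ := chartDeriv_injective hf1 himm hz
  rw [outwardConormal_eq hf1 himm hxs hxb, hr,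
    ← map_dualVec_pairing hJ (mem_range_chartDeriv hf himm hXt hz), mul_comm]
  have h := inner_conormal_mul_sqrt_det 0 hJ (components f X c (boundaryInclusion z))
  have hD : boundaryDensity f c z = Real.sqrt ((gramL (chartDeriv f c
      (boundaryInclusion z))).submatrix (Subtype.val : {i : Fin k // i ≠ 0} → Fin k)
        Subtype.val).det := by
    rw [boundaryDensity]
    congr 2
    ext i j
    simp only [gramL, Matrix.of_apply, ContinuousLinearMap.comp_apply, boundaryInclusionL_single,
      Matrix.submatrix_apply]
  rw [hD, density, mul_comm (Real.sqrt (gramL _).det)]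
  exact h

variable [MeasurableSpace M] [BorelSpace M] [CompactSpace M]

/-- The conormal is defined by a chart depending on the point. In one fixed chart it coincides
almost everywhere for the boundary measure with a continuous expression. -/
lemma aestronglyMeasurable_outwardConormal :
    AEStronglyMeasurable (outwardConormal k f) (boundaryVolume k f) := by
  have hf1 : ContMDiff (𝓡∂ k) 𝓘(ℝ, EuclideanSpace ℝ (Fin n)) 1 f := hf.of_le (by simp)
  refine aestronglyMeasurable_of_charts (k := k) fun c => ?_
  set T := (extChartAt (𝓡∂ k) c).target
  have hJc : ContinuousOn (chartDeriv f c) T := continuousOn_chartDeriv hf1 c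
  have hi : ∀ y ∈ T, Function.Injective (chartDeriv f c y) := fun y hy =>
    chartDeriv_injective hf1 himm hy
  have hbi : Function.Injective (boundaryInclusionL (k := k)) := fun z z' h => by
    rw [← boundaryProjectionL_inclusion z, ← boundaryInclusionL_apply, h, boundaryInclusionL_apply,
      boundaryProjectionL_inclusion]
  -- The span of the `∂ᵢf`, `i ≠ 0`, is the range of the derivative composed with the hyperplane
  -- inclusion, so its projection has the continuous form of `starProjection_range`.
  have hN : ContinuousOn (fun y => normalL 0 (chartDeriv f c y)) T := by
    have h0 : ContinuousOn (fun y => chartDeriv f c y (EuclideanSpace.single 0 1)) T :=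
      hJc.clm_apply continuousOn_const
    have hJb : ContinuousOn (fun y => (chartDeriv f c y).comp (boundaryInclusionL (k := k))) T :=
      hJc.clm_comp continuousOn_const
    have hib : ∀ y ∈ T, Function.Injective
        ((chartDeriv f c y).comp (boundaryInclusionL (k := k))) :=
      fun y hy => (hi y hy).comp hbi
    refine ContinuousOn.congr (h0.sub (continuousOn_gradL hJb hib
      (continuousOn_pairing hJb h0))) fun y hy => ?_
    change normalL 0 (chartDeriv f c y) = chartDeriv f c y (EuclideanSpace.single 0 1) - _
    beta_reduce
    rw [normalL, ← starProjection_range (hib y hy)]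
    congr 3
    rw [← span_range_basis]
    congr 1
    ext v
    constructor
    · rintro ⟨i, hi, rfl⟩
      exact ⟨⟨i, hi⟩, by simp [boundaryInclusionL_single]⟩
    · rintro ⟨i, rfl⟩
      exact ⟨i.1, i.2, by simp [boundaryInclusionL_single]⟩
  have hν : ContinuousOn (fun x => -(‖normalL 0 (chartDeriv f c (extChartAt (𝓡∂ k) c x))‖⁻¹ •
      normalL 0 (chartDeriv f c (extChartAt (𝓡∂ k) c x)))) (extChartAt (𝓡∂ k) c).source := by
    have h := hN.comp (continuousOn_extChartAt (I := 𝓡∂ k) c) (extChartAt (𝓡∂ k) c).mapsTo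
    refine ((h.norm.inv₀ fun x hx => ?_).smul h).neg
    exact norm_ne_zero_iff.2 (normalL_ne_zero 0 (hi _ ((extChartAt (𝓡∂ k) c).map_source hx)))
  refine (hν.aestronglyMeasurable (measurableSet_source c)).congr ?_
  filter_upwards [ae_restrict_mem (measurableSet_source c),
    ae_restrict_of_ae (ae_boundaryVolume_mem_boundary hf1)] with x hx hxb
  exact (outwardConormal_eq hf1 himm hx hxb).symm

variable [T2Space M]

lemma integrable_flux {X : M → EuclideanSpace ℝ (Fin n)} (hX : Continuous X) :
    Integrable (fun x => inner ℝ (X x) (outwardConormal k f x)) (boundaryVolume k f) := by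
  have hf1 : ContMDiff (𝓡∂ k) 𝓘(ℝ, EuclideanSpace ℝ (Fin n)) 1 f := hf.of_le (by simp)
  have := isFiniteMeasure_boundaryVolume (k := k) hf1
  obtain ⟨C, hC⟩ := isCompact_univ.exists_bound_of_continuousOn hX.continuousOn
  refine Integrable.of_bound (hX.aestronglyMeasurable.inner
    (aestronglyMeasurable_outwardConormal hf himm)) C (Eventually.of_forall fun x => ?_)
  calc ‖inner ℝ (X x) (outwardConormal k f x)‖ ≤ ‖X x‖ * ‖outwardConormal k f x‖ :=
        norm_inner_le_norm _ _
    _ ≤ C * 1 := mul_le_mul (hC x (mem_univ x)) (norm_outwardConormal_le x) (norm_nonneg _)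
        ((norm_nonneg _).trans (hC x (mem_univ x)))
    _ = C := mul_one C

/-- The boundary flux as a limit over cutoff functions, in the domain of a chart. -/
lemma tendsto_integral_inner_gradient_cutoff {X : M → EuclideanSpace ℝ (Fin n)}
    (hX : Continuous X) (hXt : ∀ x, X x ∈ tangentPlane k f x) {c : M} {ρ : M → ℝ}
    (hρ : ContMDiff (𝓡∂ k) 𝓘(ℝ, ℝ) ∞ ρ) (hρc : tsupport ρ ⊆ (extChartAt (𝓡∂ k) c).source) :
    Tendsto (fun j : ℕ => ∫ x, inner ℝ (gradient k f (cutoff (k := k) c ρ j) x) (X x)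
        ∂(riemannianVolume k f)) atTop
      (𝓝 ((∫ x, inner ℝ (gradient k f ρ x) (X x) ∂(riemannianVolume k f)) -
        ∫ x, ρ x * inner ℝ (X x) (outwardConormal k f x) ∂(boundaryVolume k f))) := by
  classical
  have hf1 : ContMDiff (𝓡∂ k) 𝓘(ℝ, EuclideanSpace ℝ (Fin n)) 1 f := hf.of_le (by simp)
  have hρ1 : ContMDiff (𝓡∂ k) 𝓘(ℝ, ℝ) 1 ρ := hρ.of_le (by simp)
  set T := (extChartAt (𝓡∂ k) c).target with hT
  set Hs := {y : EuclideanSpace ℝ (Fin k) | 0 ≤ y 0} with hHs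
  have hTH : T ⊆ Hs := fun y hy => nonneg_of_mem_target hy
  have hHr : Hs = range (𝓡∂ k) := (range_modelWithCornersEuclideanHalfSpace k).symm
  -- `P` carries the derivative of `ρ` and `Q` the layer term of the product rule, both extended by
  -- zero to the half-space.
  set P : EuclideanSpace ℝ (Fin k) → ℝ := T.indicator fun y =>
    density f c y * chartDeriv ρ c y (components f X c y) with hP
  set Q : EuclideanSpace ℝ (Fin k) → ℝ := T.indicator fun y =>
    density f c y * (ρ ((extChartAt (𝓡∂ k) c).symm y) * components f X c y 0) with hQ
  set K := extChartAt (𝓡∂ k) c '' tsupport ρ with hK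
  have hKc : IsCompact K := isCompact_chart_image (isClosed_tsupport ρ).isCompact hρc
  have hKT : K ⊆ T := by
    rintro _ ⟨x, hx, rfl⟩
    exact (extChartAt (𝓡∂ k) c).map_source (hρc hx)
  have hnot : ∀ y ∈ T, y ∉ K → (extChartAt (𝓡∂ k) c).symm y ∉ tsupport ρ := fun y hy hyK h =>
    hyK ⟨_, h, (extChartAt (𝓡∂ k) c).right_inv hy⟩
  have hP0 : ∀ y ∉ K, P y = 0 := by
    intro y hyK
    by_cases hy : y ∈ T
    · rw [hP, indicator_of_mem hy, chartDeriv_eq_zero_of_notMem hρ1 hy (hnot y hy hyK)]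
      simp
    · exact indicator_of_notMem hy _
  have hQ0 : ∀ y ∉ K, Q y = 0 := by
    intro y hyK
    by_cases hy : y ∈ T
    · rw [hQ, indicator_of_mem hy, image_eq_zero_of_notMem_tsupport (hnot y hy hyK)]
      simp
    · exact indicator_of_notMem hy _
  -- The support is a compact subset of the chart target, so extension by zero keeps continuity on
  -- the closed half-space.
  have hcont : ∀ G : EuclideanSpace ℝ (Fin k) → ℝ, ContinuousOn G T →
      (∀ y ∉ K, T.indicator G y = 0) → ContinuousOn (T.indicator G) Hs := by
    intro G hG hG0 y hy
    by_cases hyT : y ∈ T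
    · have h1 : ContinuousWithinAt (T.indicator G) T y :=
        (hG y hyT).congr (fun z hz => indicator_of_mem hz _) (indicator_of_mem hyT _)
      refine h1.mono_of_mem_nhdsWithin ?_
      rw [hHr]
      exact target_mem_nhdsWithin hyT
    · have h1 : T.indicator G =ᶠ[𝓝 y] fun _ => 0 := by
        filter_upwards [hKc.isClosed.isOpen_compl.mem_nhds fun h => hyT (hKT h)] with z hz
        exact hG0 z hz
      exact (continuousAt_const.congr h1.symm).continuousWithinAt
  have hbc := continuousOn_components hf himm hX c
  have hdc := continuousOn_density hf1 c
  have hPc : ContinuousOn P Hs := hcont _ (hdc.mul ((continuousOn_chartDeriv hρ1 c).clm_apply hbc))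
    hP0
  have hQc : ContinuousOn Q Hs := hcont _ (hdc.mul ((hρ.continuous.comp_continuousOn
    (continuousOn_extChartAt_symm c)).mul
      ((PiLp.continuous_apply 2 (fun _ : Fin k => ℝ) 0).comp_continuousOn hbc))) hQ0
  obtain ⟨R, hR⟩ := hKc.isBounded.exists_norm_le
  have hPR : ∀ y, R < ‖y‖ → P y = 0 := fun y hy => hP0 y fun h => (hR y h).not_gt hy
  have hQR : ∀ y, R < ‖y‖ → Q y = 0 := fun y hy => hQ0 y fun h => (hR y h).not_gt hy
  have hzero : ∀ φ : M → ℝ, tsupport φ ⊆ tsupport ρ → ∀ x ∉ (extChartAt (𝓡∂ k) c).source,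
      inner ℝ (gradient k f φ x) (X x) = 0 := by
    intro φ hφ x hx
    rw [gradient_eq_zero fun h => hx (hρc (hφ h)), inner_zero_left]
  have hTm : MeasurableSet T := measurableSet_target c
  have hchart : ∀ φ : M → ℝ, ContMDiff (𝓡∂ k) 𝓘(ℝ, ℝ) 1 φ → tsupport φ ⊆ tsupport ρ →
      ∫ x, inner ℝ (gradient k f φ x) (X x) ∂(riemannianVolume k f) =
      ∫ y in Hs, T.indicator (fun y => density f c y * chartDeriv φ c y (components f X c y)) y := by
    intro φ hφ hφρ
    rw [integral_riemannianVolume_chart hf1 c ((continuous_gradient hf himm hφ).inner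
      hX).aestronglyMeasurable (hzero φ hφρ), setIntegral_indicator hTm, inter_eq_right.2 hTH]
    exact setIntegral_congr_fun hTm fun y hy => by
      beta_reduce
      rw [inner_gradient_eq hf himm hXt hφ hy]
  have hbdry : ∫ z, Q (boundaryInclusion z) =
      -∫ x, ρ x * inner ℝ (X x) (outwardConormal k f x) ∂(boundaryVolume k f) := by
    have hm : AEStronglyMeasurable (fun x => ρ x * inner ℝ (X x) (outwardConormal k f x))
        (boundaryVolume k f) :=
      hρ.continuous.aestronglyMeasurable.mul (integrable_flux hf himm hX).aestronglyMeasurable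
    rw [integral_boundaryVolume_chart hf1 c hm
      (fun x hx => by rw [image_eq_zero_of_notMem_tsupport fun h => hx (hρc h), zero_mul]),
      ← integral_neg, ← integral_indicator (measurableSet_boundaryTarget c)]
    congr 1
    ext z
    by_cases hz : z ∈ boundaryTarget (k := k) c
    · have hz' : boundaryInclusion z ∈ T := hz
      rw [indicator_of_mem hz, hQ, indicator_of_mem hz']
      have := inner_outwardConormal_eq hf himm hXt hz
      linear_combination (ρ ((extChartAt (𝓡∂ k) c).symm (boundaryInclusion z))) * this
    · have hz' : boundaryInclusion z ∉ T := hz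
      rw [indicator_of_notMem hz, hQ, indicator_of_notMem hz']
  rw [hchart ρ hρ1 subset_rfl, sub_eq_add_neg, ← hbdry]
  have hPi := integrableOn_halfSpace hPc hPR
  have hQi : ∀ j : ℕ, IntegrableOn (fun y : EuclideanSpace ℝ (Fin k) =>
      (j * deriv Real.smoothTransition (j * y 0 - 1)) * Q y) Hs := by
    intro j
    refine integrableOn_halfSpace (ContinuousOn.mul (Continuous.continuousOn ?_) hQc)
      (R := R) fun y hy => by rw [hQR y hy, mul_zero]
    have := PiLp.continuous_apply 2 (fun _ : Fin k => ℝ) 0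
    exact continuous_const.mul (continuous_deriv_smoothTransition.comp
      ((continuous_const.mul this).sub continuous_const))
  have hPji : ∀ j : ℕ, IntegrableOn (fun y : EuclideanSpace ℝ (Fin k) =>
      Real.smoothTransition (j * y 0 - 1) * P y) Hs := by
    intro j
    refine integrableOn_halfSpace (ContinuousOn.mul (Continuous.continuousOn ?_) hPc)
      (R := R) fun y hy => by rw [hPR y hy, mul_zero]
    have := PiLp.continuous_apply 2 (fun _ : Fin k => ℝ) 0
    exact Real.smoothTransition.continuous.comp
      ((continuous_const.mul this).sub continuous_const)
  refine ((tendsto_integral_cutoff hPi).add (tendsto_integral_layer hQc hQR)).congr fun j => ?_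
  rw [hchart _ ((contMDiff_cutoff hρc hρ j).of_le (by simp)) (tsupport_cutoff_subset j),
    ← integral_add (hPji j) (hQi j)]
  refine setIntegral_congr_fun isClosed_halfSpace.measurableSet fun y _ => ?_
  by_cases hy : y ∈ T
  · simp only [hP, hQ, indicator_of_mem hy]
    rw [chartDeriv_cutoff hρ j hy]
    ring
  · simp only [hP, hQ, indicator_of_notMem hy]
    ring

end Immersion

end ImmersedManifold

end

noncomputable section

/-! ### The divergence theorem for continuous tangential fields with a weak divergence -/

namespace ImmersedManifold

open Filter Topology

variable {k n : ℕ} [NeZero k] {M : Type*} [TopologicalSpace M]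
  [ChartedSpace (EuclideanHalfSpace k) M] [IsManifold (𝓡∂ k) ∞ M]

/-- At an interior point the sequence is eventually constant. -/
lemma tendsto_cutoff {c : M} {ρ : M → ℝ} (hρc : tsupport ρ ⊆ (extChartAt (𝓡∂ k) c).source)
    {x : M} (hx : x ∈ (𝓡∂ k).interior M) :
    Tendsto (fun j => cutoff (k := k) c ρ j x) atTop (𝓝 (ρ x)) := by
  by_cases hxs : x ∈ (extChartAt (𝓡∂ k) c).source
  · rw [mem_interior_iff hxs] at hx
    -- Once `j y₀ ≥ 2` the argument `j y₀ - 1` is at least `1`, where the transition function equals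
    -- `1`.
    obtain ⟨N, hN⟩ := exists_nat_gt (2 / extChartAt (𝓡∂ k) c x 0)
    refine tendsto_const_nhds.congr' ?_
    filter_upwards [eventually_ge_atTop N] with j hj
    rw [div_lt_iff₀ hx] at hN
    have hj' : (N : ℝ) ≤ j := Nat.cast_le.2 hj
    rw [cutoff, Real.smoothTransition.one_of_one_le (by nlinarith), mul_one]
  · have h0 : ρ x = 0 := image_eq_zero_of_notMem_tsupport fun h => hxs (hρc h)
    simp [cutoff, h0]

lemma norm_cutoff_le (c : M) (ρ : M → ℝ) (j : ℕ) (x : M) :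
    ‖cutoff (k := k) c ρ j x‖ ≤ ‖ρ x‖ := by
  rw [cutoff, norm_mul, Real.norm_of_nonneg (Real.smoothTransition.nonneg _)]
  exact mul_le_of_le_one_right (norm_nonneg _) (Real.smoothTransition.le_one _)

lemma cutoff_nonneg {ρ : M → ℝ} (hρ : ∀ x, 0 ≤ ρ x) (c : M) (j : ℕ) (x : M) :
    0 ≤ cutoff (k := k) c ρ j x :=
  mul_nonneg (hρ x) (Real.smoothTransition.nonneg _)

variable [MeasurableSpace M]

variable (k) in
/-- `u` is the divergence of the tangential field `X` in the interior of `M`, in the weak sense. -/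
def HasWeakDivergence (f X : M → EuclideanSpace ℝ (Fin n)) (u : M → ℝ) : Prop :=
  ∀ φ : M → ℝ, ContMDiff (𝓡∂ k) 𝓘(ℝ, ℝ) ∞ φ → tsupport φ ⊆ (𝓡∂ k).interior M →
    ∫ x, φ x * u x ∂(riemannianVolume k f) =
      -∫ x, inner ℝ (gradient k f φ x) (X x) ∂(riemannianVolume k f)

variable [BorelSpace M] [CompactSpace M] [T2Space M] {f : M → EuclideanSpace ℝ (Fin n)}
  (hf : ContMDiff (𝓡∂ k) 𝓘(ℝ, EuclideanSpace ℝ (Fin n)) ∞ f)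
  (himm : ∀ x, Function.Injective (mfderiv (𝓡∂ k) 𝓘(ℝ, EuclideanSpace ℝ (Fin n)) f x))

include hf

lemma ae_mem_interior : ∀ᵐ x ∂(riemannianVolume k f), x ∈ (𝓡∂ k).interior M := by
  have h := riemannianVolume_boundary (k := k) (hf.of_le (by simp))
  rw [← ModelWithCorners.compl_interior] at h
  exact h

lemma integrable_mul_of_tsupport_subset_interior {u : M → ℝ}
    (hu : LocallyIntegrableOn u ((𝓡∂ k).interior M) (riemannianVolume k f)) {φ : M → ℝ}
    (hφ : Continuous φ) (hφi : tsupport φ ⊆ (𝓡∂ k).interior M) :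
    Integrable (fun x => φ x * u x) (riemannianVolume k f) := by
  have hK : IsCompact (tsupport φ) := (isClosed_tsupport φ).isCompact
  have h := ((hu.mono_set hφi).integrableOn_isCompact hK).continuousOn_mul hφ.continuousOn hK
  refine (integrableOn_iff_integrable_of_support_subset ?_).1 h
  exact (Function.support_mul_subset_left _ _).trans (subset_tsupport φ)

include himm

/-- A partition of unity reduces to a chart. The test function is only `C¹` because it will be a
product with a multiple of `ψ`. -/
lemma integral_firstVariation_interior (ξ : EuclideanSpace ℝ (Fin n)) {φ : M → ℝ}
    (hφ : ContMDiff (𝓡∂ k) 𝓘(ℝ, ℝ) 1 φ) (hφi : tsupport φ ⊆ (𝓡∂ k).interior M) :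
    ∫ x, (inner ℝ (gradient k f φ x) (f x - ξ) +
      φ x * (k + inner ℝ (f x - ξ) (meanCurvature k f x))) ∂(riemannianVolume k f) = 0 := by
  obtain ⟨t, ρ, hρ, -, hρs, hρ1⟩ := exists_partition k M
  have hρφ : ∀ i, ContMDiff (𝓡∂ k) 𝓘(ℝ, ℝ) 1 (fun x => ρ i x * φ x) := fun i =>
    ((hρ i).of_le (by simp)).mul hφ
  have hφs : φ = fun x => ∑ i, ρ i x * φ x := by
    ext x
    rw [← Finset.sum_mul, hρ1, one_mul]
  have key : ∀ x, inner ℝ (gradient k f φ x) (f x - ξ) +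
      φ x * (k + inner ℝ (f x - ξ) (meanCurvature k f x)) =
      ∑ i, (inner ℝ (gradient k f (fun x => ρ i x * φ x) x) (f x - ξ) +
        (ρ i x * φ x) * (k + inner ℝ (f x - ξ) (meanCurvature k f x))) := by
    intro x
    rw [Finset.sum_add_distrib, ← sum_inner, ← gradient_sum Finset.univ f hρφ, ← Finset.sum_mul,
      ← hφs, ← Finset.sum_mul, hρ1, one_mul]
  have hc : Continuous fun x => f x - ξ := hf.continuous.sub continuous_const
  simp_rw [key]
  rw [integral_finsetSum]
  · refine Finset.sum_eq_zero fun i _ => integral_firstVariation_local hf himm ξ (hρφ i)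
      (c := i.1) ?_ ?_
    · exact (closure_mono (Function.support_mul_subset_right _ _)).trans hφi
    · exact (closure_mono (Function.support_mul_subset_left _ _)).trans (hρs i)
  · intro i _
    exact integrable_of_continuous hf (((continuous_gradient hf himm (hρφ i)).inner hc).add
      ((hρφ i).continuous.mul (continuous_const.add
        (hc.inner (continuous_meanCurvature hf himm)))))

/-- The cutoffs are admissible test functions. The limit exists although `u` need not be integrable
up to the boundary, which matters for the Fatou argument. -/
lemma tendsto_integral_cutoff_mul {X : M → EuclideanSpace ℝ (Fin n)} {u : M → ℝ}
    (hX : Continuous X) (hXt : ∀ x, X x ∈ tangentPlane k f x) (hu : HasWeakDivergence k f X u)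
    {c : M} {ρ : M → ℝ} (hρ : ContMDiff (𝓡∂ k) 𝓘(ℝ, ℝ) ∞ ρ)
    (hρc : tsupport ρ ⊆ (extChartAt (𝓡∂ k) c).source) :
    Tendsto (fun j : ℕ => ∫ x, cutoff (k := k) c ρ j x * u x ∂(riemannianVolume k f)) atTop
      (𝓝 ((∫ x, ρ x * inner ℝ (X x) (outwardConormal k f x) ∂(boundaryVolume k f)) -
        ∫ x, inner ℝ (gradient k f ρ x) (X x) ∂(riemannianVolume k f))) := by
  rw [← neg_sub]
  refine (tendsto_integral_inner_gradient_cutoff hf himm hX hXt hρ hρc).neg.congr fun j => ?_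
  exact (hu _ (contMDiff_cutoff hρc hρ j) (tsupport_cutoff_interior hρc j)).symm

/-- The divergence theorem. -/
theorem integral_eq_flux {X : M → EuclideanSpace ℝ (Fin n)} {u : M → ℝ}
    (hX : Continuous X) (hXt : ∀ x, X x ∈ tangentPlane k f x) (hu : HasWeakDivergence k f X u)
    (hui : Integrable u (riemannianVolume k f)) :
    ∫ x, u x ∂(riemannianVolume k f) =
      ∫ x, inner ℝ (X x) (outwardConormal k f x) ∂(boundaryVolume k f) := by
  obtain ⟨t, ρ, hρ, -, hρs, hρ1⟩ := exists_partition k M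
  have hρ1' : ∀ i, ContMDiff (𝓡∂ k) 𝓘(ℝ, ℝ) 1 (ρ i) := fun i => (hρ i).of_le (by simp)
  have hρu : ∀ i, Integrable (fun x => ρ i x * u x) (riemannianVolume k f) := by
    intro i
    obtain ⟨C, hC⟩ := isCompact_univ.exists_bound_of_continuousOn (hρ i).continuous.continuousOn
    exact hui.bdd_mul (hρ i).continuous.aestronglyMeasurable
      (Eventually.of_forall fun x => hC x (mem_univ x))
  have hflux := integrable_flux hf himm hX
  have hρν : ∀ i, Integrable (fun x => ρ i x * inner ℝ (X x) (outwardConormal k f x))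
      (boundaryVolume k f) := by
    intro i
    obtain ⟨C, hC⟩ := isCompact_univ.exists_bound_of_continuousOn (hρ i).continuous.continuousOn
    exact hflux.bdd_mul (hρ i).continuous.aestronglyMeasurable
      (Eventually.of_forall fun x => hC x (mem_univ x))
  have hρX : ∀ i, Integrable (fun x => inner ℝ (gradient k f (ρ i) x) (X x))
      (riemannianVolume k f) := fun i =>
    integrable_of_continuous hf ((continuous_gradient hf himm (hρ1' i)).inner hX)
  -- Two computations of one limit: dominated convergence, and the layer limit of the weak
  -- formulation.
  have hloc : ∀ i, ∫ x, ρ i x * u x ∂(riemannianVolume k f) =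
      (∫ x, ρ i x * inner ℝ (X x) (outwardConormal k f x) ∂(boundaryVolume k f)) -
        ∫ x, inner ℝ (gradient k f (ρ i) x) (X x) ∂(riemannianVolume k f) := by
    intro i
    refine tendsto_nhds_unique ?_ (tendsto_integral_cutoff_mul hf himm hX hXt hu (hρ i) (hρs i))
    refine tendsto_integral_of_dominated_convergence (fun x => ‖ρ i x * u x‖) (fun j => ?_)
      (hρu i).norm (fun j => Eventually.of_forall fun x => ?_) ?_
    · exact ((contMDiff_cutoff (hρs i) (hρ i) j).continuous.aestronglyMeasurable).mul
        hui.aestronglyMeasurable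
    · rw [norm_mul, norm_mul]
      exact mul_le_mul_of_nonneg_right (norm_cutoff_le _ _ _ _) (norm_nonneg _)
    · filter_upwards [ae_mem_interior hf] with x hx
      exact (tendsto_cutoff (hρs i) hx).mul_const _
  calc ∫ x, u x ∂(riemannianVolume k f)
      = ∫ x, ∑ i, ρ i x * u x ∂(riemannianVolume k f) := by
        simp_rw [← Finset.sum_mul, hρ1, one_mul]
    _ = ∑ i, ((∫ x, ρ i x * inner ℝ (X x) (outwardConormal k f x) ∂(boundaryVolume k f)) -
        ∫ x, inner ℝ (gradient k f (ρ i) x) (X x) ∂(riemannianVolume k f)) := by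
        rw [integral_finsetSum _ fun i _ => hρu i]
        exact Finset.sum_congr rfl fun i _ => hloc i
    _ = (∫ x, inner ℝ (X x) (outwardConormal k f x) ∂(boundaryVolume k f)) -
        ∫ x, inner ℝ (gradient k f (fun x => ∑ i, ρ i x) x) (X x) ∂(riemannianVolume k f) := by
        rw [Finset.sum_sub_distrib, ← integral_finsetSum _ fun i _ => hρν i,
          ← integral_finsetSum _ fun i _ => hρX i]
        simp_rw [← Finset.sum_mul, hρ1, one_mul, ← sum_inner, ← gradient_sum Finset.univ f hρ1',
          hρ1]
    _ = ∫ x, inner ℝ (X x) (outwardConormal k f x) ∂(boundaryVolume k f) := by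
        -- The partition functions sum to `1`, whose gradient is zero; the interior terms cancel
        -- altogether.
        simp_rw [hρ1, gradient_const, inner_zero_left, integral_zero, sub_zero]

/-- A weak divergence with a sign is integrable up to the boundary. -/
theorem integrable_of_hasWeakDivergence {X : M → EuclideanSpace ℝ (Fin n)} {u : M → ℝ}
    (hX : Continuous X) (hXt : ∀ x, X x ∈ tangentPlane k f x) (hu : HasWeakDivergence k f X u)
    (hul : LocallyIntegrableOn u ((𝓡∂ k).interior M) (riemannianVolume k f))
    (hu0 : ∀ᵐ x ∂(riemannianVolume k f), u x ≤ 0) : Integrable u (riemannianVolume k f) := by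
  obtain ⟨t, ρ, hρ, hρ0, hρs, hρ1⟩ := exists_partition k M
  have hρu : ∀ i, Integrable (fun x => -(ρ i x * u x)) (riemannianVolume k f) := by
    intro i
    -- A convergent sequence is bounded. The integrands `-(cutoff · u)` are nonnegative, so Fatou's
    -- lemma turns this bound into integrability.
    have hlim := (tendsto_integral_cutoff_mul hf himm hX hXt hu (hρ i) (hρs i)).neg
    obtain ⟨C, hC⟩ := hlim.bddAbove_range
    refine integrable_of_tendsto_of_integral_le
      (v := fun j x => -(cutoff (k := k) i.1 (ρ i) j x * u x)) (C := C) (fun j => ?_) (fun j => ?_)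
      (fun j => ?_) ?_
    · exact (integrable_mul_of_tsupport_subset_interior hf hul
        (contMDiff_cutoff (hρs i) (hρ i) j).continuous (tsupport_cutoff_interior (hρs i) j)).neg
    · filter_upwards [hu0] with x hx
      exact neg_nonneg.2 (mul_nonpos_of_nonneg_of_nonpos (cutoff_nonneg (hρ0 i) _ _ _) hx)
    · rw [integral_neg]
      exact hC ⟨j, rfl⟩
    · filter_upwards [ae_mem_interior hf] with x hx
      exact ((tendsto_cutoff (hρs i) hx).mul_const _).neg
  have h := integrable_finsetSum Finset.univ fun i _ => (hρu i).neg
  refine h.congr (Eventually.of_forall fun x => ?_)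
  simp only [Pi.neg_apply, neg_neg, ← Finset.sum_mul, hρ1, one_mul]

end ImmersedManifold

end

noncomputable section

/-! ### Powers of the radial distance -/

namespace ImmersedManifold

open Filter Topology

/-- In polar coordinates the integrand is `t^(k-1-γ)`, with exponent above `-1` exactly because `γ <
k`. -/
lemma integrableOn_ball_inv_rpow {k : ℕ} [NeZero k] {γ : ℝ} (hγ : γ < k) {ε : ℝ} (hε : 0 < ε) :
    IntegrableOn (fun y : EuclideanSpace ℝ (Fin k) => (‖y‖ ^ γ)⁻¹) (Metric.ball 0 ε) := by
  have hk : (1 : ℝ) ≤ k := by exact_mod_cast NeZero.one_le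
  have h := integrableOn_fun_norm_addHaar (E := EuclideanSpace ℝ (Fin k)) volume
    (f := fun t : ℝ => (t ^ γ)⁻¹) (r := ε)
  refine h.2 ?_
  have h1 := (intervalIntegral.integrableOn_Ioo_rpow_iff (s := (k : ℝ) - 1 - γ) hε).2 (by linarith)
  refine h1.congr_fun (fun t ht => ?_) measurableSet_Ioo
  beta_reduce
  rw [finrank_euclideanSpace_fin, smul_eq_mul, Real.rpow_sub ht.1, div_eq_mul_inv]
  congr 1
  rw [← Real.rpow_natCast, Nat.cast_sub NeZero.one_le, Nat.cast_one]

variable {k n : ℕ} [NeZero k] {M : Type*} [TopologicalSpace M]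
  [ChartedSpace (EuclideanHalfSpace k) M] [IsManifold (𝓡∂ k) ∞ M]
  {f : M → EuclideanSpace ℝ (Fin n)} {ξ : EuclideanSpace ℝ (Fin n)}
  (hf : ContMDiff (𝓡∂ k) 𝓘(ℝ, EuclideanSpace ℝ (Fin n)) ∞ f)
  (himm : ∀ x, Function.Injective (mfderiv (𝓡∂ k) 𝓘(ℝ, EuclideanSpace ℝ (Fin n)) f x))

omit [IsManifold (𝓡∂ k) ∞ M] in
lemma density_nonneg (f : M → EuclideanSpace ℝ (Fin n)) (c : M) (y : EuclideanSpace ℝ (Fin k)) :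
    0 ≤ density f c y :=
  Real.sqrt_nonneg _

omit [NeZero k] [TopologicalSpace M] [ChartedSpace (EuclideanHalfSpace k) M]
  [IsManifold (𝓡∂ k) ∞ M] in
lemma r_nonneg (f : M → EuclideanSpace ℝ (Fin n)) (ξ : EuclideanSpace ℝ (Fin n)) (x : M) :
    0 ≤ r f ξ x :=
  dist_nonneg

include hf

lemma continuous_r : Continuous (r f ξ) := hf.continuous.dist continuous_const

include himm in
/-- An immersion separates nearby points at a linear rate. -/
lemma exists_norm_sub_le (x₀ : M) : ∃ C > 0, ∀ᶠ y in 𝓝[range (𝓡∂ k)] (extChartAt (𝓡∂ k) x₀ x₀),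
    ‖y - extChartAt (𝓡∂ k) x₀ x₀‖ ≤
      C * ‖f ((extChartAt (𝓡∂ k) x₀).symm y) - f x₀‖ := by
  have hf1 : ContMDiff (𝓡∂ k) 𝓘(ℝ, EuclideanSpace ℝ (Fin n)) 1 f := hf.of_le (by simp)
  set y₀ := extChartAt (𝓡∂ k) x₀ x₀ with hy₀
  have hy : y₀ ∈ (extChartAt (𝓡∂ k) x₀).target := mem_extChartAt_target x₀
  obtain ⟨K, hK, hJ⟩ := LinearMap.exists_antilipschitzWith
    (chartDeriv f x₀ y₀ : EuclideanSpace ℝ (Fin k) →ₗ[ℝ] EuclideanSpace ℝ (Fin n))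
    (LinearMap.ker_eq_bot.2 (chartDeriv_injective hf1 himm hy))
  have hK' : (0 : ℝ) < K := hK
  have hd := (differentiableWithinAt_chart hf1 hy).hasFDerivWithinAt
  refine ⟨2 * K, by positivity, ?_⟩
  -- The linearization error is taken at most half the lower bound `1/K` of the derivative, so that
  -- it is absorbed; hence the constant `2K`.
  filter_upwards [hd.isLittleO.def (c := (2 * (K : ℝ))⁻¹) (by positivity)] with y h
  have h1 : ‖y - y₀‖ ≤ K * ‖chartDeriv f x₀ y₀ (y - y₀)‖ := by
    have := hJ.le_mul_dist (y - y₀) 0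
    simpa using this
  have h2 : (extChartAt (𝓡∂ k) x₀).symm y₀ = x₀ := extChartAt_to_inv x₀
  simp only [Function.comp_apply, h2] at h
  have h3 : ‖chartDeriv f x₀ y₀ (y - y₀)‖ ≤
      ‖f ((extChartAt (𝓡∂ k) x₀).symm y) - f x₀‖ + (2 * (K : ℝ))⁻¹ * ‖y - y₀‖ := by
    refine le_trans ?_ (add_le_add_right h _)
    refine le_trans (le_of_eq ?_) (norm_sub_le _ _)
    rw [sub_sub_cancel]
    rfl
  have h4 : (K : ℝ) * ((2 * (K : ℝ))⁻¹ * ‖y - y₀‖) = ‖y - y₀‖ / 2 := by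
    field_simp
  nlinarith [mul_le_mul_of_nonneg_left h3 hK'.le]

variable [MeasurableSpace M] [BorelSpace M] [CompactSpace M] [T2Space M]

lemma integrable_of_chart (c : M) {h : M → ℝ} (hh : AEStronglyMeasurable h (riemannianVolume k f))
    (hs : ∀ x ∉ (extChartAt (𝓡∂ k) c).source, h x = 0)
    (hi : IntegrableOn (fun y => density f c y * h ((extChartAt (𝓡∂ k) c).symm y))
      (extChartAt (𝓡∂ k) c).target) : Integrable h (riemannianVolume k f) := by
  have hf1 : ContMDiff (𝓡∂ k) 𝓘(ℝ, EuclideanSpace ℝ (Fin n)) 1 f := hf.of_le (by simp)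
  have hT := measurableSet_target (k := k) c
  have hss : Function.support h ⊆ (extChartAt (𝓡∂ k) c).source := fun x hx => by
    by_contra hxs
    exact hx (hs x hxs)
  rw [← integrableOn_iff_integrable_of_support_subset hss, IntegrableOn]
  have hh' := hh.restrict (s := (extChartAt (𝓡∂ k) c).source)
  rw [riemannianVolume_restrict hf1, chartVolume_eq, paramMeasure] at hh' ⊢
  rw [integrable_map_measure hh' (aemeasurable_param volume hT (continuousOn_extChartAt_symm c) _),
    integrable_withDensity_iff_integrable_smul₀'
      ((continuousOn_density hf1 c).aemeasurable hT).ennreal_ofReal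
      (Eventually.of_forall fun y => ENNReal.ofReal_lt_top)]
  refine hi.congr (Eventually.of_forall fun y => ?_)
  simp only [smul_eq_mul, Function.comp_apply]
  rw [ENNReal.toReal_ofReal (density_nonneg f c y)]

lemma measure_singleton_eq_zero (x : M) : riemannianVolume k f {x} = 0 := by
  have hf1 : ContMDiff (𝓡∂ k) 𝓘(ℝ, EuclideanSpace ℝ (Fin n)) 1 f := hf.of_le (by simp)
  rw [← Measure.restrict_eq_self _ (singleton_subset_iff.2 (mem_extChartAt_source (I := 𝓡∂ k) x)),
    riemannianVolume_restrict hf1, chartVolume_eq, paramMeasure_apply volume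
      (measurableSet_target x) (continuousOn_extChartAt_symm x) (measurableSet_singleton x)]
  refine setLIntegral_measure_zero _ _ (measure_mono_null (t := {extChartAt (𝓡∂ k) x x}) ?_
    (measure_singleton _))
  rintro y ⟨hy, hyx⟩
  rw [mem_preimage, mem_singleton_iff] at hyx
  rw [mem_singleton_iff, ← (extChartAt (𝓡∂ k) x).right_inv hy, hyx]

include himm

/-- By the linear separation of nearby points, the preimages of `ξ` are isolated, and single points
are null. Almost everywhere statements may thus ignore the values of quotients at `r = 0`. -/
lemma ae_r_pos : ∀ᵐ x ∂(riemannianVolume k f), 0 < r f ξ x := by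
  have : SecondCountableTopology (EuclideanHalfSpace k) :=
    inferInstanceAs (SecondCountableTopology {y : EuclideanSpace ℝ (Fin k) // 0 ≤ y 0})
  -- Second countability lets a locally null set be null.
  have := ChartedSpace.secondCountable_of_sigmaCompact (EuclideanHalfSpace k) M
  suffices h : riemannianVolume k f {x | f x = ξ} = 0 by
    filter_upwards [measure_eq_zero_iff_ae_notMem.1 h] with x hx
    exact dist_pos.2 hx
  refine measure_null_of_locally_null _ fun x₀ hx₀ => ?_
  obtain ⟨C, -, hC⟩ := exists_norm_sub_le hf himm x₀
  have h1 : ∀ᶠ x in 𝓝 x₀, x ∈ (extChartAt (𝓡∂ k) x₀).source ∧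
      ‖extChartAt (𝓡∂ k) x₀ x - extChartAt (𝓡∂ k) x₀ x₀‖ ≤ C * ‖f x - f x₀‖ := by
    have ht : Tendsto (extChartAt (𝓡∂ k) x₀) (𝓝 x₀)
        (𝓝[range (𝓡∂ k)] (extChartAt (𝓡∂ k) x₀ x₀)) :=
      tendsto_nhdsWithin_iff.2 ⟨continuousAt_extChartAt x₀, by
        filter_upwards [extChartAt_source_mem_nhds (I := 𝓡∂ k) x₀] with x hx
        exact target_subset_range x₀ ((extChartAt (𝓡∂ k) x₀).map_source hx)⟩
    filter_upwards [extChartAt_source_mem_nhds (I := 𝓡∂ k) x₀, ht.eventually hC] with x hx h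
    rw [(extChartAt (𝓡∂ k) x₀).left_inv hx] at h
    exact ⟨hx, h⟩
  refine ⟨{x | f x = ξ} ∩ {x | x ∈ (extChartAt (𝓡∂ k) x₀).source ∧
      ‖extChartAt (𝓡∂ k) x₀ x - extChartAt (𝓡∂ k) x₀ x₀‖ ≤ C * ‖f x - f x₀‖},
    inter_mem_nhdsWithin _ h1, measure_mono_null (t := {x₀}) ?_ (measure_singleton_eq_zero hf x₀)⟩
  rintro x ⟨hx, hxs, hxC⟩
  rw [mem_ofPred_eq] at hx hx₀
  rw [hx, hx₀, sub_self, norm_zero, mul_zero] at hxC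
  exact (extChartAt (𝓡∂ k) x₀).injOn hxs (mem_extChartAt_source x₀)
    (sub_eq_zero.1 (norm_le_zero_iff.1 hxC))

/-- Away from preimages of `ξ` the function is continuous. Near such a point, `‖y - y₀‖ ≤ C r` in
coordinates, so `r^(-γ)` is at most `C^γ ‖y - y₀‖^(-γ)`. -/
lemma integrable_inv_rpow_r {γ : ℝ} (hγ0 : 0 < γ) (hγ : γ < k) :
    Integrable (fun x => (r f ξ x ^ γ)⁻¹) (riemannianVolume k f) := by
  have hf1 : ContMDiff (𝓡∂ k) 𝓘(ℝ, EuclideanSpace ℝ (Fin n)) 1 f := hf.of_le (by simp)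
  have := isFiniteMeasure_riemannianVolume (k := k) hf1
  have hrc := continuous_r (k := k) (ξ := ξ) hf
  have hm : Measurable fun x => (r f ξ x ^ γ)⁻¹ := (hrc.measurable.pow_const γ).inv
  suffices h : LocallyIntegrable (fun x => (r f ξ x ^ γ)⁻¹) (riemannianVolume k f) from
    integrableOn_univ.1 (h.integrableOn_isCompact isCompact_univ)
  intro x₀
  by_cases hx₀ : f x₀ = ξ
  swap
  · have hr0 : r f ξ x₀ ≠ 0 := (dist_pos.2 hx₀).ne'
    have hc : ContinuousAt (fun x => (r f ξ x ^ γ)⁻¹) x₀ :=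
      (hrc.continuousAt.rpow_const (Or.inl hr0)).inv₀
        (Real.rpow_pos_of_pos (dist_pos.2 hx₀) γ).ne'
    exact hc.tendsto.integrableAtFilter hm.stronglyMeasurable.stronglyMeasurableAtFilter
      (Measure.finiteAt_nhds _ x₀)
  set y₀ := extChartAt (𝓡∂ k) x₀ x₀ with hy₀
  set T := (extChartAt (𝓡∂ k) x₀).target with hT
  have hy₀T : y₀ ∈ T := mem_extChartAt_target x₀
  obtain ⟨C, hC0, hC⟩ := exists_norm_sub_le hf himm x₀
  have h1 : ∀ᶠ y in 𝓝[T] y₀, density f x₀ y ≤ density f x₀ y₀ + 1 :=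
    ((continuousOn_density hf1 x₀ y₀ hy₀T).eventually_lt continuousWithinAt_const
      (lt_add_one _)).mono fun y hy => hy.le
  have h2 := h1.and (hC.filter_mono (nhdsWithin_mono _ (target_subset_range x₀)))
  obtain ⟨ε, hε, hball⟩ := Metric.mem_nhdsWithin_iff.1 h2
  set D := density f x₀ y₀ + 1 with hD
  have hD0 : 0 ≤ D := by
    have := density_nonneg f x₀ y₀
    linarith
  set U := (extChartAt (𝓡∂ k) x₀).source ∩ extChartAt (𝓡∂ k) x₀ ⁻¹' Metric.ball y₀ ε with hU
  have hUo : IsOpen U := (continuousOn_extChartAt x₀).isOpen_inter_preimage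
    (isOpen_extChartAt_source x₀) Metric.isOpen_ball
  refine ⟨U, hUo.mem_nhds ⟨mem_extChartAt_source x₀, Metric.mem_ball_self hε⟩, ?_⟩
  rw [← integrable_indicator_iff hUo.measurableSet]
  refine integrable_of_chart hf x₀ (hm.indicator hUo.measurableSet).aestronglyMeasurable
    (fun x hx => indicator_of_notMem (fun h => hx h.1) _) ?_
  have hg : Integrable (fun y => (D * C ^ γ) * (Metric.ball (0 : EuclideanSpace ℝ (Fin k)) ε).indicator
      (fun y => (‖y‖ ^ γ)⁻¹) (y - y₀)) :=
    (((integrable_indicator_iff Metric.isOpen_ball.measurableSet).2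
      (integrableOn_ball_inv_rpow hγ hε)).comp_sub_right y₀).const_mul _
  have hTm : MeasurableSet T := measurableSet_target x₀
  have hsymm : AEMeasurable (extChartAt (𝓡∂ k) x₀).symm (volume.restrict T) := by
    have := aemeasurable_param volume hTm (continuousOn_extChartAt_symm x₀) 1
    rwa [withDensity_one] at this
  refine hg.integrableOn.mono' ?_ ?_
  · exact (((continuousOn_density hf1 x₀).aemeasurable hTm).mul
      ((hm.indicator hUo.measurableSet).comp_aemeasurable hsymm)).aestronglyMeasurable
  · filter_upwards [ae_restrict_mem hTm] with y hy
    have hry := (extChartAt (𝓡∂ k) x₀).right_inv hy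
    by_cases hyb : y ∈ Metric.ball y₀ ε
    · obtain ⟨hyD, hyC⟩ := hball ⟨hyb, hy⟩
      have hyU : (extChartAt (𝓡∂ k) x₀).symm y ∈ U :=
        ⟨(extChartAt (𝓡∂ k) x₀).map_target hy, by rwa [mem_preimage, hry]⟩
      have hyb' : y - y₀ ∈ Metric.ball (0 : EuclideanSpace ℝ (Fin k)) ε := by
        rwa [mem_ball_zero_iff, ← dist_eq_norm]
      rw [indicator_of_mem hyU, indicator_of_mem hyb', norm_mul,
        Real.norm_of_nonneg (density_nonneg f x₀ y),
        Real.norm_of_nonneg (inv_nonneg.2 (Real.rpow_nonneg (r_nonneg f ξ _) _)), mul_assoc]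
      refine mul_le_mul hyD ?_ (inv_nonneg.2 (Real.rpow_nonneg (r_nonneg f ξ _) _)) hD0
      -- At the singular point itself the inverse of zero is zero by convention, and the bound is
      -- trivial.
      by_cases hyy : y = y₀
      · have : r f ξ ((extChartAt (𝓡∂ k) x₀).symm y) = 0 := by
          rw [hyy, hy₀, extChartAt_to_inv, r, hx₀, dist_self]
        rw [this, Real.zero_rpow hγ0.ne', inv_zero]
        positivity
      · have hp : 0 < ‖y - y₀‖ := norm_pos_iff.2 (sub_ne_zero.2 hyy)
        rw [← hy₀, hx₀, ← dist_eq_norm (f _)] at hyC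
        have hr : 0 < r f ξ ((extChartAt (𝓡∂ k) x₀).symm y) := by
          by_contra h
          have : dist (f ((extChartAt (𝓡∂ k) x₀).symm y)) ξ ≤ 0 := not_lt.1 h
          nlinarith
        have h3 : ‖y - y₀‖ ^ γ ≤ C ^ γ * r f ξ ((extChartAt (𝓡∂ k) x₀).symm y) ^ γ := by
          rw [← Real.mul_rpow hC0.le hr.le]
          exact Real.rpow_le_rpow hp.le hyC hγ0.le
        rw [← div_eq_mul_inv, inv_eq_one_div, div_le_div_iff₀ (Real.rpow_pos_of_pos hr γ)
          (Real.rpow_pos_of_pos hp γ), one_mul]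
        exact h3
    · have hyU : (extChartAt (𝓡∂ k) x₀).symm y ∉ U := fun h => hyb (by
        have := h.2
        rwa [mem_preimage, hry] at this)
      have hyb' : y - y₀ ∉ Metric.ball (0 : EuclideanSpace ℝ (Fin k)) ε := by
        rwa [mem_ball_zero_iff, ← dist_eq_norm]
      rw [indicator_of_notMem hyU, indicator_of_notMem hyb']
      simp

end ImmersedManifold

end

noncomputable section

/-! ### Radial fields and their weak divergence -/

namespace ImmersedManifold

open Filter Topology

variable {k n : ℕ} [NeZero k] {M : Type*} [TopologicalSpace M]
  [ChartedSpace (EuclideanHalfSpace k) M]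

lemma gradient_mem_tangentPlane (f : M → EuclideanSpace ℝ (Fin n)) (φ : M → ℝ) (x : M) :
    gradient k f φ x ∈ tangentPlane k f x :=
  Submodule.sum_mem _ fun i _ => Submodule.sum_mem _ fun _ _ =>
    Submodule.smul_mem _ _ (Submodule.subset_span (mem_range_self i))

lemma tangentialPart_mem (f : M → EuclideanSpace ℝ (Fin n)) (x : M)
    (v : EuclideanSpace ℝ (Fin n)) : tangentialPart k f x v ∈ tangentPlane k f x :=
  Submodule.starProjection_apply_mem _ _

lemma inner_tangentialPart {f : M → EuclideanSpace ℝ (Fin n)} {x : M}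
    {w : EuclideanSpace ℝ (Fin n)} (hw : w ∈ tangentPlane k f x) (v : EuclideanSpace ℝ (Fin n)) :
    inner ℝ w (tangentialPart k f x v) = inner ℝ w v := by
  rw [tangentialPart, ← Submodule.inner_starProjection_left_eq_right,
    Submodule.starProjection_eq_self_iff.2 hw]

lemma norm_sq_eq_tangentialPart_add_normalPart (f : M → EuclideanSpace ℝ (Fin n)) (x : M)
    (v : EuclideanSpace ℝ (Fin n)) :
    ‖v‖ ^ 2 = ‖tangentialPart k f x v‖ ^ 2 + ‖normalPart k f x v‖ ^ 2 := by
  have h : inner ℝ (tangentialPart k f x v) (normalPart k f x v) = 0 := by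
    rw [normalPart, inner_sub_right, inner_tangentialPart (tangentialPart_mem f x v), sub_self]
  have h2 : v = tangentialPart k f x v + normalPart k f x v := by
    rw [normalPart, add_sub_cancel]
  conv_lhs => rw [h2, norm_add_sq_real, h]
  ring

lemma tangentialPart_smul (f : M → EuclideanSpace ℝ (Fin n)) (x : M) (a : ℝ)
    (v : EuclideanSpace ℝ (Fin n)) :
    tangentialPart k f x (a • v) = a • tangentialPart k f x v :=
  map_smul _ _ _

/-- The tangential part of the position vector relative to `ξ`. -/
def positionTangent (k : ℕ) [NeZero k] {M : Type*} [TopologicalSpace M]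
    [ChartedSpace (EuclideanHalfSpace k) M] (f : M → EuclideanSpace ℝ (Fin n))
    (ξ : EuclideanSpace ℝ (Fin n)) (x : M) : EuclideanSpace ℝ (Fin n) :=
  tangentialPart k f x (f x - ξ)

lemma norm_positionTangent_sq_le (f : M → EuclideanSpace ℝ (Fin n))
    (ξ : EuclideanSpace ℝ (Fin n)) (x : M) : ‖positionTangent k f ξ x‖ ^ 2 ≤ r f ξ x ^ 2 := by
  rw [r, dist_eq_norm, norm_sq_eq_tangentialPart_add_normalPart (k := k) f x (f x - ξ)]
  exact le_add_of_nonneg_right (sq_nonneg _)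

/-- A power of the regularized squared distance from `ξ`. -/
def radialPower (f : M → EuclideanSpace ℝ (Fin n)) (ξ : EuclideanSpace ℝ (Fin n)) (ε a : ℝ)
    (x : M) : ℝ :=
  (r f ξ x ^ 2 + ε) ^ a

variable [IsManifold (𝓡∂ k) ∞ M]
  {f : M → EuclideanSpace ℝ (Fin n)} {ξ : EuclideanSpace ℝ (Fin n)}
  (hf : ContMDiff (𝓡∂ k) 𝓘(ℝ, EuclideanSpace ℝ (Fin n)) ∞ f)
  (himm : ∀ x, Function.Injective (mfderiv (𝓡∂ k) 𝓘(ℝ, EuclideanSpace ℝ (Fin n)) f x))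

include hf

lemma contMDiff_radialPower {ε : ℝ} (hε : 0 < ε) (a : ℝ) :
    ContMDiff (𝓡∂ k) 𝓘(ℝ, ℝ) ∞ (radialPower f ξ ε a) := by
  have h : ContDiff ℝ ∞ fun z : EuclideanSpace ℝ (Fin n) => (‖z - ξ‖ ^ 2 + ε) ^ a :=
    (((contDiff_id.sub contDiff_const).norm_sq ℝ).add contDiff_const).rpow_const_of_ne
      fun z => by positivity
  have h2 : radialPower f ξ ε a = (fun z => (‖z - ξ‖ ^ 2 + ε) ^ a) ∘ f := by
    ext x
    rw [radialPower, r, dist_eq_norm, Function.comp_apply]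
  rw [h2]
  exact h.contMDiff.comp hf

include himm

lemma gradient_radialPower {ε : ℝ} (hε : 0 < ε) (a : ℝ) (x : M) :
    gradient k f (radialPower f ξ ε a) x =
      (2 * a * radialPower f ξ ε (a - 1) x) • positionTangent k f ξ x := by
  have hf1 : ContMDiff (𝓡∂ k) 𝓘(ℝ, EuclideanSpace ℝ (Fin n)) 1 f := hf.of_le (by simp)
  have hx := mem_extChartAt_source (I := 𝓡∂ k) x
  have hy := mem_extChartAt_target (I := 𝓡∂ k) x
  have hJ := chartDeriv_injective hf1 himm hy
  have h1 := (((differentiableWithinAt_chart hf1 hy).hasFDerivWithinAt.sub_const ξ).norm_sq.add_const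
    ε).rpow_const (p := a) (Or.inl (by positivity))
  have h2 : chartDeriv (radialPower f ξ ε a) x (extChartAt (𝓡∂ k) x x) =
      (2 * a * radialPower f ξ ε (a - 1) x) •
        pairing (chartDeriv f x (extChartAt (𝓡∂ k) x x)) (f x - ξ) := by
    have h3 : radialPower f ξ ε a ∘ (extChartAt (𝓡∂ k) x).symm = fun y =>
        (‖(f ∘ (extChartAt (𝓡∂ k) x).symm) y - ξ‖ ^ 2 + ε) ^ a := by
      ext y
      rw [Function.comp_apply, radialPower, r, dist_eq_norm, Function.comp_apply]
    rw [chartDeriv, h3]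
    erw [h1.fderivWithin (halfSpace_uniqueDiffOn _ (target_subset_range x hy))]
    ext1 w
    simp only [_root_.smul_apply, smul_eq_mul, Function.comp_apply, extChartAt_to_inv,
      ContinuousLinearMap.comp_apply, innerSL_apply_apply, pairing_apply, radialPower, r,
      dist_eq_norm, chartDeriv, nsmul_eq_mul]
    push_cast
    ring
  rw [gradient_eq_gradL_self, h2, gradL_smul, ← starProjection_range hJ]
  simp only [positionTangent, tangentialPart, tangentPlane_eq_range hf1 himm hx]

/-- With exponent `1` and `ε = 1`, the field is half the gradient of `r² + 1`, so it inherits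
continuity. -/
lemma continuous_positionTangent : Continuous (positionTangent k f ξ) := by
  have h := continuous_gradient hf himm
    ((contMDiff_radialPower (ξ := ξ) hf one_pos 1).of_le (by simp))
  have h2 : positionTangent k f ξ = fun x => (1 / 2 : ℝ) • gradient k f (radialPower f ξ 1 1) x := by
    ext1 x
    rw [gradient_radialPower hf himm one_pos, smul_smul, radialPower, sub_self, Real.rpow_zero]
    norm_num
  rw [h2]
  exact h.const_smul (1 / 2 : ℝ)

variable [MeasurableSpace M] [BorelSpace M] [CompactSpace M] [T2Space M]

lemma HasWeakDivergence.smul {X : M → EuclideanSpace ℝ (Fin n)} {u : M → ℝ} (hX : Continuous X)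
    (hu : HasWeakDivergence k f X u)
    (hul : LocallyIntegrableOn u ((𝓡∂ k).interior M) (riemannianVolume k f)) {P : M → ℝ}
    (hP : ContMDiff (𝓡∂ k) 𝓘(ℝ, ℝ) ∞ P) :
    HasWeakDivergence k f (fun x => P x • X x)
      (fun x => P x * u x + inner ℝ (gradient k f P x) (X x)) := by
  intro φ hφ hφi
  have hφ1 : ContMDiff (𝓡∂ k) 𝓘(ℝ, ℝ) 1 φ := hφ.of_le (by simp)
  have hP1 : ContMDiff (𝓡∂ k) 𝓘(ℝ, ℝ) 1 P := hP.of_le (by simp)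
  have hs : tsupport (fun x => φ x * P x) ⊆ (𝓡∂ k).interior M :=
    (closure_mono (Function.support_mul_subset_left _ _)).trans hφi
  have h := hu (fun x => φ x * P x) (hφ.mul hP) hs
  have h1 : Integrable (fun x => φ x * P x * u x) (riemannianVolume k f) :=
    integrable_mul_of_tsupport_subset_interior hf hul (hφ.continuous.mul hP.continuous) hs
  have h2 : Integrable (fun x => φ x * inner ℝ (gradient k f P x) (X x)) (riemannianVolume k f) :=
    integrable_of_continuous hf
      (hφ.continuous.mul ((continuous_gradient hf himm hP1).inner hX))
  have h3 : Integrable (fun x => P x * inner ℝ (gradient k f φ x) (X x)) (riemannianVolume k f) :=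
    integrable_of_continuous hf
      (hP.continuous.mul ((continuous_gradient hf himm hφ1).inner hX))
  simp_rw [gradient_mul hφ1 hP1, inner_add_left, inner_smul_left, RCLike.conj_to_real] at h
  rw [integral_add h2 h3] at h
  simp_rw [mul_add, ← mul_assoc, inner_smul_right]
  rw [integral_add h1 h2, h]
  ring

/-- The first variation formula tested with `φ g`, where `g` may be merely `C¹`. Gradients are
tangential, so `f - ξ` may be replaced by its tangential part. -/
lemma hasWeakDivergence_positionTangent {g : M → ℝ} (hg : ContMDiff (𝓡∂ k) 𝓘(ℝ, ℝ) 1 g) :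
    HasWeakDivergence k f (fun x => g x • positionTangent k f ξ x)
      (fun x => inner ℝ (gradient k f g x) (positionTangent k f ξ x) +
        g x * (k + inner ℝ (f x - ξ) (meanCurvature k f x))) := by
  intro φ hφ hφi
  have hφ1 : ContMDiff (𝓡∂ k) 𝓘(ℝ, ℝ) 1 φ := hφ.of_le (by simp)
  have h := integral_firstVariation_interior hf himm ξ (φ := fun x => φ x * g x) (hφ1.mul hg)
    ((closure_mono (Function.support_mul_subset_left _ _)).trans hφi)
  have hT := continuous_positionTangent (ξ := ξ) hf himm
  have hc : Continuous fun x => f x - ξ := hf.continuous.sub continuous_const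
  have h1 : Integrable (fun x => φ x * (inner ℝ (gradient k f g x) (positionTangent k f ξ x) +
      g x * (k + inner ℝ (f x - ξ) (meanCurvature k f x)))) (riemannianVolume k f) :=
    integrable_of_continuous hf (hφ.continuous.mul
      (((continuous_gradient hf himm hg).inner hT).add (hg.continuous.mul
        (continuous_const.add (hc.inner (continuous_meanCurvature hf himm))))))
  have h2 : Integrable (fun x => inner ℝ (gradient k f φ x) (g x • positionTangent k f ξ x))
      (riemannianVolume k f) :=
    integrable_of_continuous hf ((continuous_gradient hf himm hφ1).inner
      (hg.continuous.smul hT))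
  rw [eq_neg_iff_add_eq_zero, ← integral_add h1 h2, ← h]
  refine integral_congr_ae (Eventually.of_forall fun x => ?_)
  simp only [gradient_mul hφ1 hg, inner_add_left, inner_smul_left, inner_smul_right,
    RCLike.conj_to_real, positionTangent, inner_tangentialPart (gradient_mem_tangentPlane f _ x)]
  ring

lemma HasWeakDivergence.add {X Y : M → EuclideanSpace ℝ (Fin n)} {u w : M → ℝ} (hX : Continuous X)
    (hY : Continuous Y) (hu : HasWeakDivergence k f X u) (hw : HasWeakDivergence k f Y w)
    (hul : LocallyIntegrableOn u ((𝓡∂ k).interior M) (riemannianVolume k f))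
    (hwl : LocallyIntegrableOn w ((𝓡∂ k).interior M) (riemannianVolume k f)) :
    HasWeakDivergence k f (fun x => X x + Y x) (fun x => u x + w x) := by
  intro φ hφ hφi
  have hφ1 : ContMDiff (𝓡∂ k) 𝓘(ℝ, ℝ) 1 φ := hφ.of_le (by simp)
  have hg := continuous_gradient hf himm hφ1
  simp_rw [mul_add, inner_add_right]
  rw [integral_add (integrable_mul_of_tsupport_subset_interior hf hul hφ.continuous hφi)
    (integrable_mul_of_tsupport_subset_interior hf hwl hφ.continuous hφi),
    integral_add (integrable_of_continuous hf (hg.inner hX))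
      (integrable_of_continuous hf (hg.inner hY)), hu φ hφ hφi, hw φ hφ hφi]
  ring

end ImmersedManifold

end

noncomputable section

/-! ### The regularized identity and its limit -/

namespace ImmersedManifold

open Filter Topology

lemma div_rpow_eq {t : ℝ} (ht : 0 < t) (a s : ℝ) : a / t ^ s = t ^ (-s) * a := by
  rw [Real.rpow_neg ht.le, div_eq_inv_mul]

/-! ### Bounds and limits of the regularized powers. -/

section Powers

variable {n : ℕ} {M : Type*} {f : M → EuclideanSpace ℝ (Fin n)} {ξ : EuclideanSpace ℝ (Fin n)}

lemma radialPower_nonneg {ε : ℝ} (hε : 0 < ε) (a : ℝ) (x : M) : 0 ≤ radialPower f ξ ε a x :=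
  Real.rpow_nonneg (by positivity) _

lemma radialPower_le {ε a b : ℝ} (hε : 0 < ε) (hb : b ≤ 0) (hab : 2 * a = b) {x : M}
    (hx : 0 < r f ξ x) : radialPower f ξ ε a x ≤ r f ξ x ^ b := by
  rw [radialPower, ← hab, Real.rpow_mul hx.le, Real.rpow_two]
  exact Real.rpow_le_rpow_of_nonpos (by positivity) (by linarith) (by linarith)

lemma tendsto_radialPower {a b : ℝ} (hab : 2 * a = b) {x : M} (hx : 0 < r f ξ x) :
    Tendsto (fun j : ℕ => radialPower f ξ (1 / ((j : ℝ) + 1)) a x) atTop (𝓝 (r f ξ x ^ b)) := by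
  rw [← hab, Real.rpow_mul hx.le, Real.rpow_two]
  have h : Tendsto (fun j : ℕ => r f ξ x ^ 2 + 1 / ((j : ℝ) + 1)) atTop (𝓝 (r f ξ x ^ 2)) := by
    simpa using tendsto_one_div_add_atTop_nhds_zero_nat.const_add (r f ξ x ^ 2)
  exact h.rpow_const (Or.inl (by positivity))

lemma radialPower_add_one {ε a b : ℝ} (hε : 0 < ε) (hab : a + 1 = b) (x : M) :
    radialPower f ξ ε a x * (r f ξ x ^ 2 + ε) = radialPower f ξ ε b x := by
  rw [radialPower, radialPower, ← hab, Real.rpow_add_one (by positivity)]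

end Powers

variable {k n : ℕ} [NeZero k] {M : Type*} [TopologicalSpace M]
  [ChartedSpace (EuclideanHalfSpace k) M]

variable (k) in
/-- The field `r^(2-γ) ∇ψ + (γ - 2) ψ r^(-γ) (f - ξ)^⊤`, with `r` regularized. -/
def regularizedField (f : M → EuclideanSpace ℝ (Fin n)) (ξ : EuclideanSpace ℝ (Fin n)) (γ : ℝ)
    (ψ : M → ℝ) (ε : ℝ) (x : M) : EuclideanSpace ℝ (Fin n) :=
  radialPower f ξ ε (-((γ - 2) / 2)) x • gradient k f ψ x +
    ((γ - 2) * ψ x * radialPower f ξ ε (-(γ / 2)) x) • positionTangent k f ξ x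

variable (k) in
/-- The terms of order zero in the divergence of the regularized field. -/
def regularizedPotential (f : M → EuclideanSpace ℝ (Fin n)) (ξ : EuclideanSpace ℝ (Fin n)) (γ : ℝ)
    (ψ : M → ℝ) (ε : ℝ) (x : M) : ℝ :=
  ψ x * (radialPower f ξ ε (-(γ / 2)) x * (k + inner ℝ (f x - ξ) (meanCurvature k f x)) -
    γ * radialPower f ξ ε (-(γ / 2) - 1) x * ‖positionTangent k f ξ x‖ ^ 2)

/-- `∇̄r` is a unit vector, so Pythagoras trades its normal part for its tangential part, the form
in which the divergence computation delivers it. -/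
lemma Φ_eq {f : M → EuclideanSpace ℝ (Fin n)} {ξ : EuclideanSpace ℝ (Fin n)} (γ : ℝ) {x : M}
    (hx : 0 < r f ξ x) :
    Φ k f ξ γ x = γ * (1 - ‖positionTangent k f ξ x‖ ^ 2 / r f ξ x ^ 2) +
      inner ℝ (f x - ξ) (meanCurvature k f x) := by
  have h := norm_sq_eq_tangentialPart_add_normalPart (k := k) f x (radialField f ξ x)
  have h1 : ‖radialField f ξ x‖ = 1 := by
    rw [radialField, norm_smul, norm_inv, Real.norm_of_nonneg hx.le, ← dist_eq_norm]
    exact inv_mul_cancel₀ hx.ne'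
  have h2 : tangentialPart k f x (radialField f ξ x) = (r f ξ x)⁻¹ • positionTangent k f ξ x :=
    tangentialPart_smul f x _ _
  rw [h1, h2, norm_smul, norm_inv, Real.norm_of_nonneg hx.le, mul_pow] at h
  have h3 : ‖normalPart k f x (radialField f ξ x)‖ ^ 2 =
      1 - ‖positionTangent k f ξ x‖ ^ 2 / r f ξ x ^ 2 := by
    rw [div_eq_inv_mul, ← inv_pow]
    linarith
  rw [Φ, h3, radialField, inner_smul_left, RCLike.conj_to_real, mul_inv_cancel_left₀ hx.ne']

lemma W_eq {f : M → EuclideanSpace ℝ (Fin n)} {ξ : EuclideanSpace ℝ (Fin n)} (γ : ℝ)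
    (ψ : M → ℝ) (x : M) :
    W k f ξ γ ψ x = gradient k f ψ x +
      ((γ - 2) * ψ x / r f ξ x ^ 2) • positionTangent k f ξ x := by
  rw [W, radialField, tangentialPart_smul, smul_smul, positionTangent, ← div_eq_mul_inv, div_div,
    sq]

variable [IsManifold (𝓡∂ k) ∞ M]
  {f : M → EuclideanSpace ℝ (Fin n)} {ξ : EuclideanSpace ℝ (Fin n)}
  (hf : ContMDiff (𝓡∂ k) 𝓘(ℝ, EuclideanSpace ℝ (Fin n)) ∞ f)
  (himm : ∀ x, Function.Injective (mfderiv (𝓡∂ k) 𝓘(ℝ, EuclideanSpace ℝ (Fin n)) f x))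
  [MeasurableSpace M] [BorelSpace M] [CompactSpace M] [T2Space M]
  {ψ u : M → ℝ} (hψ : ContMDiff (𝓡∂ k) 𝓘(ℝ, ℝ) 1 ψ)

omit [IsManifold (𝓡∂ k) ∞ M] [BorelSpace M] [T2Space M] in
lemma IsLaplacian.hasWeakDivergence (hu : IsLaplacian k f ψ u) :
    HasWeakDivergence k f (gradient k f ψ) u := fun φ hφ hφi =>
  hu.2 φ hφ (HasCompactSupport.of_compactSpace φ) hφi

include hf

/-- Local integrability gives measurability in the interior only; the boundary is null. -/
lemma IsLaplacian.aestronglyMeasurable (hu : IsLaplacian k f ψ u) :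
    AEStronglyMeasurable u (riemannianVolume k f) := by
  have : SecondCountableTopology (EuclideanHalfSpace k) :=
    inferInstanceAs (SecondCountableTopology {y : EuclideanSpace ℝ (Fin k) // 0 ≤ y 0})
  have := ChartedSpace.secondCountable_of_sigmaCompact (EuclideanHalfSpace k) M
  have h := hu.1.aestronglyMeasurable
  rwa [Measure.restrict_eq_self_of_ae_mem (ae_mem_interior hf)] at h

lemma integrable_continuous_mul {g : M → ℝ} (hg : Continuous g)
    (hu : Integrable u (riemannianVolume k f)) :
    Integrable (fun x => g x * u x) (riemannianVolume k f) := by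
  obtain ⟨C, hC⟩ := isCompact_univ.exists_bound_of_continuousOn hg.continuousOn
  exact hu.bdd_mul hg.aestronglyMeasurable (Eventually.of_forall fun x => hC x (mem_univ x))

include himm

lemma continuous_inner_meanCurvature :
    Continuous fun x => inner ℝ (f x - ξ) (meanCurvature k f x) :=
  (hf.continuous.sub continuous_const).inner (continuous_meanCurvature hf himm)

include hψ

lemma continuous_regularizedField (γ : ℝ) {ε : ℝ} (hε : 0 < ε) :
    Continuous (regularizedField k f ξ γ ψ ε) :=
  ((contMDiff_radialPower hf hε _).continuous.smul (continuous_gradient hf himm hψ)).add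
    (((continuous_const.mul hψ.continuous).mul (contMDiff_radialPower hf hε _).continuous).smul
      (continuous_positionTangent hf himm))

lemma continuous_regularizedPotential (γ : ℝ) {ε : ℝ} (hε : 0 < ε) :
    Continuous (regularizedPotential k f ξ γ ψ ε) :=
  hψ.continuous.mul (((contMDiff_radialPower hf hε _).continuous.mul
    (continuous_const.add (continuous_inner_meanCurvature hf himm))).sub
      ((continuous_const.mul (contMDiff_radialPower hf hε _).continuous).mul
        ((continuous_positionTangent hf himm).norm.pow 2)))

/-- The divergence theorem for the regularized field, where no singularity is present. -/
lemma integral_regularized (γ : ℝ) {ε : ℝ} (hε : 0 < ε) (hu : IsLaplacian k f ψ u)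
    (hui : Integrable u (riemannianVolume k f)) :
    (∫ x, radialPower f ξ ε (-((γ - 2) / 2)) x * u x ∂(riemannianVolume k f)) +
      (γ - 2) * (∫ x, regularizedPotential k f ξ γ ψ ε x ∂(riemannianVolume k f)) =
      ∫ x, inner ℝ (regularizedField k f ξ γ ψ ε x) (outwardConormal k f x)
        ∂(boundaryVolume k f) := by
  have hP := contMDiff_radialPower (k := k) (ξ := ξ) hf hε (-((γ - 2) / 2))
  have hQ : ContMDiff (𝓡∂ k) 𝓘(ℝ, ℝ) 1 (radialPower f ξ ε (-(γ / 2))) :=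
    (contMDiff_radialPower hf hε _).of_le (by simp)
  have hsψ : ContMDiff (𝓡∂ k) 𝓘(ℝ, ℝ) 1 (fun x => (γ - 2) * ψ x) := contMDiff_const.mul hψ
  have hg : ContMDiff (𝓡∂ k) 𝓘(ℝ, ℝ) 1
      (fun x => (γ - 2) * ψ x * radialPower f ξ ε (-(γ / 2)) x) := hsψ.mul hQ
  have hT := continuous_positionTangent (ξ := ξ) hf himm
  have hψc := continuous_gradient hf himm hψ
  have hPu := integrable_continuous_mul hf hP.continuous hui
  have hPc := integrable_of_continuous hf
    ((continuous_gradient hf himm (hP.of_le (by simp))).inner hψc)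
  have hgc := integrable_of_continuous hf (((continuous_gradient hf himm hg).inner hT).add
    (hg.continuous.mul ((continuous_const (y := (k : ℝ))).add (continuous_inner_meanCurvature (ξ := ξ) hf himm))))
  have h := HasWeakDivergence.add hf himm (hP.continuous.smul hψc) (hg.continuous.smul hT)
    (HasWeakDivergence.smul hf himm hψc hu.hasWeakDivergence hu.1 hP)
    (hasWeakDivergence_positionTangent hf himm hg)
    ((hPu.add hPc).locallyIntegrable.locallyIntegrableOn _)
    (hgc.locallyIntegrable.locallyIntegrableOn _)
  have hflux := integral_eq_flux hf himm (continuous_regularizedField (ξ := ξ) hf himm hψ γ hε)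
    (fun x => Submodule.add_mem _
      (Submodule.smul_mem _ _ (gradient_mem_tangentPlane f ψ x))
      (Submodule.smul_mem _ _ (tangentialPart_mem f x _))) h ((hPu.add hPc).add hgc)
  rw [← hflux, ← integral_const_mul, ← integral_add hPu ((integrable_of_continuous hf
    (continuous_regularizedPotential hf himm hψ γ hε)).const_mul _)]
  refine integral_congr_ae (Eventually.of_forall fun x => ?_)
  -- Differentiating the first weight produces the second one, so the two terms in `⟨∇ψ, (f-ξ)^⊤⟩`
  -- cancel.
  have e : -((γ - 2) / 2) - 1 = -(γ / 2) := by ring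
  have hsg : gradient k f (fun x => (γ - 2) * ψ x) x = (γ - 2) • gradient k f ψ x := by
    rw [gradient_mul contMDiff_const hψ, gradient_const, smul_zero, add_zero]
  simp only [regularizedPotential, gradient_mul hsψ hQ, hsg, gradient_radialPower hf himm hε, e,
    inner_add_left, inner_smul_left, RCLike.conj_to_real, real_inner_self_eq_norm_sq,
    real_inner_comm (gradient k f ψ x) (positionTangent k f ξ x)]
  ring

/-- Dominated convergence with majorant `A (B + γ) r^(-γ)`, where `A` bounds `|ψ|` and `B` bounds
`|k + ⟨f - ξ, H⟩|`. -/
lemma tendsto_integral_regularizedPotential {γ : ℝ} (hγ : 0 < γ) (hγk : γ < k) :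
    Tendsto (fun j : ℕ => ∫ x, regularizedPotential k f ξ γ ψ (1 / ((j : ℝ) + 1)) x
        ∂(riemannianVolume k f)) atTop
      (𝓝 (∫ x, ψ x / r f ξ x ^ γ * (k - γ + Φ k f ξ γ x) ∂(riemannianVolume k f))) := by
  have hh := continuous_inner_meanCurvature (ξ := ξ) hf himm
  obtain ⟨A, hA⟩ := isCompact_univ.exists_bound_of_continuousOn hψ.continuous.continuousOn
  obtain ⟨B, hB⟩ := isCompact_univ.exists_bound_of_continuousOn
    ((continuous_const (y := (k : ℝ))).add hh).continuousOn
  refine tendsto_integral_of_dominated_convergence (fun x => A * (B + γ) * (r f ξ x ^ γ)⁻¹)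
    (fun j => (continuous_regularizedPotential hf himm hψ γ (by positivity)).aestronglyMeasurable)
    ((integrable_inv_rpow_r hf himm hγ hγk).const_mul _) (fun j => ?_) ?_
  · filter_upwards [ae_r_pos (ξ := ξ) hf himm] with x hx
    have hε : 0 < 1 / ((j : ℝ) + 1) := by positivity
    have hQ := radialPower_le (f := f) (ξ := ξ) (a := -(γ / 2)) (b := -γ) hε (by linarith)
      (by ring) hx
    rw [Real.rpow_neg hx.le] at hQ
    have hQ0 := radialPower_nonneg (f := f) (ξ := ξ) hε (-(γ / 2)) x
    have hQ1 := radialPower_nonneg (f := f) (ξ := ξ) hε (-(γ / 2) - 1) x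
    have hQ2 := radialPower_add_one (f := f) (ξ := ξ) (a := -(γ / 2) - 1) (b := -(γ / 2)) hε
      (by ring) x
    have hT := norm_positionTangent_sq_le (k := k) f ξ x
    -- The exponent `-(γ/2) - 1` alone would be too singular; the factor `‖(f-ξ)^⊤‖² ≤ r² + ε`
    -- restores one power.
    have h1 : radialPower f ξ (1 / ((j : ℝ) + 1)) (-(γ / 2) - 1) x *
        ‖positionTangent k f ξ x‖ ^ 2 ≤ (r f ξ x ^ γ)⁻¹ := by
      refine le_trans ?_ hQ
      rw [← hQ2]
      exact mul_le_mul_of_nonneg_left (by linarith) hQ1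
    have hA0 : 0 ≤ A := (norm_nonneg _).trans (hA x (mem_univ x))
    have hBx := hB x (mem_univ x)
    rw [regularizedPotential, norm_mul, mul_assoc A]
    refine mul_le_mul (hA x (mem_univ x)) ?_ (norm_nonneg _) hA0
    refine (norm_sub_le _ _).trans ?_
    rw [add_mul]
    refine add_le_add ?_ ?_
    · rw [norm_mul, Real.norm_of_nonneg hQ0, mul_comm B]
      exact mul_le_mul hQ hBx (norm_nonneg _) (hQ0.trans hQ)
    · rw [mul_assoc, norm_mul, Real.norm_of_nonneg hγ.le, Real.norm_of_nonneg (by positivity)]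
      exact mul_le_mul_of_nonneg_left h1 hγ.le
  · filter_upwards [ae_r_pos (ξ := ξ) hf himm] with x hx
    have h1 := tendsto_radialPower (f := f) (ξ := ξ) (a := -(γ / 2)) (b := -γ) (by ring) hx
    have h2 := tendsto_radialPower (f := f) (ξ := ξ) (a := -(γ / 2) - 1) (b := -γ - 2) (by ring) hx
    have h3 := ((h1.mul_const (k + inner ℝ (f x - ξ) (meanCurvature k f x))).sub
      ((h2.const_mul γ).mul_const (‖positionTangent k f ξ x‖ ^ 2))).const_mul (ψ x)
    have h4 : ψ x / r f ξ x ^ γ * (k - γ + Φ k f ξ γ x) =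
        ψ x * (r f ξ x ^ (-γ) * (k + inner ℝ (f x - ξ) (meanCurvature k f x)) -
          γ * r f ξ x ^ (-γ - 2) * ‖positionTangent k f ξ x‖ ^ 2) := by
      rw [Φ_eq γ hx, Real.rpow_sub hx, Real.rpow_neg hx.le, Real.rpow_two]
      have := hx.ne'
      have := (Real.rpow_pos_of_pos hx γ).ne'
      field_simp
      ring
    rw [h4]
    exact h3

variable {R : ℝ} (hR : 0 < R) (hbdry : ∀ x ∈ (𝓡∂ k).boundary M, f x ∈ Metric.sphere ξ R)

include hR hbdry

/-- Since `r = R` on `∂M`, all radial weights are constants there. Both the regularized and the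
limiting flux are combinations of the same two integrals, and only the numbers `a`, `b` have to
converge. -/
lemma integral_boundary_eq (γ a b : ℝ) {Y : M → EuclideanSpace ℝ (Fin n)}
    (hY : ∀ x, r f ξ x = R → Y x = a • gradient k f ψ x +
      ((γ - 2) * b) • (ψ x • positionTangent k f ξ x)) :
    Integrable (fun x => inner ℝ (Y x) (outwardConormal k f x)) (boundaryVolume k f) ∧
    ∫ x, inner ℝ (Y x) (outwardConormal k f x) ∂(boundaryVolume k f) =
      a * (∫ x, inner ℝ (gradient k f ψ x) (outwardConormal k f x) ∂(boundaryVolume k f)) +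
      (γ - 2) * b * (∫ x, inner ℝ (ψ x • positionTangent k f ξ x) (outwardConormal k f x)
        ∂(boundaryVolume k f)) := by
  have hf1 : ContMDiff (𝓡∂ k) 𝓘(ℝ, EuclideanSpace ℝ (Fin n)) 1 f := hf.of_le (by simp)
  have h1 := (integrable_flux hf himm (continuous_gradient hf himm hψ)).const_mul a
  have h2 : Integrable (fun x => (γ - 2) * b *
      inner ℝ (ψ x • positionTangent k f ξ x) (outwardConormal k f x)) (boundaryVolume k f) :=
    (integrable_flux hf himm (hψ.continuous.smul
      (continuous_positionTangent (ξ := ξ) hf himm))).const_mul _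
  have h3 : ∀ᵐ x ∂(boundaryVolume k f), inner ℝ (Y x) (outwardConormal k f x) =
      a * inner ℝ (gradient k f ψ x) (outwardConormal k f x) +
      (γ - 2) * b * inner ℝ (ψ x • positionTangent k f ξ x) (outwardConormal k f x) := by
    filter_upwards [ae_boundaryVolume_mem_boundary hf1] with x hx
    rw [hY x (hbdry x hx), inner_add_left, real_inner_smul_left, real_inner_smul_left _ _ ((γ - 2) * b)]
  refine ⟨(h1.add h2).congr (h3.mono fun x hx => hx.symm), ?_⟩
  rw [integral_congr_ae h3, integral_add h1 h2, integral_const_mul, integral_const_mul]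

lemma tendsto_integral_regularizedField {γ : ℝ} :
    Integrable (fun x => 1 / r f ξ x ^ (γ - 2) * inner ℝ (W k f ξ γ ψ x) (outwardConormal k f x))
      (boundaryVolume k f) ∧
    Tendsto (fun j : ℕ => ∫ x, inner ℝ (regularizedField k f ξ γ ψ (1 / ((j : ℝ) + 1)) x)
        (outwardConormal k f x) ∂(boundaryVolume k f)) atTop
      (𝓝 (∫ x, 1 / r f ξ x ^ (γ - 2) * inner ℝ (W k f ξ γ ψ x) (outwardConormal k f x)
        ∂(boundaryVolume k f))) := by
  have hW := integral_boundary_eq (ψ := ψ) hf himm hψ hR hbdry γ (1 / R ^ (γ - 2))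
    (1 / R ^ (γ - 2) * (1 / R ^ 2))
    (Y := fun x => (1 / r f ξ x ^ (γ - 2)) • W k f ξ γ ψ x) (fun x hx => by
      rw [W_eq, hx, smul_add, smul_smul, smul_smul]
      congr 2
      ring)
  simp only [real_inner_smul_left (W k f ξ γ ψ _)] at hW
  refine ⟨hW.1, ?_⟩
  rw [hW.2]
  have hj : ∀ j : ℕ, ∫ x, inner ℝ (regularizedField k f ξ γ ψ (1 / ((j : ℝ) + 1)) x)
      (outwardConormal k f x) ∂(boundaryVolume k f) = _ := fun j =>
    (integral_boundary_eq (ψ := ψ) hf himm hψ hR hbdry γ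
      ((R ^ 2 + 1 / ((j : ℝ) + 1)) ^ (-((γ - 2) / 2))) ((R ^ 2 + 1 / ((j : ℝ) + 1)) ^ (-(γ / 2)))
      (Y := regularizedField k f ξ γ ψ (1 / ((j : ℝ) + 1))) (fun x hx => by
        rw [regularizedField, radialPower, radialPower, hx, smul_smul]
        congr 2
        ring)).2
  simp_rw [hj]
  have hlim : Tendsto (fun j : ℕ => R ^ 2 + 1 / ((j : ℝ) + 1)) atTop (𝓝 (R ^ 2)) := by
    simpa using tendsto_one_div_add_atTop_nhds_zero_nat.const_add (R ^ 2)
  have h1 : ∀ a b : ℝ, 2 * a = b → Tendsto (fun j : ℕ => (R ^ 2 + 1 / ((j : ℝ) + 1)) ^ a) atTop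
      (𝓝 (R ^ b)) := by
    intro a b hab
    rw [← hab, Real.rpow_mul hR.le, Real.rpow_two]
    exact hlim.rpow_const (Or.inl (by positivity))
  have e1 : 1 / R ^ (γ - 2) = R ^ (-(γ - 2)) := by rw [Real.rpow_neg hR.le, one_div]
  have e2 : 1 / R ^ (γ - 2) * (1 / R ^ 2) = R ^ (-γ) := by
    rw [e1, one_div, ← Real.rpow_two, ← Real.rpow_neg hR.le, ← Real.rpow_add hR]
    congr 1
    ring
  rw [e2, e1]
  exact ((h1 (-((γ - 2) / 2)) (-(γ - 2)) (by ring)).mul_const _).add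
    (((h1 (-(γ / 2)) (-γ) (by ring)).const_mul _).mul_const _)

/-- The identity behind the Rellich inequality. -/
theorem integral_laplacian_identity {γ : ℝ} (hγ : 2 < γ) (hγk : γ < k) (hu : IsLaplacian k f ψ u)
    (hui : Integrable u (riemannianVolume k f))
    (hur : Integrable (fun x => u x / r f ξ x ^ (γ - 2)) (riemannianVolume k f)) :
    (∫ x, u x / r f ξ x ^ (γ - 2) ∂(riemannianVolume k f)) +
      (γ - 2) * (∫ x, ψ x / r f ξ x ^ γ * (k - γ + Φ k f ξ γ x) ∂(riemannianVolume k f)) =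
      ∫ x, 1 / r f ξ x ^ (γ - 2) * inner ℝ (W k f ξ γ ψ x) (outwardConormal k f x)
        ∂(boundaryVolume k f) := by
  have h1 : Tendsto (fun j : ℕ => ∫ x, radialPower f ξ (1 / ((j : ℝ) + 1)) (-((γ - 2) / 2)) x * u x
      ∂(riemannianVolume k f)) atTop
      (𝓝 (∫ x, u x / r f ξ x ^ (γ - 2) ∂(riemannianVolume k f))) := by
    refine tendsto_integral_of_dominated_convergence (fun x => ‖u x / r f ξ x ^ (γ - 2)‖)
      (fun j => ?_) hur.norm (fun j => ?_) ?_
    · exact (contMDiff_radialPower (k := k) hf (by positivity) _).continuous.aestronglyMeasurable.mul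
        hui.aestronglyMeasurable
    · filter_upwards [ae_r_pos (ξ := ξ) hf himm] with x hx
      have hε : 0 < 1 / ((j : ℝ) + 1) := by positivity
      rw [div_rpow_eq hx, norm_mul, norm_mul, Real.norm_of_nonneg (radialPower_nonneg hε _ x),
        Real.norm_of_nonneg (Real.rpow_nonneg hx.le _)]
      exact mul_le_mul_of_nonneg_right (radialPower_le hε (by linarith) (by ring) hx)
        (norm_nonneg _)
    · filter_upwards [ae_r_pos (ξ := ξ) hf himm] with x hx
      rw [div_rpow_eq hx]
      exact (tendsto_radialPower (by ring) hx).mul_const _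
  refine tendsto_nhds_unique (h1.add
    ((tendsto_integral_regularizedPotential hf himm hψ (by linarith) hγk).const_mul (γ - 2))) ?_
  refine (tendsto_integral_regularizedField hf himm hψ hR hbdry).2.congr fun j => ?_
  exact (integral_regularized hf himm hψ γ (by positivity) hu hui).symm

/-- A nonpositive Laplacian is integrable against the singular weight. -/
theorem integrable_laplacian_div_of_nonpos {γ : ℝ} (hγ : 2 < γ) (hγk : γ < k)
    (hu : IsLaplacian k f ψ u) (hu0 : ∀ᵐ x ∂(riemannianVolume k f), u x ≤ 0) :
    Integrable u (riemannianVolume k f) ∧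
    Integrable (fun x => u x / r f ξ x ^ (γ - 2)) (riemannianVolume k f) := by
  have hui : Integrable u (riemannianVolume k f) :=
    integrable_of_hasWeakDivergence hf himm (continuous_gradient hf himm hψ)
      (gradient_mem_tangentPlane f ψ) hu.hasWeakDivergence hu.1 hu0
  refine ⟨hui, ?_⟩
  -- By the regularized identity this difference equals `-∫ (r² + ε)^(-(γ-2)/2) Δψ`. It converges,
  -- so it is bounded, and Fatou's lemma applies as `ε → 0`.
  have hlim := (((tendsto_integral_regularizedPotential (ξ := ξ) hf himm hψ (by linarith)
    hγk).const_mul (γ - 2)).sub (tendsto_integral_regularizedField (γ := γ) hf himm hψ hR hbdry).2)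
  obtain ⟨C, hC⟩ := hlim.bddAbove_range
  have h := integrable_of_tendsto_of_integral_le
    (v := fun (j : ℕ) x => -(radialPower f ξ (1 / ((j : ℝ) + 1)) (-((γ - 2) / 2)) x * u x))
    (w := fun x => -(u x / r f ξ x ^ (γ - 2))) (μ := riemannianVolume k f) (C := C)
    (fun j => (integrable_continuous_mul hf
      (contMDiff_radialPower hf (by positivity) _).continuous hui).neg) (fun j => ?_)
    (fun j => ?_) ?_
  · exact h.neg.congr (Eventually.of_forall fun x => neg_neg _)
  · filter_upwards [hu0] with x hx
    exact neg_nonneg.2 (mul_nonpos_of_nonneg_of_nonpos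
      (radialPower_nonneg (by positivity) _ x) hx)
  · have h1 := integral_regularized (ξ := ξ) hf himm hψ γ
      (show 0 < 1 / ((j : ℝ) + 1) by positivity) hu hui
    rw [integral_neg]
    refine le_trans (le_of_eq ?_) (hC ⟨j, rfl⟩)
    linear_combination -h1
  · filter_upwards [ae_r_pos (ξ := ξ) hf himm] with x hx
    rw [div_rpow_eq hx]
    exact ((tendsto_radialPower (by ring) hx).mul_const _).neg

end ImmersedManifold

end

noncomputable section

/-! ### Convergence of the singular integrals -/

namespace ImmersedManifold

open Filter Topology

variable {k n : ℕ} [NeZero k] {M : Type*} [TopologicalSpace M]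
  [ChartedSpace (EuclideanHalfSpace k) M] [IsManifold (𝓡∂ k) ∞ M]
  {f : M → EuclideanSpace ℝ (Fin n)} {ξ : EuclideanSpace ℝ (Fin n)}
  (hf : ContMDiff (𝓡∂ k) 𝓘(ℝ, EuclideanSpace ℝ (Fin n)) ∞ f)
  (himm : ∀ x, Function.Injective (mfderiv (𝓡∂ k) 𝓘(ℝ, EuclideanSpace ℝ (Fin n)) f x))
  [MeasurableSpace M] [BorelSpace M] [CompactSpace M] [T2Space M]

include hf himm

/-- `Φ` need not be continuous where `r = 0`; off that null set it equals a quotient of continuous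
functions plus a continuous one. -/
lemma aestronglyMeasurable_Φ (γ : ℝ) :
    AEStronglyMeasurable (Φ k f ξ γ) (riemannianVolume k f) := by
  have hT := continuous_positionTangent (ξ := ξ) hf himm
  have h : Measurable fun x => γ * (1 - ‖positionTangent k f ξ x‖ ^ 2 / r f ξ x ^ 2) +
      inner ℝ (f x - ξ) (meanCurvature k f x) :=
    ((((hT.norm.pow 2).measurable.div ((continuous_r hf).pow 2).measurable).const_sub 1).const_mul
      γ).add (continuous_inner_meanCurvature hf himm).measurable
  refine h.aestronglyMeasurable.congr ?_
  filter_upwards [ae_r_pos (ξ := ξ) hf himm] with x hx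
  exact (Φ_eq γ hx).symm

lemma exists_abs_Φ_le {γ : ℝ} (hγ : 0 ≤ γ) :
    ∃ C, ∀ᵐ x ∂(riemannianVolume k f), |Φ k f ξ γ x| ≤ C := by
  obtain ⟨B, hB⟩ := isCompact_univ.exists_bound_of_continuousOn
    (continuous_inner_meanCurvature (ξ := ξ) hf himm).continuousOn
  refine ⟨γ + B, ?_⟩
  filter_upwards [ae_r_pos (ξ := ξ) hf himm] with x hx
  have h1 : ‖positionTangent k f ξ x‖ ^ 2 / r f ξ x ^ 2 ≤ 1 :=
    div_le_one_of_le₀ (norm_positionTangent_sq_le f ξ x) (sq_nonneg _)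
  have h2 : 0 ≤ ‖positionTangent k f ξ x‖ ^ 2 / r f ξ x ^ 2 := by positivity
  rw [Φ_eq γ hx]
  refine (abs_add_le _ _).trans (add_le_add ?_ (hB x (mem_univ x)))
  rw [abs_of_nonneg (mul_nonneg hγ (by linarith))]
  exact mul_le_of_le_one_right hγ (by linarith)

lemma integrable_div_rpow_mul {γ : ℝ} (hγ : 0 < γ) (hγk : γ < k) {ψ b : M → ℝ}
    (hψ : Continuous ψ) (hb : AEStronglyMeasurable b (riemannianVolume k f)) {C : ℝ}
    (hC : ∀ᵐ x ∂(riemannianVolume k f), |b x| ≤ C) :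
    Integrable (fun x => ψ x / r f ξ x ^ γ * b x) (riemannianVolume k f) := by
  have h := integrable_continuous_mul hf hψ (integrable_inv_rpow_r (ξ := ξ) hf himm hγ hγk)
  have h2 := h.bdd_mul hb hC
  refine h2.congr (Eventually.of_forall fun x => ?_)
  simp only [div_eq_mul_inv]
  ring

/-- As `s ≥ 0` and `M` is compact, `r^s` is bounded; multiplying it back removes the weight. -/
lemma integrable_of_integrable_abs_div {s : ℝ} (hs : 0 ≤ s) {u : M → ℝ}
    (hm : AEStronglyMeasurable u (riemannianVolume k f))
    (hi : Integrable (fun x => |u x| / r f ξ x ^ s) (riemannianVolume k f)) :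
    Integrable u (riemannianVolume k f) ∧
      Integrable (fun x => u x / r f ξ x ^ s) (riemannianVolume k f) := by
  have hrc := continuous_r (ξ := ξ) hf
  have hrm : AEStronglyMeasurable (fun x => (r f ξ x ^ s)⁻¹) (riemannianVolume k f) :=
    (hrc.measurable.pow_const s).inv.aestronglyMeasurable
  have hur : Integrable (fun x => u x / r f ξ x ^ s) (riemannianVolume k f) := by
    have hum : AEStronglyMeasurable (fun x => u x / r f ξ x ^ s) (riemannianVolume k f) := by
      simp_rw [div_eq_mul_inv]
      exact hm.mul hrm
    refine hi.mono hum (Eventually.of_forall fun x => ?_)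
    rw [norm_div, norm_div, Real.norm_eq_abs (u x), Real.norm_eq_abs |u x|, abs_abs]
  refine ⟨?_, hur⟩
  have h := integrable_continuous_mul hf (hrc.rpow_const fun x => Or.inr hs) hur
  refine h.congr ?_
  filter_upwards [ae_r_pos (ξ := ξ) hf himm] with x hx
  exact mul_div_cancel₀ _ (Real.rpow_pos_of_pos hx s).ne'

end ImmersedManifold

end

/-! ### The equality case of the Rellich inequality. -/

open ImmersedManifold in
theorem mainTheorem9 {k n : ℕ} [NeZero k] {M : Type*} [TopologicalSpace M] [T2Space M]
    [CompactSpace M] [MeasurableSpace M] [BorelSpace M]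
    [ChartedSpace (EuclideanHalfSpace k) M] [IsManifold (𝓡∂ k) ∞ M]
    (f : M → EuclideanSpace ℝ (Fin n))
    (hf : ContMDiff (𝓡∂ k) 𝓘(ℝ, EuclideanSpace ℝ (Fin n)) ∞ f)
    (himm : ∀ x, Function.Injective (mfderiv (𝓡∂ k) 𝓘(ℝ, EuclideanSpace ℝ (Fin n)) f x))
    (ξ : EuclideanSpace ℝ (Fin n)) (R : ℝ) (hR : 0 < R)
    (hbdry : ∀ x ∈ (𝓡∂ k).boundary M, f x ∈ Metric.sphere ξ R)
    (γ : ℝ) (hγ : 2 < γ) (hγk : γ < k)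
    (ψ : M → ℝ) (hψ : ContMDiff (𝓡∂ k) 𝓘(ℝ, ℝ) 1 ψ) (hψ0 : ∀ x, 0 ≤ ψ x)
    (Δψ : M → ℝ) (hΔψ : IsLaplacian k f ψ Δψ) :
    Integrable (fun x => ψ x / r f ξ x ^ γ) (riemannianVolume k f) ∧
    Integrable (fun x => ψ x / r f ξ x ^ γ * (Φ k f ξ γ x)⁺) (riemannianVolume k f) ∧
    Integrable (fun x => ψ x / r f ξ x ^ γ * (Φ k f ξ γ x)⁻) (riemannianVolume k f) ∧
    Integrable (fun x => 1 / r f ξ x ^ (γ - 2) * inner ℝ (W k f ξ γ ψ x) (outwardConormal k f x))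
      (boundaryVolume k f) ∧
    ((Integrable (fun x => |Δψ x| / r f ξ x ^ (γ - 2)) (riemannianVolume k f) ∧
      (γ - 2) * (k - γ) * (∫ x, ψ x / r f ξ x ^ γ ∂(riemannianVolume k f))
          + (γ - 2) * (∫ x, ψ x / r f ξ x ^ γ * (Φ k f ξ γ x)⁺ ∂(riemannianVolume k f))
        = (∫ x, |Δψ x| / r f ξ x ^ (γ - 2) ∂(riemannianVolume k f))
          + (γ - 2) * (∫ x, ψ x / r f ξ x ^ γ * (Φ k f ξ γ x)⁻ ∂(riemannianVolume k f))
          + (∫ x, 1 / r f ξ x ^ (γ - 2) * inner ℝ (W k f ξ γ ψ x) (outwardConormal k f x)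
              ∂(boundaryVolume k f))) ↔
      ∀ᵐ x ∂(riemannianVolume k f), Δψ x ≤ 0) := by
  have hγ0 : 0 < γ := by linarith
  have hpos := ae_r_pos (ξ := ξ) hf himm
  have hΦ := aestronglyMeasurable_Φ (ξ := ξ) hf himm γ
  obtain ⟨C, hC⟩ := exists_abs_Φ_le (ξ := ξ) hf himm hγ0.le
  have hA : Integrable (fun x => ψ x / r f ξ x ^ γ) (riemannianVolume k f) := by
    have := integrable_div_rpow_mul (ξ := ξ) hf himm hγ0 hγk hψ.continuous (b := fun _ => 1)
      aestronglyMeasurable_const (C := 1) (Filter.Eventually.of_forall fun _ => by simp)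
    simpa only [mul_one] using this
  have hB₁ : Integrable (fun x => ψ x / r f ξ x ^ γ * (Φ k f ξ γ x)⁺) (riemannianVolume k f) := by
    refine integrable_div_rpow_mul hf himm hγ0 hγk hψ.continuous (C := C)
      (continuous_id.sup continuous_const |>.comp_aestronglyMeasurable hΦ) ?_
    filter_upwards [hC] with x hx
    rw [abs_of_nonneg (posPart_nonneg _)]
    exact (sup_le (le_abs_self _) (abs_nonneg _)).trans hx
  have hB₂ : Integrable (fun x => ψ x / r f ξ x ^ γ * (Φ k f ξ γ x)⁻) (riemannianVolume k f) := by
    refine integrable_div_rpow_mul hf himm hγ0 hγk hψ.continuous (C := C)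
      (continuous_neg.sup continuous_const |>.comp_aestronglyMeasurable hΦ) ?_
    filter_upwards [hC] with x hx
    rw [abs_of_nonneg (negPart_nonneg _)]
    exact (sup_le (neg_le_abs _) (abs_nonneg _)).trans hx
  -- Separates `Φ = Φ⁺ - Φ⁻`, to bring the identity into the shape of the inequality.
  have hsplit : ∫ x, ψ x / r f ξ x ^ γ * (k - γ + Φ k f ξ γ x) ∂(riemannianVolume k f) =
      (k - γ) * (∫ x, ψ x / r f ξ x ^ γ ∂(riemannianVolume k f)) +
        (∫ x, ψ x / r f ξ x ^ γ * (Φ k f ξ γ x)⁺ ∂(riemannianVolume k f)) -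
        ∫ x, ψ x / r f ξ x ^ γ * (Φ k f ξ γ x)⁻ ∂(riemannianVolume k f) := by
    have hA' := hA.const_mul ((k : ℝ) - γ)
    have hAB : Integrable (fun x => (k - γ) * (ψ x / r f ξ x ^ γ) +
        ψ x / r f ξ x ^ γ * (Φ k f ξ γ x)⁺) (riemannianVolume k f) := hA'.add hB₁
    rw [← integral_const_mul, ← integral_add hA' hB₁, ← integral_sub hAB hB₂]
    refine integral_congr_ae (Filter.Eventually.of_forall fun x => ?_)
    have h := posPart_sub_negPart (Φ k f ξ γ x)
    linear_combination -(ψ x / r f ξ x ^ γ) * h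
  have hWi := (tendsto_integral_regularizedField (γ := γ) hf himm hψ hR hbdry).1
  refine ⟨hA, hB₁, hB₂, hWi, ?_, fun hΔ0 => ?_⟩
  · rintro ⟨hΔi, heq⟩
    obtain ⟨hui, hur⟩ := integrable_of_integrable_abs_div hf himm (by linarith : 0 ≤ γ - 2)
      (hΔψ.aestronglyMeasurable hf) hΔi
    have hid := integral_laplacian_identity hf himm hψ hR hbdry hγ hγk hΔψ hui hur
    rw [hsplit] at hid
    -- The assumed equality and the identity differ only in `|Δψ|` against `-Δψ`, so subtracting
    -- them leaves the integral of a nonnegative function.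
    have hsum : ∫ x, (|Δψ x| / r f ξ x ^ (γ - 2) + Δψ x / r f ξ x ^ (γ - 2))
        ∂(riemannianVolume k f) = 0 := by
      rw [integral_add hΔi hur]
      linear_combination hid - heq
    have hnn : 0 ≤ᵐ[riemannianVolume k f] fun x =>
        |Δψ x| / r f ξ x ^ (γ - 2) + Δψ x / r f ξ x ^ (γ - 2) := by
      refine Filter.Eventually.of_forall fun x => ?_
      have h1 := Real.rpow_nonneg (r_nonneg f ξ x) (γ - 2)
      have h2 := neg_le_abs (Δψ x)
      have h3 : 0 ≤ (|Δψ x| + Δψ x) / r f ξ x ^ (γ - 2) := div_nonneg (by linarith) h1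
      rwa [add_div] at h3
    filter_upwards [(integral_eq_zero_iff_of_nonneg_ae hnn (hΔi.add hur)).1 hsum, hpos]
      with x hx hxr
    rw [Pi.zero_apply, ← add_div, div_eq_zero_iff] at hx
    have h1 := hx.resolve_right (Real.rpow_pos_of_pos hxr _).ne'
    have h2 := abs_nonneg (Δψ x)
    linarith
  -- The sign alone supplies the missing integrability; after that `|Δψ| = -Δψ` and the identity is
  -- the claimed equality.
  · obtain ⟨hui, hur⟩ := integrable_laplacian_div_of_nonpos hf himm hψ hR hbdry hγ hγk hΔψ hΔ0
    have hid := integral_laplacian_identity hf himm hψ hR hbdry hγ hγk hΔψ hui hur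
    rw [hsplit] at hid
    have habs : (fun x => |Δψ x| / r f ξ x ^ (γ - 2)) =ᵐ[riemannianVolume k f]
        fun x => -(Δψ x / r f ξ x ^ (γ - 2)) := by
      filter_upwards [hΔ0] with x hx
      rw [abs_of_nonpos hx, neg_div]
    refine ⟨hur.neg.congr habs.symm, ?_⟩
    rw [integral_congr_ae habs, integral_neg]
    linear_combination hid
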